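/- Work in the algebra $\mathbb{C}((z^{-1}))$ of formal Laurent series $\sum_{k\le N}a_kz^k$; the order of a nonzero series is its highest exponent. For $m\ge 0$ let $S_m=\{-m,-m+2,\dots,m,m+1,m+2,\dots\}$, and let the Birkhoff stratum $\Sigma_m$ of $\mathrm{Gr}^{(2)}$ be the set of subspaces $V$ with $z^2V\subset V$ whose nonzero elements have exactly the orders in $S_m$. Let $n\ge 2$ and $T=S_{2n}\cap\mathbb{Z}_{\ge0}=\{0,2,\dots,2n,2n+1,2n+2,\dots\}$. For parameters $H=(H^j_k)$ put $$p_j(z)=z^j+\sum_{k:\ -k\notin T,\ -k<j}H^j_kz^{-k}\quad(j\in T),\qquad U_H=\operatorname{span}\{p_j: j\in T\}.$$ Let $W_{2n}$ be the set of all $U_H$ whose parameters satisfy $$H^{2m}_k=0\ (m\ge0;\ k=-2n+1,-2n+3,\dots,-1\text{ and }k=1,2,3,\dots),\qquad H^{2m+1}_{2k}=0\ (m\ge 0,\ k\ge -n),$$ $$H^{2j+1}_{2(l+k)+1}-H^{2(j+k)+1}_{2l+1}-\sum_{s=-n}^{k-n-1}H^{2j+1}_{2s+1}H^{2(k-s)-1}_{2l+1}=0\quad(j\ge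 n,\ k\ge0,\ l\ge-n),$$ $$H^{2j+1}_{2(l+k)+1}+H^{2k+1}_{2(l+j)+1}+\sum_{s=-n}^{-1}H^{2j+1}_{2s+1}H^{2k+1}_{2(l-s)-1}+\sum_{r=-n}^{-1}H^{2k+1}_{2r+1}H^{2j+1}_{2(l-r)-1}+\sum_{s=0}^{l-1}H^{2j+1}_{2s+1}H^{2k+1}_{2(l-s)-1}=0\quad(j,k\ge n,\ l\ge1).$$ 1. Consider the subspaces $U$ of members of $\Sigma_{2n}$ whose nonzero elements have exactly the orders in $T$. Then $W_{2n}$ is the largest set of such subspaces all of whose members satisfy $U\cdot U\subset U$ and $z^2U\subset U$. Moreover, if $U\in W_{2n}$ and $U\subset V\in\Sigma_{2n}$, then $U$ is maximal among the multiplicatively closed subspaces of $V$. The members of $W_{2n}$ are parametrized bijectively by the $2n+1$ arbitrary complex numbers $H^{2n+1}_{-2n+1},H^{2n+1}_{-2n+3},\dots,H^{2n+1}_{2n+1}$. 2. Let $U_H\in W_{2n}$, with $H$ satisfying the constraints. The $p_j$, $j\in T$, form a basis of $U_H$, and $p_{2m}=z^{2m}$. The space $U_H$ is an infinite-dimensional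 commutative associative unital algebra, and $\lambda\mapsto z^2$, $p_{2n+1}\mapsto p_{2n+1}(z)$ induces an isomorphism of algebras $$\mathbb{C}[\lambda,p_{2n+1}]/(C_{2n+1})\cong U_H,\qquad C_{2n+1}=p_{2n+1}^2-P(\lambda),\quad P(\lambda)=\lambda^{2n+1}+\sum_{s=0}^{2n}u_s\lambda^s,$$ $$u_s=2H^{2n+1}_{2(n-s)+1}+\sum_{k=-n}^{n-s-1}H^{2n+1}_{2k+1}H^{2n+1}_{-2(s+k)-1}.$$ 3. For such $H$ there are monic polynomials $\alpha_m\in\mathbb{C}[\lambda]$ of degree $m-n$ ($m>n$) with $p_{2m+1}(z)=\alpha_m(z^2)\,p_{2n+1}(z)$. In the affine space with coordinates $\lambda,p_{2n+1},p_{2n+3},\dots$ (and $p_{2i}:=\lambda^i$) let $\Gamma_{2n}$ be the variety defined by the relations $p_jp_k=\sum_lC^l_{jk}p_l$ ($j,k\in T$), where the constants $C_{jk}^l$ are the structure constants of $U_H$ in the basis $(p_j)$. The ideal $$\langle C_{2n+1},\ p_{2m+1}-\alpha_m(\lambda)p_{2n+1}\ (m>n)\rangle$$ is the ideal generated by these relations,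 the ideal of all polynomials vanishing on $\Gamma_{2n}$, and the ideal of all polynomial relations between the series $z^2,p_{2n+1}(z),p_{2n+3}(z),\dots$. 4. For such $H$ the curve $C_{2n+1}=0$ is integral, its function field is a quadratic extension of $\mathbb{C}(\lambda)$, and its completion, glued from the charts with coordinates $(\lambda,p_{2n+1})$ and $(\lambda^{-1},p_{2n+1}\lambda^{-n-1})$, has arithmetic genus $n$. The affine curve is nonsingular if and only if $P$ is squarefree, and if and only if it is a hyperelliptic curve of (geometric) genus $n$. -/

import Mathlib

noncomputable section

/-! ### Formal Laurent series in `z` with finitely many positive powers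

`LaurentSeries ℂ` is used in the variable `1 / z`: the coefficient of `z ^ k` in `f` is
`f.coeff (-k)`, and the order in `z` of a nonzero `f` is `-f.order`. -/

/-- The usual `ℂ`-algebra structure, by coefficientwise scalar multiplication. (Instance search
would otherwise find the one inherited from power series, whose scalar multiplication is equal to
this one only by a lemma.) -/
instance (priority := high) laurentAlgebra : Algebra ℂ (LaurentSeries ℂ) := HahnSeries.instAlgebra

/-- The monomial `z ^ k`. -/
def zPow (k : ℤ) : LaurentSeries ℂ := HahnSeries.single (-k) 1

/-- The set of orders in `z` of the nonzero elements of a subspace. -/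
def zOrders (V : Submodule ℂ (LaurentSeries ℂ)) : Set ℤ :=
  {k | ∃ f ∈ V, f ≠ 0 ∧ -f.order = k}

/-- `z ^ 2 * V ⊆ V`. -/
def ZSqStable (V : Submodule ℂ (LaurentSeries ℂ)) : Prop := ∀ f ∈ V, zPow 2 * f ∈ V

/-- `S_m = {-m, -m+2, …, m, m+1, m+2, …}`. -/
def orderSet (m : ℕ) : Set ℤ := {k | (m : ℤ) ≤ k ∨ (-(m : ℤ) ≤ k ∧ Even (k + m))}

/-- The Birkhoff stratum `Σ_m` of `Gr⁽²⁾`: the subspaces `V` with `z ^ 2 * V ⊆ V` whose elements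
have exactly the orders `S_m`. -/
def birkhoffStratum (m : ℕ) : Set (Submodule ℂ (LaurentSeries ℂ)) :=
  {V | zOrders V = orderSet m ∧ ZSqStable V}

/-- The nonnegative part `{0, 2, …, 2n, 2n+1, 2n+2, …}` of `S_{2n}`. -/
def nonnegOrders (n : ℕ) : Set ℤ := {k | k ∈ orderSet (2 * n) ∧ 0 ≤ k}

/-- The subspaces of points of `Σ_{2n}` that have one basis element for each nonnegative order of
`S_{2n}` (and no element of negative order). -/
def nonnegParts (n : ℕ) : Set (Submodule ℂ (LaurentSeries ℂ)) :=
  {U | zOrders U = nonnegOrders n ∧ ∃ V ∈ birkhoffStratum (2 * n), U ≤ V}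

/-! ### The canonical basis and its parameters -/

open Classical in
/-- `p_j = z ^ j + ∑ H^j_k z ^ (-k)`, the sum running over all `k` such that `-k < j` and `-k` is
not one of the orders `0, 2, …, 2n, 2n+1, 2n+2, …`; here `H j k` stands for `H^j_k`. -/
def canonicalSeries (n : ℕ) (H : ℤ → ℤ → ℂ) (j : ℤ) : LaurentSeries ℂ :=
  HahnSeries.ofSuppBddBelow
    (fun k : ℤ => if k = -j then 1 else if -k ∉ nonnegOrders n ∧ -k < j then H j k else 0)
    ⟨-j, fun k hk => by
      by_contra hlt
      apply hk
      simp only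
      rw [if_neg (by omega), if_neg (by rintro ⟨-, h⟩; omega)]⟩

/-- The vector space with basis `p_j`, `j = 0, 2, …, 2n, 2n+1, 2n+2, …`. -/
def spanSeries (n : ℕ) (H : ℤ → ℤ → ℂ) : Submodule ℂ (LaurentSeries ℂ) :=
  Submodule.span ℂ (Set.range fun j : nonnegOrders n => canonicalSeries n H j)

/-- The linear constraints: `H^{2m}_k = 0` for `k = -2n+1, -2n+3, …, -1` and `k = 1, 2, 3, …`,
and `H^{2m+1}_{2k} = 0` for `k ≥ -n`. -/
def LinearConstraints (n : ℕ) (H : ℤ → ℤ → ℂ) : Prop :=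
  (∀ m k : ℤ, 0 ≤ m → (1 ≤ k ∨ (-2 * (n : ℤ) + 1 ≤ k ∧ Odd k)) → H (2 * m) k = 0) ∧
  (∀ m k : ℤ, 0 ≤ m → -(n : ℤ) ≤ k → H (2 * m + 1) (2 * k) = 0)

/-- The quadratic constraints on the `H^{2j+1}_{2l+1}`. -/
def QuadraticConstraints (n : ℕ) (H : ℤ → ℤ → ℂ) : Prop :=
  (∀ j k l : ℤ, (n : ℤ) ≤ j → 0 ≤ k → -(n : ℤ) ≤ l →
    H (2 * j + 1) (2 * (l + k) + 1) - H (2 * (j + k) + 1) (2 * l + 1)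
      - ∑ s ∈ Finset.Icc (-(n : ℤ)) (k - n - 1),
          H (2 * j + 1) (2 * s + 1) * H (2 * (k - s) - 1) (2 * l + 1) = 0) ∧
  (∀ j k l : ℤ, (n : ℤ) ≤ j → (n : ℤ) ≤ k → 1 ≤ l →
    H (2 * j + 1) (2 * (l + k) + 1) + H (2 * k + 1) (2 * (l + j) + 1)
      + ∑ s ∈ Finset.Icc (-(n : ℤ)) (-1),
          H (2 * j + 1) (2 * s + 1) * H (2 * k + 1) (2 * (l - s) - 1)
      + ∑ r ∈ Finset.Icc (-(n : ℤ)) (-1),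
          H (2 * k + 1) (2 * r + 1) * H (2 * j + 1) (2 * (l - r) - 1)
      + ∑ s ∈ Finset.Icc (0 : ℤ) (l - 1),
          H (2 * j + 1) (2 * s + 1) * H (2 * k + 1) (2 * (l - s) - 1) = 0)

/-- All constraints. -/
def Admissible (n : ℕ) (H : ℤ → ℤ → ℂ) : Prop :=
  LinearConstraints n H ∧ QuadraticConstraints n H

/-- The subset `W_{2n}`: the spaces `⟨p_j⟩` whose parameters obey the constraints. -/
def hyperellipticSubset (n : ℕ) : Set (Submodule ℂ (LaurentSeries ℂ)) :=
  {U | ∃ H, Admissible n H ∧ U = spanSeries n H}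

/-! ### The curve `C_{2n+1}` -/

/-- The coefficient `u_s`. -/
def uCoeff (n : ℕ) (H : ℤ → ℤ → ℂ) (s : ℕ) : ℂ :=
  2 * H (2 * n + 1) (2 * ((n : ℤ) - s) + 1) +
    ∑ k ∈ Finset.Icc (-(n : ℤ)) ((n : ℤ) - s - 1),
      H (2 * n + 1) (2 * k + 1) * H (2 * n + 1) (-2 * (s + k) - 1)

/-- `λ ^ (2n+1) + ∑_{k ≤ 2n} u_k λ ^ k`. -/
def branchPoly (n : ℕ) (H : ℤ → ℤ → ℂ) : Polynomial ℂ :=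
  Polynomial.X ^ (2 * n + 1) +
    ∑ k ∈ Finset.range (2 * n + 1), Polynomial.C (uCoeff n H k) * Polynomial.X ^ k

/-- `C_{2n+1} = p_{2n+1} ^ 2 - λ ^ (2n+1) - ∑_{k ≤ 2n} u_k λ ^ k` in `ℂ[λ, p_{2n+1}]`, where
`λ = X 0` and `p_{2n+1} = X 1`. -/
def curvePoly (n : ℕ) (H : ℤ → ℤ → ℂ) : MvPolynomial (Fin 2) ℂ :=
  MvPolynomial.X 1 ^ 2 - Polynomial.aeval (MvPolynomial.X 0) (branchPoly n H)

/-- `ℂ[λ, p_{2n+1}] / C_{2n+1}`. -/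
abbrev CurveRing (n : ℕ) (H : ℤ → ℤ → ℂ) : Type :=
  MvPolynomial (Fin 2) ℂ ⧸ Ideal.span {curvePoly n H}

/-- The class of `λ` in the coordinate ring. -/
def CurveRing.lam (n : ℕ) (H : ℤ → ℤ → ℂ) : CurveRing n H :=
  Ideal.Quotient.mk _ (MvPolynomial.X 0)

/-- The class of `p_{2n+1}` in the coordinate ring. -/
def CurveRing.p (n : ℕ) (H : ℤ → ℤ → ℂ) : CurveRing n H :=
  Ideal.Quotient.mk _ (MvPolynomial.X 1)

/-! ### The variety in the affine space with coordinates `λ, p_{2n+1}, p_{2n+3}, …` -/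

/-- The coordinates `λ` and `p_{2m+1}`, `m ≥ n`. -/
inductive Coord (n : ℕ) : Type
  | lam : Coord n
  | odd : {m : ℕ // n ≤ m} → Coord n

/-- The coordinate function of the basis element `p_j`: `λ ^ i` if `j = 2 * i`, and the coordinate
`p_{2m+1}` if `j = 2 * m + 1`. -/
def coordFun (n : ℕ) (j : nonnegOrders n) : MvPolynomial (Coord n) ℂ :=
  if h : Even (j : ℤ) then MvPolynomial.X Coord.lam ^ ((j : ℤ) / 2).toNat
  else MvPolynomial.X (Coord.odd ⟨((j : ℤ) / 2).toNat, by
    obtain ⟨j, hj, h0⟩ := j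
    change ¬ Even j at h
    change n ≤ (j / 2).toNat
    rw [Int.not_even_iff] at h
    rcases hj with hj | ⟨-, hj⟩
    · push_cast at hj; omega
    · rw [Int.even_iff] at hj; push_cast at hj; omega⟩)

/-- The quadrics `p_j p_k - ∑_l C_{jk}^l p_l`, where the constants `C_{jk}^l` are those for which
the Laurent series satisfy `p_j(z) p_k(z) = ∑_l C_{jk}^l p_l(z)`. -/
def relationSet (n : ℕ) (H : ℤ → ℤ → ℂ) : Set (MvPolynomial (Coord n) ℂ) :=
  {F | ∃ (j k : nonnegOrders n) (c : nonnegOrders n →₀ ℂ),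
    canonicalSeries n H j * canonicalSeries n H k =
      c.sum (fun l a => a • canonicalSeries n H l) ∧
    F = coordFun n j * coordFun n k - c.sum (fun l a => a • coordFun n l)}

/-- The variety `Γ_{2n}` at fixed parameters: the common zeros of these quadrics. -/
def gammaVariety (n : ℕ) (H : ℤ → ℤ → ℂ) : Set (Coord n → ℂ) :=
  {x | ∀ F ∈ relationSet n H, MvPolynomial.eval x F = 0}

/-- The values of the coordinates as Laurent series: `λ = z ^ 2`, `p_{2m+1} = p_{2m+1}(z)`. -/
def coordSeries (n : ℕ) (H : ℤ → ℤ → ℂ) : Coord n → LaurentSeries ℂ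
  | Coord.lam => zPow 2
  | Coord.odd m => canonicalSeries n H (2 * (m : ℕ) + 1)

/-- `⟨C_{2n+1}, p_{2m+1} - α_m(λ) p_{2n+1} (m > n)⟩`. -/
def curveIdeal (n : ℕ) (H : ℤ → ℤ → ℂ) (α : ℕ → Polynomial ℂ) :
    Ideal (MvPolynomial (Coord n) ℂ) :=
  Ideal.span
    ({MvPolynomial.X (Coord.odd ⟨n, le_rfl⟩) ^ 2 -
        Polynomial.aeval (MvPolynomial.X Coord.lam) (branchPoly n H)} ∪
      {F | ∃ m : {m : ℕ // n ≤ m}, n < m ∧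
        F = MvPolynomial.X (Coord.odd m) -
          Polynomial.aeval (MvPolynomial.X Coord.lam) (α m) *
            MvPolynomial.X (Coord.odd ⟨n, le_rfl⟩)})

/-! ### Genus -/

/-- The affine plane curve `F = 0` has no singular point. -/
def IsNonsingularCurve (F : MvPolynomial (Fin 2) ℂ) : Prop :=
  ∀ x : Fin 2 → ℂ, MvPolynomial.eval x F = 0 →
    ∃ i, MvPolynomial.eval x (MvPolynomial.pderiv i F) ≠ 0

open scoped KaehlerDifferential in
/-- The everywhere regular differentials of a function field `K` over `ℂ`: those `ω ∈ Ω_{K/ℂ}`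
that lie, for every valuation ring `ℂ ⊆ O ⊆ K`, in the image of `Ω_{O/ℂ}`, the `O`-span of the
differentials of elements of `O`. (For a function field in one variable the rings `O ≠ K` are the
local rings of the points of the smooth projective model.) -/
def regularDifferentials (K : Type*) [Field K] [Algebra ℂ K] : Submodule ℂ (Ω[K⁄ℂ]) where
  carrier := {ω | ∀ O : ValuationSubring K, (∀ c : ℂ, algebraMap ℂ K c ∈ O) →
    ω ∈ Submodule.span O.toSubring (KaehlerDifferential.D ℂ K '' (O : Set K))}
  zero_mem' := fun _ _ => Submodule.zero_mem _
  add_mem' := fun h₁ h₂ O hO => Submodule.add_mem _ (h₁ O hO) (h₂ O hO)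
  smul_mem' := fun c ω h O hO => by
    have := Submodule.smul_mem _ (⟨algebraMap ℂ K c, hO c⟩ : O.toSubring) (h O hO)
    have e : (⟨algebraMap ℂ K c, hO c⟩ : O.toSubring) • ω = c • ω :=
      algebraMap_smul K c ω
    rwa [e] at this

/-- The (geometric) genus of a function field: the dimension of its space of regular
differentials. -/
def geometricGenus (K : Type*) [Field K] [Algebra ℂ K] : ℕ :=
  Module.finrank ℂ (regularDifferentials K)

/-- `K` is the function field of a hyperelliptic curve of genus `g`: `g ≥ 2`, the genus is `g`,
and `K` is a quadratic extension of a rational function field `ℂ(x)`. -/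
def IsHyperellipticOfGenus (K : Type*) [Field K] [Algebra ℂ K] (g : ℕ) : Prop :=
  2 ≤ g ∧ geometricGenus K = g ∧
    ∃ x : K, Transcendental ℂ x ∧ Module.finrank (IntermediateField.adjoin ℂ {x}) K = 2

/-- `dim H¹(X, 𝒪)` of an integral separated curve `X` covered by two affine open subsets, whose
coordinate rings `A` and `B` are given inside the function field: the first Čech cohomology
`𝒪(U ∩ V) / (𝒪(U) + 𝒪(V))`, where `𝒪(U ∩ V)` is generated by `A` and `B`. -/
def cechGenus {K : Type*} [Field K] [Algebra ℂ K] (A B : Subalgebra ℂ K) : ℕ :=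
  Module.finrank ℂ
    ((Subalgebra.toSubmodule (A ⊔ B)) ⧸
      (Subalgebra.toSubmodule A ⊔ Subalgebra.toSubmodule B).submoduleOf
        (Subalgebra.toSubmodule (A ⊔ B)))

/-- The arithmetic genus of the completed curve `y ^ 2 = P(x)`, `deg P ∈ {2n+1, 2n+2}`: its affine
charts have the coordinates `x, y` and `1 / x, y / x ^ (n+1)`. -/
def doubleCoverArithmeticGenus {K : Type*} [Field K] [Algebra ℂ K] (n : ℕ) (x y : K) : ℕ :=
  cechGenus (Algebra.adjoin ℂ {x, y}) (Algebra.adjoin ℂ {x⁻¹, y * x⁻¹ ^ (n + 1)})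

end

/-! ### Laurent series in `1 / z`: coefficients, parity, polynomials in `z ^ 2`. -/

section LaurentBasics

open HahnSeries

/-! The constraints on `H` describe rings generated by `z²` and one odd series. Let `U` have the
orders `T`, be closed under products and stable under `z²`. Its reduced element of order `0` is
idempotent, hence `1`. If `q` is its reduced element of order `2n+1`, comparison of orders gives `U
= ℂ[z²] + ℂ[z²] q`. Write `q² = a(z²) + b(z²) q` and apply `z ↦ -z`: this yields `q(z) + q(-z) =
b(z²)`, and since `q` has no even nonnegative exponents, `b = 0`. So `q` is odd and `q² = P(z²)`
(`exists_eq_quadSpan`). Conversely, each odd reduced `q` of order `2n+1` whose square is a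
polynomial in `z²` gives such a ring.

In these terms the linear constraints say that `p_{2m} = z^{2m}` and that the odd-indexed `p_j` are
odd. The first quadratic family expands `z^{2k} p_{2j+1}` in the basis, and the second says that
`p_{2j+1} p_{2k+1}` has no negative powers of `z` (`spanSeries_eq_quadSpan`, `canonicalSeries_sq`,
`exists_admissible_eq_spanSeries`). A member of `W_{2n}` is thus a square root of a monic polynomial
of degree `2n+1` in `z²`: its first `2n+1` free coefficients are arbitrary and a recursion
determines the others (`sqrtCoeff`).

By parity `1` and `q` are independent over `ℂ[z²]`. The normal form `a(λ) + b(λ) p_{2n+1}` therefore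
identifies the coordinate ring with `U_H` and settles the equalities of ideals.

For the genera only the decomposition `K = ℂ(x) ⊕ ℂ(x) w`, `w² = Q(x)`, matters (`IsQuadraticPair`).
The arithmetic genus counts the monomials `x^k y` missed by both charts. If `Q` is squarefree of
degree `2m+1`, the regular differentials are the `a(x) dx / w` with `deg a < m`. Writing `P = R² Q`
with `Q` squarefree, the geometric genus is `n - deg R`, which equals `n` exactly when `P` is
squarefree. -/

lemma coeff_zPow (a k : ℤ) : (zPow a).coeff k = if k = -a then 1 else 0 := by
  rw [zPow]
  by_cases h : k = -a
  · rw [h, HahnSeries.coeff_single_same, if_pos rfl]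
  · rw [HahnSeries.coeff_single_of_ne h, if_neg h]

lemma zPow_mul_zPow (a b : ℤ) : zPow a * zPow b = zPow (a + b) := by
  rw [zPow, zPow, zPow, HahnSeries.single_mul_single, one_mul, neg_add]

lemma zPow_zero : zPow 0 = 1 := by
  rw [zPow, neg_zero]; rfl

lemma zPow_pow (a : ℤ) (m : ℕ) : zPow a ^ m = zPow (a * m) := by
  induction m with
  | zero => simp [zPow_zero]
  | succ m ih => rw [pow_succ, ih, zPow_mul_zPow]; congr 1; push_cast; ring

lemma coeff_zPow_mul (a : ℤ) (f : LaurentSeries ℂ) (k : ℤ) :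
    (zPow a * f).coeff k = f.coeff (k + a) := by
  rw [zPow, HahnSeries.coeff_single_mul, one_mul, sub_neg_eq_add]

lemma zPow_ne_zero (a : ℤ) : zPow a ≠ 0 := by
  rw [zPow]; exact HahnSeries.single_ne_zero one_ne_zero

/-- The coefficients of a product of two series, as sums over intervals. -/
lemma coeff_mul_eq_sum_Icc {f g : LaurentSeries ℂ} {a b : ℤ} (hf : ∀ k < a, f.coeff k = 0)
    (hg : ∀ k < b, g.coeff k = 0) (m : ℤ) :
    (f * g).coeff m = ∑ i ∈ Finset.Icc a (m - b), f.coeff i * g.coeff (m - i) := by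
  classical
  rw [HahnSeries.coeff_mul]
  refine Finset.sum_of_injOn Prod.fst ?_ ?_ ?_ ?_
  · rintro ⟨i, j⟩ h ⟨i', j'⟩ h' (e : i = i')
    simp only [Finset.mem_coe, Finset.mem_antidiagonal] at h h'
    ext
    · exact e
    · change j = j'
      have h1 := h.2.2; have h2 := h'.2.2; omega
  · rintro ⟨i, j⟩ h
    simp only [Finset.mem_coe, Finset.mem_antidiagonal, HahnSeries.mem_support] at h
    obtain ⟨h1, h2, h3⟩ := h
    have : a ≤ i := by by_contra hlt; exact h1 (hf i (by omega))
    have : b ≤ j := by by_contra hlt; exact h2 (hg j (by omega))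
    simp only [Finset.coe_Icc, Set.mem_Icc]; omega
  · intro i _ hi
    by_contra hne
    apply hi
    refine ⟨(i, m - i), ?_, rfl⟩
    simp only [Finset.mem_coe, Finset.mem_antidiagonal, HahnSeries.mem_support]
    exact ⟨left_ne_zero_of_mul hne, right_ne_zero_of_mul hne, by omega⟩
  · rintro ⟨i, j⟩ h
    simp only [Finset.mem_antidiagonal] at h
    have : j = m - i := by omega
    simp [this]

lemma coeff_eq_zero_of_lt_neg_order {f : LaurentSeries ℂ} {k : ℤ} (h : k < f.order) :
    f.coeff k = 0 := HahnSeries.coeff_eq_zero_of_lt_order h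

lemma order_eq_of_coeff {f : LaurentSeries ℂ} {a : ℤ} (h0 : f.coeff a ≠ 0)
    (h : ∀ k < a, f.coeff k = 0) : f.order = a := by
  apply le_antisymm (HahnSeries.order_le_of_coeff_ne_zero h0)
  by_contra hlt
  have hf : f ≠ 0 := by rintro rfl; exact h0 rfl
  exact (HahnSeries.coeff_order_eq_zero.not.2 hf) (h _ (by omega))

lemma ne_zero_of_coeff {f : LaurentSeries ℂ} {a : ℤ} (h0 : f.coeff a ≠ 0) : f ≠ 0 := by
  rintro rfl; exact h0 rfl

/-! ### The involution `z ↦ -z` -/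

/-- The substitution `z ↦ -z`. -/
noncomputable def zNeg : LaurentSeries ℂ →+* LaurentSeries ℂ where
  toFun f := HahnSeries.ofSuppBddBelow (fun k : ℤ => ((k.negOnePow : ℤ) : ℂ) * f.coeff k)
    ⟨f.order, fun k hk => by
      by_contra hlt
      exact hk (by simp [coeff_eq_zero_of_lt_neg_order (not_le.1 hlt)])⟩
  map_one' := by
    ext k
    change ((k.negOnePow : ℤ) : ℂ) * (1 : LaurentSeries ℂ).coeff k = _
    rw [HahnSeries.coeff_one]
    split_ifs with h
    · simp [h]
    · simp
  map_zero' := by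
    ext k; simp
  map_add' f g := by
    ext k
    simp [mul_add]
  map_mul' f g := by
    ext k
    change ((k.negOnePow : ℤ) : ℂ) * (f * g).coeff k = _
    have hf : ∀ k < f.order, f.coeff k = 0 := fun _ => coeff_eq_zero_of_lt_neg_order
    have hg : ∀ k < g.order, g.coeff k = 0 := fun _ => coeff_eq_zero_of_lt_neg_order
    rw [coeff_mul_eq_sum_Icc hf hg, coeff_mul_eq_sum_Icc (a := f.order) (b := g.order)
      (fun k hk => by
        change ((k.negOnePow : ℤ) : ℂ) * f.coeff k = 0
        rw [hf k hk, mul_zero])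
      (fun k hk => by
        change ((k.negOnePow : ℤ) : ℂ) * g.coeff k = 0
        rw [hg k hk, mul_zero]), Finset.mul_sum]
    refine Finset.sum_congr rfl fun i _ => ?_
    have : k = i + (k - i) := by ring
    conv_lhs => rw [this, Int.negOnePow_add]
    change _ = (((i.negOnePow : ℤ) : ℂ) * f.coeff i) *
      ((((k - i).negOnePow : ℤ) : ℂ) * g.coeff (k - i))
    simp only [Units.val_mul, Int.cast_mul, add_sub_cancel]
    ring

lemma coeff_zNeg (f : LaurentSeries ℂ) (k : ℤ) :
    (zNeg f).coeff k = ((k.negOnePow : ℤ) : ℂ) * f.coeff k := rfl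

lemma coeff_zNeg_of_even (f : LaurentSeries ℂ) {k : ℤ} (hk : Even k) :
    (zNeg f).coeff k = f.coeff k := by
  rw [coeff_zNeg, Int.negOnePow_even k hk]; simp

lemma coeff_zNeg_of_odd (f : LaurentSeries ℂ) {k : ℤ} (hk : Odd k) :
    (zNeg f).coeff k = -f.coeff k := by
  rw [coeff_zNeg, Int.negOnePow_odd k hk]; simp

lemma zNeg_eq_self {f : LaurentSeries ℂ} (h : ∀ k, Odd k → f.coeff k = 0) : zNeg f = f := by
  ext k
  rcases Int.even_or_odd k with hk | hk
  · exact coeff_zNeg_of_even f hk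
  · rw [coeff_zNeg_of_odd f hk, h k hk, neg_zero]

lemma zNeg_eq_neg {f : LaurentSeries ℂ} (h : ∀ k, Even k → f.coeff k = 0) : zNeg f = -f := by
  ext k
  rcases Int.even_or_odd k with hk | hk
  · rw [coeff_zNeg_of_even f hk, HahnSeries.coeff_neg, h k hk, neg_zero]
  · rw [coeff_zNeg_of_odd f hk, HahnSeries.coeff_neg]

lemma coeff_eq_zero_of_zNeg_eq_self {f : LaurentSeries ℂ} (h : zNeg f = f) {k : ℤ} (hk : Odd k) :
    f.coeff k = 0 := by
  have := coeff_zNeg_of_odd f hk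
  rw [h] at this
  exact self_eq_neg.1 this

lemma coeff_eq_zero_of_zNeg_eq_neg {f : LaurentSeries ℂ} (h : zNeg f = -f) {k : ℤ}
    (hk : Even k) : f.coeff k = 0 := by
  have := coeff_zNeg_of_even f hk
  rw [h, HahnSeries.coeff_neg] at this
  exact neg_eq_self.1 this

/-! ### Polynomials in `z ^ 2` -/

open Polynomial in
-- The coefficient with index `k` belongs to `z ^ (-k)`, which is the power `-k / 2` of `z ^ 2` when
-- `k ≤ 0` is even.
lemma coeff_aeval_zPow_two (a : ℂ[X]) (k : ℤ) :
    (aeval (zPow 2) a).coeff k = if k ≤ 0 ∧ Even k then a.coeff (-k / 2).toNat else 0 := by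
  induction a using Polynomial.induction_on' with
  | add a b ha hb =>
    rw [map_add, HahnSeries.coeff_add, ha, hb]
    split_ifs <;> simp
  | monomial m c =>
    rw [aeval_monomial, zPow_pow, ← Algebra.smul_def, HahnSeries.coeff_smul, coeff_zPow,
      coeff_monomial]
    rcases Int.even_or_odd k with hk | hk
    · obtain ⟨r, rfl⟩ := hk
      by_cases hr : r ≤ 0
      · have h2 : r + r ≤ 0 ∧ Even (r + r) := ⟨by omega, ⟨r, rfl⟩⟩
        rw [if_pos h2]
        by_cases h : m = (-(r + r) / 2).toNat
        · have h1 : r + r = -(2 * (m : ℤ)) := by omega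
          rw [if_pos h1, if_pos h]; simp
        · have h1 : r + r ≠ -(2 * (m : ℤ)) := by omega
          rw [if_neg h1, if_neg h]; simp
      · have h1 : r + r ≠ -(2 * (m : ℤ)) := by omega
        have h2 : ¬ (r + r ≤ 0 ∧ Even (r + r)) := by omega
        rw [if_neg h1, if_neg h2]; simp
    · rw [if_neg (by rintro rfl; exact Int.not_even_iff_odd.2 hk ⟨-m, by ring⟩),
        if_neg (by rintro ⟨-, h⟩; exact Int.not_even_iff_odd.2 hk h)]
      simp

open Polynomial in
lemma coeff_aeval_zPow_two_neg (a : ℂ[X]) (i : ℕ) :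
    (aeval (zPow 2) a).coeff (-(2 * (i : ℤ))) = a.coeff i := by
  rw [coeff_aeval_zPow_two, if_pos ⟨by omega, ⟨-i, by ring⟩⟩]
  congr 1; omega

open Polynomial in
lemma zNeg_aeval_zPow_two (a : ℂ[X]) : zNeg (aeval (zPow 2) a) = aeval (zPow 2) a := by
  apply zNeg_eq_self
  intro k hk
  rw [coeff_aeval_zPow_two, if_neg (by rintro ⟨-, h⟩; exact Int.not_even_iff_odd.2 hk h)]

open Polynomial in
lemma aeval_zPow_two_injective : Function.Injective (aeval (R := ℂ) (zPow 2)) := by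
  rw [injective_iff_map_eq_zero]
  intro a ha
  ext i
  rw [← coeff_aeval_zPow_two_neg, ha]; rfl

open Polynomial in
/-- An even series without negative powers of `z` is a polynomial in `z ^ 2`. -/
lemma exists_aeval_zPow_two {f : LaurentSeries ℂ} (hpos : ∀ k : ℤ, 0 < k → f.coeff k = 0)
    (hodd : ∀ k : ℤ, Odd k → f.coeff k = 0) {N : ℕ} (hN : ∀ k : ℤ, k < -(2 * N) → f.coeff k = 0) :
    f = aeval (zPow 2) (∑ i ∈ Finset.range (N + 1), C (f.coeff (-(2 * (i : ℤ)))) * X ^ i) := by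
  ext k
  rw [coeff_aeval_zPow_two]
  simp only [finsetSum_coeff, coeff_C_mul, coeff_X_pow]
  split_ifs with h
  · obtain ⟨h0, r, rfl⟩ := h
    obtain ⟨s, rfl⟩ : ∃ s : ℕ, r = -s := ⟨(-r).toNat, by omega⟩
    have e : (-(-(s : ℤ) + -s) / 2).toNat = s := by omega
    rw [e]
    simp only [mul_ite, mul_one, mul_zero, Finset.sum_ite_eq, Finset.mem_range]
    split_ifs with hs
    · congr 1; ring
    · exact hN _ (by omega)
  · by_cases h0 : k ≤ 0
    · exact hodd k (Int.not_even_iff_odd.1 fun he => h ⟨h0, he⟩)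
    · exact hpos k (by omega)

open Polynomial in
/-- `1` and a nonzero odd series are linearly independent over the polynomials in `z ^ 2`. -/
lemma eq_zero_of_aeval_add_aeval_mul {q : LaurentSeries ℂ} (hq : zNeg q = -q) (hq0 : q ≠ 0)
    {a b : ℂ[X]} (h : aeval (zPow 2) a + aeval (zPow 2) b * q = 0) : a = 0 ∧ b = 0 := by
  -- The substitution `z ↦ -z` fixes the first term and changes the sign of the second, so adding
  -- the two relations isolates the first.
  have h' := congrArg zNeg h
  rw [map_add, map_mul, zNeg_aeval_zPow_two, zNeg_aeval_zPow_two, hq, map_zero] at h'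
  have ha : aeval (zPow 2) a = 0 := by
    have h2 : aeval (zPow 2) a + aeval (zPow 2) a = 0 := by linear_combination h + h'
    ext k
    have h3 := congrArg (fun f => HahnSeries.coeff f k) h2
    simp only [HahnSeries.coeff_add, HahnSeries.coeff_zero] at h3 ⊢
    exact add_self_eq_zero.1 h3
  have hb : aeval (zPow 2) b = 0 := by
    rw [ha, zero_add] at h
    exact (mul_eq_zero.1 h).resolve_right hq0
  exact ⟨aeval_zPow_two_injective (by simpa using ha), aeval_zPow_two_injective (by simpa using hb)⟩

end LaurentBasics

/-! ### Subspaces and their orders; reduced series. -/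

section Orders

/-- A subspace is determined by a smaller one having the same orders, if these are bounded
below. -/
lemma eq_of_le_of_zOrders_subset {U A : Submodule ℂ (LaurentSeries ℂ)} (hUA : U ≤ A)
    (h : zOrders A ⊆ zOrders U) {N : ℤ} (hN : ∀ k ∈ zOrders A, N ≤ k) : A = U := by
  apply le_antisymm _ hUA
  -- Induction on a bound `N + d` for the order: an element of `U` of the same order cancels the
  -- leading term. At `d = 0` what remains would have order below `N`, so it vanishes.
  have key : ∀ d : ℕ, ∀ f ∈ A, (∀ k : ℤ, k < -(N + d) → f.coeff k = 0) → f ∈ U := by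
    intro d
    induction d with
    | zero =>
      intro f hf hk
      by_cases h0 : f.coeff (-N) = 0
      · by_contra hfU
        have hf0 : f ≠ 0 := by rintro rfl; exact hfU U.zero_mem
        have h1 := hN _ ⟨f, hf, hf0, rfl⟩
        have h2 := HahnSeries.coeff_order_eq_zero.not.2 hf0
        rcases h1.lt_or_eq with h3 | h3
        · exact h2 (hk _ (by push_cast; omega))
        · apply h2; rw [← h0]; congr 1; omega
      · have ho : f.order = -N := order_eq_of_coeff h0 (fun k hk' => hk k (by push_cast; omega))
        obtain ⟨g, hg, hg0, hgo⟩ := h ⟨f, hf, ne_zero_of_coeff h0, rfl⟩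
        have hgo : g.order = -N := by omega
        have hgc : g.coeff (-N) ≠ 0 := by rw [← hgo]; exact HahnSeries.coeff_order_eq_zero.not.2 hg0
        by_contra hfU
        set e := f - (f.coeff (-N) / g.coeff (-N)) • g with he
        have heA : e ∈ A := A.sub_mem hf (A.smul_mem _ (hUA hg))
        have he0 : e ≠ 0 := by
          intro h0
          rw [he, sub_eq_zero] at h0
          exact hfU (h0 ▸ U.smul_mem _ hg)
        have h1 := hN _ ⟨e, heA, he0, rfl⟩
        apply HahnSeries.coeff_order_eq_zero.not.2 he0
        rcases h1.lt_or_eq with h3 | h3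
        · have h4 : e.order < -N := by omega
          generalize e.order = d at h4 ⊢
          rw [he, HahnSeries.coeff_sub, HahnSeries.coeff_smul, hk _ (by push_cast; omega),
            coeff_eq_zero_of_lt_neg_order (f := g) (k := d) (by omega)]
          simp
        · have : e.order = -N := by omega
          rw [this, he, HahnSeries.coeff_sub, HahnSeries.coeff_smul, smul_eq_mul,
            div_mul_cancel₀ _ hgc, sub_self]
    | succ d ih =>
      intro f hf hk
      by_cases h0 : f.coeff (-(N + (d + 1 : ℕ))) = 0
      · apply ih f hf
        intro k hk'
        rcases (show k < -(N + (d + 1 : ℕ)) ∨ k = -(N + (d + 1 : ℕ)) by push_cast; omega) with h1 | rfl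
        · exact hk k h1
        · exact h0
      · have ho : f.order = -(N + (d + 1 : ℕ)) := order_eq_of_coeff h0 hk
        obtain ⟨g, hg, hg0, hgo⟩ := h ⟨f, hf, ne_zero_of_coeff h0, rfl⟩
        have hgo : g.order = f.order := by omega
        have hgc : g.coeff f.order ≠ 0 := by rw [← hgo]; exact HahnSeries.coeff_order_eq_zero.not.2 hg0
        have hsub : f - (f.coeff f.order / g.coeff f.order) • g ∈ U := by
          apply ih _ (A.sub_mem hf (A.smul_mem _ (hUA hg)))
          intro k hk'
          rw [HahnSeries.coeff_sub, HahnSeries.coeff_smul, smul_eq_mul]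
          rcases (show k < f.order ∨ k = f.order by rw [ho]; push_cast; omega) with h1 | rfl
          · rw [coeff_eq_zero_of_lt_neg_order h1, coeff_eq_zero_of_lt_neg_order (f := g) (k := k) (by omega)]; simp
          · rw [div_mul_cancel₀ _ hgc, sub_self]
        have := U.add_mem hsub (U.smul_mem (f.coeff f.order / g.coeff f.order) hg)
        simpa using this
  intro f hf
  apply key (-f.order - N).toNat f hf
  intro k hk
  exact coeff_eq_zero_of_lt_neg_order (by omega)

lemma mem_nonnegOrders {n : ℕ} {k : ℤ} :
    k ∈ nonnegOrders n ↔ 0 ≤ k ∧ (2 * (n : ℤ) ≤ k ∨ Even k) := by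
  simp only [nonnegOrders, orderSet, Set.mem_ofPred_eq]
  push_cast
  rw [Int.even_add]
  have : Even (2 * (n : ℤ)) := even_two_mul _
  simp only [this, iff_true]
  constructor
  · rintro ⟨h | h, h0⟩
    · exact ⟨h0, Or.inl h⟩
    · exact ⟨h0, Or.inr h.2⟩
  · rintro ⟨h0, h | h⟩
    · exact ⟨Or.inl h, h0⟩
    · exact ⟨Or.inr ⟨by omega, h⟩, h0⟩

lemma two_mul_mem_nonnegOrders (n : ℕ) (m : ℕ) : (2 * (m : ℤ)) ∈ nonnegOrders n :=
  mem_nonnegOrders.2 ⟨by omega, Or.inr (even_two_mul _)⟩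

lemma odd_mem_nonnegOrders {n m : ℕ} (h : n ≤ m) : (2 * (m : ℤ) + 1) ∈ nonnegOrders n :=
  mem_nonnegOrders.2 ⟨by omega, Or.inl (by omega)⟩

lemma nonnegOrders_cases {n : ℕ} {j : ℤ} (hj : j ∈ nonnegOrders n) :
    (∃ m : ℕ, j = 2 * m) ∨ ∃ m : ℕ, n ≤ m ∧ j = 2 * m + 1 := by
  rw [mem_nonnegOrders] at hj
  rcases Int.even_or_odd' j with ⟨m, rfl | rfl⟩
  · exact Or.inl ⟨m.toNat, by omega⟩
  · refine Or.inr ⟨m.toNat, ?_, by omega⟩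
    rcases hj with ⟨h0, h | h⟩
    · omega
    · exact absurd h (by simp [parity_simps])

/-- The series `z ^ j + ∑ c_k z ^ k`, with `k ∉ {0, 2, …, 2n, 2n+1, …}` and `k < j`. -/
def IsReducedSeries (n : ℕ) (j : ℤ) (f : LaurentSeries ℂ) : Prop :=
  f.coeff (-j) = 1 ∧ (∀ k, k < -j → f.coeff k = 0) ∧
    ∀ i ∈ nonnegOrders n, i ≠ j → f.coeff (-i) = 0

lemma coeff_canonicalSeries (n : ℕ) (H : ℤ → ℤ → ℂ) (j k : ℤ)
    [Decidable (-k ∉ nonnegOrders n ∧ -k < j)] :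
    (canonicalSeries n H j).coeff k =
      if k = -j then 1 else if -k ∉ nonnegOrders n ∧ -k < j then H j k else 0 := by
  unfold canonicalSeries HahnSeries.ofSuppBddBelow
  dsimp only
  congr

lemma isReducedSeries_canonicalSeries (n : ℕ) (H : ℤ → ℤ → ℂ) (j : ℤ) :
    IsReducedSeries n j (canonicalSeries n H j) := by
  classical
  refine ⟨?_, ?_, ?_⟩
  · rw [coeff_canonicalSeries, if_pos rfl]
  · intro k hk
    rw [coeff_canonicalSeries, if_neg (by omega), if_neg (by omega)]
  · intro i hi hij
    rw [coeff_canonicalSeries, if_neg (by omega), if_neg (by simp [hi])]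

lemma canonicalSeries_eq {n : ℕ} {H : ℤ → ℤ → ℂ} {j : ℤ} {f : LaurentSeries ℂ}
    (hf : IsReducedSeries n j f) (h : ∀ k, -k ∉ nonnegOrders n → -k < j → H j k = f.coeff k) :
    canonicalSeries n H j = f := by
  classical
  ext k
  rw [coeff_canonicalSeries]
  split_ifs with h1 h2
  · rw [h1, hf.1]
  · exact h k h2.1 h2.2
  · by_cases hk : k < -j
    · rw [hf.2.1 k hk]
    · have : -k ∈ nonnegOrders n := by
        by_contra hn; exact h2 ⟨hn, by omega⟩
      have := hf.2.2 (-k) this (by omega)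
      rw [neg_neg] at this; exact this.symm

lemma IsReducedSeries.order {n : ℕ} {j : ℤ} {f : LaurentSeries ℂ} (hf : IsReducedSeries n j f) :
    f.order = -j := order_eq_of_coeff (by rw [hf.1]; exact one_ne_zero) hf.2.1

lemma IsReducedSeries.ne_zero {n : ℕ} {j : ℤ} {f : LaurentSeries ℂ} (hf : IsReducedSeries n j f) :
    f ≠ 0 := ne_zero_of_coeff (a := -j) (by rw [hf.1]; exact one_ne_zero)

/-- A nonzero difference would have its order in `T`, but its coefficients vanish at every exponent
in `T`, the leading ones cancelling at `j`. -/
lemma eq_of_isReducedSeries {n : ℕ} {j : ℤ} {U : Submodule ℂ (LaurentSeries ℂ)}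
    (hU : zOrders U ⊆ nonnegOrders n) {f g : LaurentSeries ℂ} (hfU : f ∈ U) (hgU : g ∈ U)
    (hf : IsReducedSeries n j f) (hg : IsReducedSeries n j g) : f = g := by
  by_contra hne
  have h0 : f - g ≠ 0 := sub_ne_zero.2 hne
  have hT := hU ⟨_, U.sub_mem hfU hgU, h0, rfl⟩
  apply HahnSeries.coeff_order_eq_zero.not.2 h0
  rw [HahnSeries.coeff_sub]
  generalize (f - g).order = k at hT
  by_cases hk : -k = j
  · have : k = -j := by omega
    rw [this, hf.1, hg.1, sub_self]
  · have h1 := hf.2.2 _ hT hk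
    have h2 := hg.2.2 _ hT hk
    rw [neg_neg] at h1 h2
    rw [h1, h2, sub_self]

/-- Gaussian elimination: normalise an element of order `m` and subtract multiples of the reduced
series of smaller orders. These do not interfere, each vanishing at the other exponents in `T`. -/
lemma exists_isReducedSeries {n : ℕ} {U : Submodule ℂ (LaurentSeries ℂ)}
    (hU : nonnegOrders n ⊆ zOrders U) (m : ℕ) :
    (m : ℤ) ∈ nonnegOrders n → ∃ f ∈ U, IsReducedSeries n m f := by
  classical
  induction m using Nat.strong_induction_on with
  | _ m ih =>
    intro hm
    obtain ⟨f, hf, hf0, hfo⟩ := hU hm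
    have hfo : f.order = -m := by omega
    have hc : f.coeff (-m) ≠ 0 := by rw [← hfo]; exact HahnSeries.coeff_order_eq_zero.not.2 hf0
    choose! p hpU hp using ih
    set g := (f.coeff (-m))⁻¹ • f with hg
    have hgU : g ∈ U := U.smul_mem _ hf
    have hg1 : g.coeff (-m) = 1 := by
      rw [hg, HahnSeries.coeff_smul, smul_eq_mul, inv_mul_cancel₀ hc]
    have hglt : ∀ k < -(m : ℤ), g.coeff k = 0 := by
      intro k hk
      rw [hg, HahnSeries.coeff_smul, coeff_eq_zero_of_lt_neg_order (f := f) (k := k) (by omega), smul_zero]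
    clear_value g
    set s := (Finset.range m).filter (fun i : ℕ => (i : ℤ) ∈ nonnegOrders n) with hs
    have hs' : ∀ i ∈ s, i < m ∧ (i : ℤ) ∈ nonnegOrders n := by
      intro i hi; simpa [hs] using hi
    refine ⟨g - ∑ i ∈ s, g.coeff (-(i : ℤ)) • p i, U.sub_mem hgU (U.sum_mem fun i hi =>
      U.smul_mem _ (hpU i (hs' i hi).1 (hs' i hi).2)), ?_, ?_, ?_⟩
    · rw [HahnSeries.coeff_sub, HahnSeries.coeff_sum, Finset.sum_eq_zero, hg1, sub_zero]
      intro i hi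
      rw [HahnSeries.coeff_smul, (hp i (hs' i hi).1 (hs' i hi).2).2.1 _ (by have := (hs' i hi).1; omega), smul_zero]
    · intro k hk
      rw [HahnSeries.coeff_sub, HahnSeries.coeff_sum, Finset.sum_eq_zero, hglt k hk, sub_zero]
      intro i hi
      rw [HahnSeries.coeff_smul, (hp i (hs' i hi).1 (hs' i hi).2).2.1 _ (by have := (hs' i hi).1; omega), smul_zero]
    · intro i hi him
      rw [HahnSeries.coeff_sub, HahnSeries.coeff_sum]
      obtain ⟨i, rfl⟩ : ∃ i' : ℕ, i = i' := ⟨i.toNat, by have := (mem_nonnegOrders.1 hi).1; omega⟩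
      by_cases hlt : i < m
      · rw [Finset.sum_eq_single i]
        · rw [HahnSeries.coeff_smul, (hp i hlt hi).1, smul_eq_mul, mul_one, sub_self]
        · intro b hb hbi
          rw [HahnSeries.coeff_smul, (hp b (hs' b hb).1 (hs' b hb).2).2.2 _ hi (by omega), smul_zero]
        · intro hi'; exact absurd (by simp [hs, hlt, hi]) hi'
      · have him : i ≠ m := fun h => him (by rw [h])
        rw [hglt _ (by omega), Finset.sum_eq_zero, sub_zero]
        intro b hb
        rw [HahnSeries.coeff_smul, (hp b (hs' b hb).1 (hs' b hb).2).2.1 _ (by have := (hs' b hb).1; omega), smul_zero]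

end Orders

/-! ### The space spanned by the canonical basis. -/

section Span

variable (n : ℕ) (H : ℤ → ℤ → ℂ)

lemma canonicalSeries_mem {j : ℤ} (hj : j ∈ nonnegOrders n) :
    canonicalSeries n H j ∈ spanSeries n H :=
  Submodule.subset_span ⟨⟨j, hj⟩, rfl⟩

/-- The coefficient functionals at the exponents in `T` are dual to the `p_j`, because these are
reduced. -/
lemma coeff_linearCombination_canonicalSeries (c : nonnegOrders n →₀ ℂ) (i : nonnegOrders n) :
    (Finsupp.linearCombination ℂ (fun j : nonnegOrders n => canonicalSeries n H j) c).coeff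
      (-(i : ℤ)) = c i := by
  rw [Finsupp.linearCombination_apply, Finsupp.sum, HahnSeries.coeff_sum, Finset.sum_eq_single i]
  · rw [HahnSeries.coeff_smul, (isReducedSeries_canonicalSeries n H i).1, smul_eq_mul, mul_one]
  · intro b _ hb
    rw [HahnSeries.coeff_smul, (isReducedSeries_canonicalSeries n H b).2.2 _ i.2
      (fun h => hb (Subtype.ext h.symm)), smul_zero]
  · intro hi
    rw [Finsupp.notMem_support_iff.1 hi, zero_smul]; rfl

lemma linearIndependent_canonicalSeries :
    LinearIndependent ℂ (fun j : nonnegOrders n => canonicalSeries n H j) := by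
  rw [linearIndependent_iff]
  intro c hc
  ext i
  rw [← coeff_linearCombination_canonicalSeries n H c i, hc]; rfl

lemma mem_spanSeries_iff {f : LaurentSeries ℂ} :
    f ∈ spanSeries n H ↔ ∃ c : nonnegOrders n →₀ ℂ,
      Finsupp.linearCombination ℂ (fun j : nonnegOrders n => canonicalSeries n H j) c = f := by
  rw [spanSeries, ← Finsupp.range_linearCombination]; rfl

lemma zOrders_spanSeries : zOrders (spanSeries n H) = nonnegOrders n := by
  ext k
  constructor
  · rintro ⟨f, hf, hf0, rfl⟩
    obtain ⟨c, rfl⟩ := (mem_spanSeries_iff n H).1 hf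
    have hc : c.support.Nonempty := by
      rw [Finsupp.support_nonempty_iff]; rintro rfl; exact hf0 (map_zero _)
    obtain ⟨i, hi, hmax⟩ := c.support.exists_max_image (fun j => (j : ℤ)) hc
    have : (Finsupp.linearCombination ℂ (fun j : nonnegOrders n => canonicalSeries n H j) c).order
        = -(i : ℤ) := by
      apply order_eq_of_coeff
      · rw [coeff_linearCombination_canonicalSeries]; exact Finsupp.mem_support_iff.1 hi
      · intro k hk
        rw [Finsupp.linearCombination_apply, Finsupp.sum, HahnSeries.coeff_sum]
        apply Finset.sum_eq_zero
        intro j hj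
        rw [HahnSeries.coeff_smul, (isReducedSeries_canonicalSeries n H j).2.1 _
          (by have := hmax j hj; omega), smul_zero]
    rw [this, neg_neg]; exact i.2
  · intro hk
    exact ⟨_, canonicalSeries_mem n H hk, (isReducedSeries_canonicalSeries n H k).ne_zero, by
      rw [(isReducedSeries_canonicalSeries n H k).order, neg_neg]⟩

variable {n H}

lemma eq_zero_of_mem_spanSeries {f : LaurentSeries ℂ} (hf : f ∈ spanSeries n H)
    (h : ∀ i ∈ nonnegOrders n, f.coeff (-i) = 0) : f = 0 := by
  obtain ⟨c, rfl⟩ := (mem_spanSeries_iff n H).1 hf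
  have : c = 0 := by
    ext i; rw [← coeff_linearCombination_canonicalSeries n H c i, h i i.2]; rfl
  rw [this, map_zero]

/-- Two elements of `⟨p_j⟩` with the same coefficients at the orders of the space are equal. -/
lemma eq_of_mem_spanSeries {f g : LaurentSeries ℂ} (hf : f ∈ spanSeries n H)
    (hg : g ∈ spanSeries n H) (h : ∀ i ∈ nonnegOrders n, f.coeff (-i) = g.coeff (-i)) : f = g := by
  rw [← sub_eq_zero]
  apply eq_zero_of_mem_spanSeries (Submodule.sub_mem _ hf hg)
  intro i hi
  rw [HahnSeries.coeff_sub, h i hi, sub_self]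

end Span

/-! ### Spaces with two generators over `ℂ[z ^ 2]`. -/

section QuadSpan

open Polynomial

lemma smul_eq_algebraMap_mul (c : ℂ) (f : LaurentSeries ℂ) :
    c • f = algebraMap ℂ (LaurentSeries ℂ) c * f := Algebra.smul_def c f

lemma mul_self_le_iff {U : Submodule ℂ (LaurentSeries ℂ)} :
    U * U ≤ U ↔ ∀ f ∈ U, ∀ g ∈ U, f * g ∈ U :=
  haveI : IsScalarTower ℂ (LaurentSeries ℂ) (LaurentSeries ℂ) :=
    @IsScalarTower.right ℂ (LaurentSeries ℂ) _ _ laurentAlgebra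
  haveI : SMulCommClass ℂ (LaurentSeries ℂ) (LaurentSeries ℂ) :=
    @Algebra.to_smulCommClass ℂ (LaurentSeries ℂ) _ _ laurentAlgebra
  Submodule.mul_le

/-- The space `ℂ[z ^ 2] e + ℂ[z ^ 2] q`. -/
noncomputable def quadSpan (e q : LaurentSeries ℂ) : Submodule ℂ (LaurentSeries ℂ) where
  carrier := {f | ∃ a b : ℂ[X], f = aeval (zPow 2) a * e + aeval (zPow 2) b * q}
  zero_mem' := ⟨0, 0, by simp⟩
  add_mem' := by
    rintro _ _ ⟨a, b, rfl⟩ ⟨a', b', rfl⟩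
    exact ⟨a + a', b + b', by simp only [map_add]; ring⟩
  smul_mem' := by
    rintro c _ ⟨a, b, rfl⟩
    refine ⟨C c * a, C c * b, ?_⟩
    simp only [map_mul, aeval_C]
    rw [smul_eq_algebraMap_mul]
    ring

lemma zSqStable_quadSpan (e q : LaurentSeries ℂ) : ZSqStable (quadSpan e q) := by
  rintro _ ⟨a, b, rfl⟩
  exact ⟨X * a, X * b, by simp only [map_mul, aeval_X]; ring⟩

lemma order_aeval_zPow_two {b : ℂ[X]} (hb : b ≠ 0) :
    (aeval (zPow 2) b).order = -(2 * (b.natDegree : ℤ)) := by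
  apply order_eq_of_coeff
  · rw [coeff_aeval_zPow_two_neg]; exact leadingCoeff_ne_zero.2 hb
  · intro k hk
    rw [coeff_aeval_zPow_two]
    split_ifs with h
    · apply coeff_eq_zero_of_natDegree_lt
      obtain ⟨-, r, rfl⟩ := h
      omega
    · rfl

lemma order_aeval_mul {b : ℂ[X]} (hb : b ≠ 0) {q : LaurentSeries ℂ} (hq : q ≠ 0) :
    (aeval (zPow 2) b * q).order = -(2 * (b.natDegree : ℤ)) + q.order := by
  have h0 : aeval (zPow 2) b ≠ 0 := fun h => hb (aeval_zPow_two_injective (by simpa using h))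
  rw [HahnSeries.order_mul h0 hq, order_aeval_zPow_two hb]

lemma zNeg_zPow_even {a : ℤ} (ha : Even a) : zNeg (zPow a) = zPow a := by
  apply zNeg_eq_self
  intro k hk
  rw [coeff_zPow, if_neg]
  rintro rfl
  exact Int.not_even_iff_odd.2 hk ha.neg

lemma zNeg_zPow_odd {a : ℤ} (ha : Odd a) : zNeg (zPow a) = -zPow a := by
  apply zNeg_eq_neg
  intro k hk
  rw [coeff_zPow, if_neg]
  rintro rfl
  exact Int.not_odd_iff_even.2 hk ha.neg

/-- The even part `E` and the odd part `O` of an element share no exponents, so no leading term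
cancels and the parity of the order tells which part attains it. -/
lemma zOrders_quadSpan {n : ℕ} {q : LaurentSeries ℂ} (hq : zNeg q = -q)
    (hq1 : IsReducedSeries n (2 * n + 1) q) (N : ℕ) :
    zOrders (quadSpan (zPow (-(2 * N))) q) =
      {k | (Even k ∧ -(2 * (N : ℤ)) ≤ k) ∨ (Odd k ∧ 2 * (n : ℤ) + 1 ≤ k)} := by
  have hz : (zPow (-(2 * N))).order = 2 * N := by
    apply order_eq_of_coeff
    · rw [coeff_zPow, if_pos (by ring)]; exact one_ne_zero
    · intro k hk; rw [coeff_zPow, if_neg (by omega)]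
  ext k
  constructor
  · rintro ⟨_, ⟨a, b, rfl⟩, hf0, rfl⟩
    set E := aeval (zPow 2) a * zPow (-(2 * N)) with hE
    set O := aeval (zPow 2) b * q with hO
    have hE' : zNeg E = E := by
      rw [hE, map_mul, zNeg_aeval_zPow_two, zNeg_zPow_even ⟨-N, by ring⟩]
    have hO' : zNeg O = -O := by rw [hO, map_mul, zNeg_aeval_zPow_two, hq]; ring
    have hc := HahnSeries.coeff_order_eq_zero.not.2 hf0
    have hlt : ∀ k < (E + O).order, (E + O).coeff k = 0 := fun _ => coeff_eq_zero_of_lt_neg_order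
    generalize (E + O).order = k at hc hlt
    simp only [HahnSeries.coeff_add] at hc hlt
    rcases Int.even_or_odd k with hk | hk
    · left
      refine ⟨hk.neg, ?_⟩
      rw [coeff_eq_zero_of_zNeg_eq_neg hO' hk, add_zero] at hc
      have hE0 : E.order = k := by
        apply order_eq_of_coeff hc
        intro i hi
        rcases Int.even_or_odd i with hi' | hi'
        · have := hlt i hi
          rwa [coeff_eq_zero_of_zNeg_eq_neg hO' hi', add_zero] at this
        · exact coeff_eq_zero_of_zNeg_eq_self hE' hi'
      have ha : a ≠ 0 := by
        rintro rfl
        apply hc; rw [hE]; simp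
      rw [hE, order_aeval_mul ha (zPow_ne_zero _), hz] at hE0
      omega
    · right
      refine ⟨hk.neg, ?_⟩
      rw [coeff_eq_zero_of_zNeg_eq_self hE' hk, zero_add] at hc
      have hE0 : O.order = k := by
        apply order_eq_of_coeff hc
        intro i hi
        rcases Int.even_or_odd i with hi' | hi'
        · exact coeff_eq_zero_of_zNeg_eq_neg hO' hi'
        · have := hlt i hi
          rwa [coeff_eq_zero_of_zNeg_eq_self hE' hi', zero_add] at this
      have hb : b ≠ 0 := by
        rintro rfl
        apply hc; rw [hO]; simp
      rw [hO, order_aeval_mul hb hq1.ne_zero, hq1.order] at hE0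
      omega
  · rintro (⟨⟨r, rfl⟩, h⟩ | ⟨⟨r, rfl⟩, h⟩)
    · refine ⟨aeval (zPow 2) (X ^ (r + N).toNat : ℂ[X]) * zPow (-(2 * N)),
        ⟨X ^ (r + N).toNat, 0, by rw [map_zero]; ring⟩, ?_, ?_⟩
      · rw [map_pow, aeval_X]
        exact mul_ne_zero (pow_ne_zero _ (zPow_ne_zero _)) (zPow_ne_zero _)
      · rw [order_aeval_mul (pow_ne_zero _ X_ne_zero) (zPow_ne_zero _), hz, natDegree_X_pow]
        omega
    · refine ⟨aeval (zPow 2) (X ^ (r - n).toNat : ℂ[X]) * q,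
        ⟨0, X ^ (r - n).toNat, by rw [map_zero]; ring⟩, ?_, ?_⟩
      · rw [map_pow, aeval_X]
        exact mul_ne_zero (pow_ne_zero _ (zPow_ne_zero _)) hq1.ne_zero
      · rw [order_aeval_mul (pow_ne_zero _ X_ne_zero) hq1.ne_zero, hq1.order, natDegree_X_pow]
        omega

lemma zOrders_quadSpan_one {n : ℕ} {q : LaurentSeries ℂ} (hq : zNeg q = -q)
    (hq1 : IsReducedSeries n (2 * n + 1) q) : zOrders (quadSpan 1 q) = nonnegOrders n := by
  have := zOrders_quadSpan hq hq1 0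
  rw [Nat.cast_zero, mul_zero, neg_zero, zPow_zero] at this
  rw [this]
  ext k
  rw [mem_nonnegOrders]
  change ((Even k ∧ 0 ≤ k) ∨ (Odd k ∧ 2 * (n : ℤ) + 1 ≤ k)) ↔ _
  rw [← Int.not_even_iff_odd]
  by_cases hk : Even k
  · simp only [hk, true_and, not_true, false_and, or_false, or_true, and_true]
  · simp only [hk, false_and, not_false_eq_true, true_and, false_or, or_false]
    rw [Int.not_even_iff] at hk
    omega

/-- Lowering the even generator from `1` to `z ^ (-2n)` adds exactly the missing orders `-2n, …,
-2`; this supplies a point of `Σ_{2n}` above `quadSpan 1 q`. -/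
lemma quadSpan_mem_birkhoffStratum {n : ℕ} {q : LaurentSeries ℂ} (hq : zNeg q = -q)
    (hq1 : IsReducedSeries n (2 * n + 1) q) :
    quadSpan (zPow (-(2 * n))) q ∈ birkhoffStratum (2 * n) := by
  refine ⟨?_, zSqStable_quadSpan _ _⟩
  rw [zOrders_quadSpan hq hq1 n]
  ext k
  simp only [orderSet, Set.mem_ofPred_eq]
  push_cast
  rw [Int.even_add, ← Int.not_even_iff_odd]
  have h2 : Even (2 * (n : ℤ)) := even_two_mul _
  simp only [h2, iff_true]
  by_cases hk : Even k
  · simp only [hk, true_and, not_true, false_and, or_false, and_true]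
    omega
  · simp only [hk, false_and, not_false_eq_true, true_and, false_or, or_false, and_false]
    rw [Int.not_even_iff] at hk
    omega

lemma quadSpan_one_le (q : LaurentSeries ℂ) (n : ℕ) :
    quadSpan 1 q ≤ quadSpan (zPow (-(2 * n))) q := by
  rintro _ ⟨a, b, rfl⟩
  refine ⟨X ^ n * a, b, ?_⟩
  rw [map_mul, map_pow, aeval_X, zPow_pow, mul_one, mul_right_comm, zPow_mul_zPow,
    show (2 * (n : ℤ) + -(2 * n)) = 0 by ring, zPow_zero, one_mul]

lemma quadSpan_one_mul_le {q : LaurentSeries ℂ} {P : ℂ[X]} (h : q ^ 2 = aeval (zPow 2) P) :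
    quadSpan 1 q * quadSpan 1 q ≤ quadSpan 1 q := by
  rw [mul_self_le_iff]
  rintro _ ⟨a, b, rfl⟩ _ ⟨a', b', rfl⟩
  refine ⟨a * a' + b * b' * P, a * b' + a' * b, ?_⟩
  simp only [map_add, map_mul, ← h]
  ring

end QuadSpan

/-! ### Coefficients of the canonical series under the linear constraints. -/

section Constraints

open Polynomial

variable {n : ℕ} {H : ℤ → ℤ → ℂ}

lemma odd_notMem_nonnegOrders {n : ℕ} {l : ℤ} (hl : -(n : ℤ) ≤ l) :
    -(2 * l + 1) ∉ nonnegOrders n := by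
  rw [mem_nonnegOrders]
  rintro ⟨-, h | h⟩
  · omega
  · rw [Int.even_iff] at h; omega

lemma coeff_canonicalSeries_odd {j l : ℤ} (hj : (n : ℤ) ≤ j) (hl : -(n : ℤ) ≤ l) :
    (canonicalSeries n H (2 * j + 1)).coeff (2 * l + 1) = H (2 * j + 1) (2 * l + 1) := by
  classical
  rw [coeff_canonicalSeries, if_neg (by omega),
    if_pos ⟨odd_notMem_nonnegOrders hl, by omega⟩]

lemma coeff_canonicalSeries_odd_of_lt {j l : ℤ} (hl : l < -(n : ℤ)) :
    (canonicalSeries n H (2 * j + 1)).coeff (2 * l + 1) = if l = -j - 1 then 1 else 0 := by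
  split_ifs with h
  · have := (isReducedSeries_canonicalSeries n H (2 * j + 1)).1
    rwa [show -(2 * j + 1) = 2 * l + 1 by omega] at this
  · have := (isReducedSeries_canonicalSeries n H (2 * j + 1)).2.2 (-(2 * l + 1))
      (mem_nonnegOrders.2 ⟨by omega, Or.inl (by omega)⟩) (by omega)
    rwa [neg_neg] at this

/-- The exponents outside `T` are the negative ones and the odd ones below `2n`, which is where the
first linear constraint acts. -/
lemma canonicalSeries_even (hH : LinearConstraints n H) (m : ℕ) :
    canonicalSeries n H (2 * m) = zPow (2 * m) := by
  apply canonicalSeries_eq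
  · refine ⟨by rw [coeff_zPow, if_pos rfl], fun k hk => by rw [coeff_zPow, if_neg (by omega)],
      fun i _ hi => by rw [coeff_zPow, if_neg (by omega)]⟩
  · intro k hk hlt
    rw [coeff_zPow, if_neg (by omega)]
    apply hH.1 m k (by omega)
    rw [mem_nonnegOrders, not_and_or, not_or, Int.not_even_iff_odd] at hk
    rcases hk with hk | ⟨h1, h2⟩
    · left; omega
    · right
      obtain ⟨r, hr⟩ := h2
      exact ⟨by omega, ⟨-r - 1, by omega⟩⟩

lemma zNeg_canonicalSeries_odd (hH : LinearConstraints n H) {m : ℤ} (hm : 0 ≤ m) :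
    zNeg (canonicalSeries n H (2 * m + 1)) = -canonicalSeries n H (2 * m + 1) := by
  classical
  apply zNeg_eq_neg
  rintro _ ⟨r, rfl⟩
  rw [coeff_canonicalSeries, if_neg (by omega)]
  split_ifs with h
  · obtain ⟨h1, -⟩ := h
    rw [mem_nonnegOrders, not_and_or] at h1
    rcases h1 with h1 | h1
    · rw [show r + r = 2 * r by ring]
      exact hH.2 m r hm (by omega)
    · exact absurd (Or.inr ⟨-r, by ring⟩) h1
  · rfl

/-- The coefficient of `z ^ (-2l)` in a product of two odd series. -/
lemma coeff_mul_of_odd {f g : LaurentSeries ℂ} (hf : zNeg f = -f) (hg : zNeg g = -g) {a b : ℤ}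
    (hfa : ∀ l < a, f.coeff (2 * l + 1) = 0) (hgb : ∀ l < b, g.coeff (2 * l + 1) = 0) (l : ℤ) :
    (f * g).coeff (2 * l) =
      ∑ s ∈ Finset.Icc a (l - 1 - b), f.coeff (2 * s + 1) * g.coeff (2 * (l - s) - 1) := by
  have hf' : ∀ k < 2 * a + 1, f.coeff k = 0 := by
    intro k hk
    rcases Int.even_or_odd' k with ⟨r, rfl | rfl⟩
    · exact coeff_eq_zero_of_zNeg_eq_neg hf ⟨r, by ring⟩
    · exact hfa r (by omega)
  have hg' : ∀ k < 2 * b + 1, g.coeff k = 0 := by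
    intro k hk
    rcases Int.even_or_odd' k with ⟨r, rfl | rfl⟩
    · exact coeff_eq_zero_of_zNeg_eq_neg hg ⟨r, by ring⟩
    · exact hgb r (by omega)
  rw [coeff_mul_eq_sum_Icc hf' hg']
  symm
  refine Finset.sum_of_injOn (fun s => 2 * s + 1) (fun x _ y _ h => by simpa using h) ?_ ?_ ?_
  · intro s hs
    simp only [Finset.coe_Icc, Set.mem_Icc] at hs ⊢
    omega
  · intro i hi hni
    rcases Int.even_or_odd' i with ⟨r, rfl | rfl⟩
    · rw [coeff_eq_zero_of_zNeg_eq_neg hf ⟨r, by ring⟩, zero_mul]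
    · refine absurd ⟨r, ?_, rfl⟩ hni
      simp only [Finset.coe_Icc, Finset.mem_Icc, Set.mem_Icc] at hi ⊢
      omega
  · intro s _
    congr 2; ring

/-- The coefficients of the even series `p_{2j+1} p_{2k+1}`. -/
lemma coeff_canonicalSeries_mul (hH : LinearConstraints n H) {j k l : ℤ} (hj : (n : ℤ) ≤ j)
    (hk : (n : ℤ) ≤ k) (hlj : -(n : ℤ) ≤ l + j) (hlk : -(n : ℤ) ≤ l + k) :
    (canonicalSeries n H (2 * j + 1) * canonicalSeries n H (2 * k + 1)).coeff (2 * l) =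
      H (2 * j + 1) (2 * (l + k) + 1) + H (2 * k + 1) (2 * (l + j) + 1) +
        ∑ s ∈ Finset.Icc (-(n : ℤ)) (l - 1 + n),
          H (2 * j + 1) (2 * s + 1) * H (2 * k + 1) (2 * (l - s) - 1) := by
  -- Without their leading monomials the factors have exponents at most `2n-1`, where the odd
  -- coefficients are the parameters. The mixed products give the two isolated terms; the product of
  -- the leading monomials sits at `2j+2k+2`, above the exponent `-2l`.
  set f := canonicalSeries n H (2 * j + 1) - zPow (2 * j + 1) with hf
  set g := canonicalSeries n H (2 * k + 1) - zPow (2 * k + 1) with hg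
  have hfn : zNeg f = -f := by
    rw [hf, map_sub, zNeg_canonicalSeries_odd hH (by omega), zNeg_zPow_odd ⟨j, rfl⟩]; ring
  have hgn : zNeg g = -g := by
    rw [hg, map_sub, zNeg_canonicalSeries_odd hH (by omega), zNeg_zPow_odd ⟨k, rfl⟩]; ring
  have hfl : ∀ l < -(n : ℤ), f.coeff (2 * l + 1) = 0 := by
    intro l hl
    rw [hf, HahnSeries.coeff_sub, coeff_canonicalSeries_odd_of_lt hl, coeff_zPow, sub_eq_zero]
    exact if_congr (by omega) rfl rfl
  have hgl : ∀ l < -(n : ℤ), g.coeff (2 * l + 1) = 0 := by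
    intro l hl
    rw [hg, HahnSeries.coeff_sub, coeff_canonicalSeries_odd_of_lt hl, coeff_zPow, sub_eq_zero]
    exact if_congr (by omega) rfl rfl
  have hfc : ∀ l : ℤ, -(n : ℤ) ≤ l → f.coeff (2 * l + 1) = H (2 * j + 1) (2 * l + 1) := by
    intro l hl
    rw [hf, HahnSeries.coeff_sub, coeff_canonicalSeries_odd hj hl, coeff_zPow, if_neg (by omega),
      sub_zero]
  have hgc : ∀ l : ℤ, -(n : ℤ) ≤ l → g.coeff (2 * l + 1) = H (2 * k + 1) (2 * l + 1) := by
    intro l hl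
    rw [hg, HahnSeries.coeff_sub, coeff_canonicalSeries_odd hk hl, coeff_zPow, if_neg (by omega),
      sub_zero]
  have e : canonicalSeries n H (2 * j + 1) * canonicalSeries n H (2 * k + 1) =
      zPow (2 * k + 1) * f + zPow (2 * j + 1) * g + f * g + zPow (2 * j + 1) * zPow (2 * k + 1) := by
    rw [hf, hg]; ring
  rw [e, zPow_mul_zPow]
  simp only [HahnSeries.coeff_add, coeff_zPow_mul]
  rw [coeff_mul_of_odd hfn hgn hfl hgl, coeff_zPow, if_neg (by omega), add_zero,
    show 2 * l + (2 * k + 1) = 2 * (l + k) + 1 by ring,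
    show 2 * l + (2 * j + 1) = 2 * (l + j) + 1 by ring, hfc _ hlk, hgc _ hlj, sub_neg_eq_add]
  congr 1
  refine Finset.sum_congr rfl fun s hs => ?_
  rw [Finset.mem_Icc] at hs
  rw [hfc s hs.1, show 2 * (l - s) - 1 = 2 * (l - s - 1) + 1 by ring, hgc _ (by omega)]

/-- The range of summation in the quadratic constraints. -/
lemma sum_Icc_split (n : ℕ) {l : ℤ} (hl : 1 ≤ l) (F G : ℤ → ℂ) :
    ∑ s ∈ Finset.Icc (-(n : ℤ)) (l - 1 + n), F (2 * s + 1) * G (2 * (l - s) - 1) =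
      ∑ s ∈ Finset.Icc (-(n : ℤ)) (-1), F (2 * s + 1) * G (2 * (l - s) - 1) +
      ∑ r ∈ Finset.Icc (-(n : ℤ)) (-1), G (2 * r + 1) * F (2 * (l - r) - 1) +
      ∑ s ∈ Finset.Icc (0 : ℤ) (l - 1), F (2 * s + 1) * G (2 * (l - s) - 1) := by
  -- The reflection `s ↦ l - 1 - s` exchanges the two factors and carries the top piece `[l, l-1+n]`
  -- to `[-n, -1]`.
  have e : Finset.Icc (-(n : ℤ)) (l - 1 + n) =
      (Finset.Icc (-(n : ℤ)) (-1) ∪ Finset.Icc l (l - 1 + n)) ∪ Finset.Icc (0 : ℤ) (l - 1) := by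
    ext s; simp only [Finset.mem_union, Finset.mem_Icc]; omega
  rw [e, Finset.sum_union, Finset.sum_union]
  · congr 2
    refine Finset.sum_nbij' (fun s => l - 1 - s) (fun s => l - 1 - s) ?_ ?_ ?_ ?_ ?_
    · intro s hs; simp only [Finset.mem_Icc] at hs ⊢; omega
    · intro s hs; simp only [Finset.mem_Icc] at hs ⊢; omega
    · intro s _; ring
    · intro s _; ring
    · intro s _
      rw [mul_comm]
      congr 2 <;> ring
  · rw [Finset.disjoint_left]; intro s; simp only [Finset.mem_Icc]; omega
  · rw [Finset.disjoint_left]; intro s; simp only [Finset.mem_union, Finset.mem_Icc]; omega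

end Constraints

/-! ### Admissible parameters give a ring `ℂ[z ^ 2] + ℂ[z ^ 2] p_{2n+1}`. -/

section Admissible

open Polynomial

variable {n : ℕ} {H : ℤ → ℤ → ℂ}

/-- Multiplication by `z ^ 2` moves the free exponent `2n-1` to `2n+1`, the only exponent in `T`
reached besides the leading one. This is the first quadratic family at `k = 1`. -/
lemma zPow_two_mul_canonicalSeries (hH : Admissible n H) {j : ℤ} (hj : (n : ℤ) ≤ j) :
    zPow 2 * canonicalSeries n H (2 * j + 1) = canonicalSeries n H (2 * (j + 1) + 1) +
      H (2 * j + 1) (2 * (-n) + 1) • canonicalSeries n H (2 * n + 1) := by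
  have h1 := zNeg_canonicalSeries_odd hH.1 (m := j) (by omega)
  have h2 := zNeg_canonicalSeries_odd hH.1 (m := j + 1) (by omega)
  have h3 := zNeg_canonicalSeries_odd hH.1 (m := n) (by omega)
  ext k
  rw [coeff_zPow_mul, HahnSeries.coeff_add, HahnSeries.coeff_smul, smul_eq_mul]
  rcases Int.even_or_odd' k with ⟨l, rfl | rfl⟩
  · rw [coeff_eq_zero_of_zNeg_eq_neg h1 ⟨l + 1, by ring⟩,
      coeff_eq_zero_of_zNeg_eq_neg h2 ⟨l, by ring⟩, coeff_eq_zero_of_zNeg_eq_neg h3 ⟨l, by ring⟩]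
    simp
  · rw [show 2 * l + 1 + 2 = 2 * (l + 1) + 1 by ring]
    by_cases hl : -(n : ℤ) ≤ l
    · rw [coeff_canonicalSeries_odd hj (by omega), coeff_canonicalSeries_odd (by omega) hl,
        coeff_canonicalSeries_odd le_rfl hl]
      have := hH.2.1 j 1 l hj (by omega) hl
      rw [show (1 : ℤ) - n - 1 = -n by ring, Finset.Icc_self, Finset.sum_singleton,
        show 2 * (1 - -(n : ℤ)) - 1 = 2 * n + 1 by ring] at this
      linear_combination this
    · rw [coeff_canonicalSeries_odd_of_lt (by omega : l < -(n : ℤ)),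
        coeff_canonicalSeries_odd_of_lt (by omega : l < -(n : ℤ)), if_congr
        (show l = -(j + 1) - 1 ↔ l + 1 = -j - 1 by omega) rfl rfl]
      by_cases hl' : l + 1 = -(n : ℤ)
      · rw [hl', coeff_canonicalSeries_odd hj le_rfl, if_neg (by omega), if_pos (by omega)]
        ring
      · rw [coeff_canonicalSeries_odd_of_lt (by omega), if_neg (show ¬ l = -(n : ℤ) - 1 by omega)]
        ring

/-- The polynomials `α_{n+i}`. -/
noncomputable def alphaPoly (n : ℕ) (H : ℤ → ℤ → ℂ) : ℕ → ℂ[X]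
  | 0 => 1
  | i + 1 => X * alphaPoly n H i - C (H (2 * (n + i : ℤ) + 1) (2 * (-n) + 1))

lemma alphaPoly_monic_natDegree (n : ℕ) (H : ℤ → ℤ → ℂ) (i : ℕ) :
    (alphaPoly n H i).Monic ∧ (alphaPoly n H i).natDegree = i := by
  induction i with
  | zero => exact ⟨monic_one, natDegree_one⟩
  | succ i ih =>
    have hm : (X * alphaPoly n H i).Monic := monic_X.mul ih.1
    have hd : (X * alphaPoly n H i).natDegree = i + 1 := by
      rw [natDegree_X_mul ih.1.ne_zero, ih.2]
    have hlt : (C (H (2 * (n + i : ℤ) + 1) (2 * (-n) + 1))).degree < (X * alphaPoly n H i).degree := by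
      refine degree_C_le.trans_lt ?_
      rw [degree_eq_natDegree hm.ne_zero, hd]
      exact_mod_cast Nat.succ_pos i
    refine ⟨?_, ?_⟩
    · rw [alphaPoly]
      exact hm.sub_of_left hlt
    · rw [alphaPoly, natDegree_sub_eq_left_of_natDegree_lt, hd]
      rw [natDegree_C, hd]; omega

lemma canonicalSeries_odd_eq (hH : Admissible n H) (i : ℕ) :
    canonicalSeries n H (2 * (n + i : ℤ) + 1) =
      aeval (zPow 2) (alphaPoly n H i) * canonicalSeries n H (2 * n + 1) := by
  induction i with
  | zero => simp [alphaPoly]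
  | succ i ih =>
    have := zPow_two_mul_canonicalSeries hH (j := n + i) (by omega)
    rw [alphaPoly, map_sub, map_mul, aeval_X, aeval_C, sub_mul, mul_assoc, ← ih, this,
      smul_eq_algebraMap_mul, add_sub_cancel_right]
    push_cast
    rw [add_assoc]

/-- The meaning of the second quadratic family: index `2l > 0` is the negative power `z ^ (-2l)`. -/
lemma coeff_canonicalSeries_sq_pos (hH : Admissible n H) {j k l : ℤ} (hj : (n : ℤ) ≤ j)
    (hk : (n : ℤ) ≤ k) (hl : 1 ≤ l) :
    (canonicalSeries n H (2 * j + 1) * canonicalSeries n H (2 * k + 1)).coeff (2 * l) = 0 := by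
  rw [coeff_canonicalSeries_mul hH.1 hj hk (by omega) (by omega), sum_Icc_split n hl]
  have := hH.2.2 j k l hj hk hl
  linear_combination this

lemma coeff_branchPoly (n : ℕ) (H : ℤ → ℤ → ℂ) (i : ℕ) : (branchPoly n H).coeff i =
    if i = 2 * n + 1 then 1 else if i < 2 * n + 1 then uCoeff n H i else 0 := by
  rw [branchPoly, coeff_add, finsetSum_coeff, coeff_X_pow]
  simp only [coeff_C_mul, coeff_X_pow, mul_ite, mul_one, mul_zero, Finset.sum_ite_eq,
    Finset.mem_range]
  split_ifs <;> first | omega | simp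

lemma branchPoly_natDegree (n : ℕ) (H : ℤ → ℤ → ℂ) : (branchPoly n H).natDegree = 2 * n + 1 := by
  apply natDegree_eq_of_le_of_coeff_ne_zero
  · rw [natDegree_le_iff_coeff_eq_zero]
    intro i hi
    rw [coeff_branchPoly, if_neg (by omega), if_neg (by omega)]
  · rw [coeff_branchPoly, if_pos rfl]; exact one_ne_zero

lemma branchPoly_ne_zero (n : ℕ) (H : ℤ → ℤ → ℂ) : branchPoly n H ≠ 0 := by
  intro h
  have := branchPoly_natDegree n H
  rw [h, natDegree_zero] at this
  omega

/-- The coefficients of `p_{2n+1} ^ 2` at the nonnegative powers of `z`. -/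
lemma coeff_canonicalSeries_sq (hH : LinearConstraints n H) (i : ℕ) :
    (canonicalSeries n H (2 * n + 1) ^ 2).coeff (-(2 * (i : ℤ))) = (branchPoly n H).coeff i := by
  have hr := isReducedSeries_canonicalSeries n H (2 * n + 1)
  have hlow := coeff_mul_eq_sum_Icc hr.2.1 hr.2.1
  rw [coeff_branchPoly, sq]
  split_ifs with h1 h2
  · rw [hlow, show -(2 * (i : ℤ)) - -(2 * n + 1) = -(2 * n + 1) by omega, Finset.Icc_self,
      Finset.sum_singleton, show -(2 * (i : ℤ)) - -(2 * n + 1) = -(2 * n + 1) by omega, hr.1, mul_one]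
  · rw [show -(2 * (i : ℤ)) = 2 * (-i) by ring,
      coeff_canonicalSeries_mul hH le_rfl le_rfl (by omega) (by omega), uCoeff,
      show -(i : ℤ) + n = n - i by ring, show -(i : ℤ) - 1 + n = n - i - 1 by ring, ← two_mul]
    congr 1
    refine Finset.sum_congr rfl fun s _ => ?_
    congr 2; ring
  · rw [hlow, Finset.Icc_eq_empty (by omega), Finset.sum_empty]

/-- The square of an odd series is even; its negative powers vanish by the second quadratic family,
and its other coefficients are those of `P`. -/
lemma canonicalSeries_sq (hH : Admissible n H) :
    canonicalSeries n H (2 * n + 1) ^ 2 = aeval (zPow 2) (branchPoly n H) := by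
  have hodd := zNeg_canonicalSeries_odd hH.1 (m := n) (by omega)
  ext k
  rw [coeff_aeval_zPow_two]
  rcases Int.even_or_odd' k with ⟨r, rfl | rfl⟩
  · split_ifs with h
    · obtain ⟨s, rfl⟩ : ∃ s : ℕ, r = -s := ⟨(-r).toNat, by omega⟩
      rw [show (-(2 * -(s : ℤ)) / 2).toNat = s by omega, ← coeff_canonicalSeries_sq hH.1]
      congr 1; ring
    · have hr : 1 ≤ r := by
        by_contra hr; exact h ⟨by omega, even_two_mul r⟩
      rw [sq]
      exact coeff_canonicalSeries_sq_pos hH le_rfl le_rfl hr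
  · rw [if_neg (by rintro ⟨-, h⟩; rw [Int.even_iff] at h; omega)]
    apply coeff_eq_zero_of_zNeg_eq_self _ ⟨r, rfl⟩
    rw [map_pow, hodd]; ring

/-- One inclusion comes from `p_{2m} = z ^ (2m)` and the polynomials `α_m`; equality follows because
both spaces have the orders `T`. -/
lemma spanSeries_eq_quadSpan (hH : Admissible n H) :
    spanSeries n H = quadSpan 1 (canonicalSeries n H (2 * n + 1)) := by
  symm
  apply eq_of_le_of_zOrders_subset (N := 0)
  · rw [spanSeries, Submodule.span_le]
    rintro _ ⟨⟨j, hj⟩, rfl⟩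
    rcases nonnegOrders_cases hj with ⟨m, rfl⟩ | ⟨m, hm, rfl⟩
    · refine ⟨X ^ m, 0, ?_⟩
      simp only [map_pow, aeval_X, map_zero, zPow_pow, mul_one, zero_mul, add_zero]
      exact canonicalSeries_even hH.1 m
    · refine ⟨0, alphaPoly n H (m - n), ?_⟩
      rw [← canonicalSeries_odd_eq hH, map_zero, zero_mul, zero_add]
      push_cast [hm]
      congr 1; ring_nf
  · rw [zOrders_spanSeries, zOrders_quadSpan_one (zNeg_canonicalSeries_odd hH.1 (by omega))
      (isReducedSeries_canonicalSeries n H _)]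
  · rw [zOrders_quadSpan_one (zNeg_canonicalSeries_odd hH.1 (by omega))
      (isReducedSeries_canonicalSeries n H _)]
    exact fun k hk => (mem_nonnegOrders.1 hk).1

end Admissible

/-! ### Every multiplicatively closed stable space comes from admissible parameters. -/

section Converse

open Polynomial

variable {n : ℕ} {U : Submodule ℂ (LaurentSeries ℂ)}

lemma aeval_zPow_two_mul_mem (hz : ZSqStable U) {f : LaurentSeries ℂ} (hf : f ∈ U) (a : ℂ[X]) :
    aeval (zPow 2) a * f ∈ U := by
  induction a using Polynomial.induction_on' with
  | add a b ha hb => rw [map_add, add_mul]; exact U.add_mem ha hb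
  | monomial m c =>
    rw [aeval_monomial, mul_assoc, ← smul_eq_algebraMap_mul]
    apply U.smul_mem
    induction m with
    | zero => simpa using hf
    | succ m ih => rw [pow_succ', mul_assoc]; exact hz _ ih

/-- A multiplicatively closed space with the orders `0, 2, …, 2n, 2n+1, …` contains `1`. -/
lemma one_mem_of_mul_closed (hU : zOrders U = nonnegOrders n) (hmul : U * U ≤ U) : 1 ∈ U := by
  obtain ⟨e, he, hr⟩ := exists_isReducedSeries hU.ge 0 (two_mul_mem_nonnegOrders n 0)
  simp only [Nat.cast_zero] at hr
  have hlt : ∀ k < (0 : ℤ), e.coeff k = 0 := fun k hk => hr.2.1 k (by omega)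
  -- `e * e` again has constant term `1` and no positive exponents, so uniqueness of reduced
  -- elements makes `e` idempotent.
  have hee : IsReducedSeries n 0 (e * e) := by
    have h := coeff_mul_eq_sum_Icc hlt hlt
    have hlt' : ∀ k < (0 : ℤ), (e * e).coeff k = 0 := by
      intro k hk
      rw [h, Finset.Icc_eq_empty (by omega), Finset.sum_empty]
    refine ⟨?_, fun k hk => hlt' k (by omega), fun i hi h0 => hlt' _ ?_⟩
    · have h1 := hr.1
      simp only [neg_zero] at h1 ⊢
      rw [h, sub_self, Finset.Icc_self, Finset.sum_singleton, sub_self, h1, one_mul]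
    · have := (mem_nonnegOrders.1 hi).1; omega
  have heq : e * e = e := eq_of_isReducedSeries hU.le (mul_self_le_iff.1 hmul e he e he) he hee hr
  have : e = 1 := mul_left_cancel₀ hr.ne_zero (by rw [heq, mul_one])
  rwa [← this]

/-- The multiplicatively closed, `z ^ 2`-stable spaces with the orders `0, 2, …, 2n, 2n+1, …` are
of the form `ℂ[z ^ 2] + ℂ[z ^ 2] q` with an odd series `q` of order `2n+1`. -/
lemma exists_eq_quadSpan (hU : zOrders U = nonnegOrders n) (hmul : U * U ≤ U)
    (hz : ZSqStable U) :
    ∃ q : LaurentSeries ℂ, IsReducedSeries n (2 * n + 1) q ∧ zNeg q = -q ∧ U = quadSpan 1 q := by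
  obtain ⟨q, hq, hr⟩ := exists_isReducedSeries hU.ge (2 * n + 1)
    (by push_cast; exact odd_mem_nonnegOrders le_rfl)
  push_cast at hr
  have h1 := one_mem_of_mul_closed hU hmul
  have hle : quadSpan 1 q ≤ U := by
    rintro _ ⟨a, b, rfl⟩
    exact U.add_mem (aeval_zPow_two_mul_mem hz h1 a) (aeval_zPow_two_mul_mem hz hq b)
  have hUq : U = quadSpan 1 q := by
    apply eq_of_le_of_zOrders_subset hle (N := 0)
    · rw [hU]
      intro k hk
      rcases nonnegOrders_cases hk with ⟨m, rfl⟩ | ⟨m, hm, rfl⟩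
      · refine ⟨aeval (zPow 2) (X ^ m : ℂ[X]), ⟨X ^ m, 0, by rw [map_zero]; ring⟩, ?_, ?_⟩
        · rw [map_pow, aeval_X]; exact pow_ne_zero _ (zPow_ne_zero _)
        · rw [order_aeval_zPow_two (pow_ne_zero _ X_ne_zero), natDegree_X_pow, neg_neg]
      · refine ⟨aeval (zPow 2) (X ^ (m - n) : ℂ[X]) * q, ⟨0, X ^ (m - n), by rw [map_zero]; ring⟩,
          ?_, ?_⟩
        · rw [map_pow, aeval_X]; exact mul_ne_zero (pow_ne_zero _ (zPow_ne_zero _)) hr.ne_zero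
        · rw [order_aeval_mul (pow_ne_zero _ X_ne_zero) hr.ne_zero, natDegree_X_pow, hr.order]
          push_cast [hm]; ring
    · rw [hU]; exact fun k hk => (mem_nonnegOrders.1 hk).1
  refine ⟨q, hr, ?_, hUq⟩
  -- Oddness of `q`: subtract from `q² = a + b q` its image under `z ↦ -z` and cancel `q(z) -
  -- q(-z)`, whose leading coefficient is `2`. Then `q(z) + q(-z) = b(z²)`, while `q` has no even
  -- nonnegative exponents.
  have hqq := mul_self_le_iff.1 hmul q hq q hq
  rw [hUq] at hqq
  obtain ⟨a, b, hab⟩ := hqq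
  have hab' := congrArg zNeg hab
  simp only [map_mul, map_add, zNeg_aeval_zPow_two, map_one] at hab'
  have hne : q - zNeg q ≠ 0 := by
    apply ne_zero_of_coeff (a := -(2 * n + 1))
    rw [HahnSeries.coeff_sub, coeff_zNeg_of_odd q ⟨-n - 1, by ring⟩, hr.1]
    norm_num
  have hs : q + zNeg q = aeval (zPow 2) b := by
    apply mul_left_cancel₀ hne
    linear_combination hab - hab'
  have hb : b = 0 := by
    ext i
    rw [← coeff_aeval_zPow_two_neg, ← hs, HahnSeries.coeff_add,
      coeff_zNeg_of_even q ⟨-i, by ring⟩, hr.2.2 _ (two_mul_mem_nonnegOrders n i) (by omega)]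
    simp
  rw [hb, map_zero] at hs
  linear_combination hs

/-- Such a space is `⟨p_j⟩` for parameters that obey the constraints. -/
lemma exists_admissible_eq_spanSeries {q : LaurentSeries ℂ} (hr : IsReducedSeries n (2 * n + 1) q)
    (hq : zNeg q = -q) (hmul : quadSpan 1 q * quadSpan 1 q ≤ quadSpan 1 q) :
    ∃ H, Admissible n H ∧ quadSpan 1 q = spanSeries n H ∧ canonicalSeries n H (2 * n + 1) = q := by
  classical
  have hord := zOrders_quadSpan_one hq hr
  set U := quadSpan 1 q with hUdef
  have hex : ∀ j : ℤ, j ∈ nonnegOrders n → ∃ f ∈ U, IsReducedSeries n j f := by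
    intro j hj
    have h0 := (mem_nonnegOrders.1 hj).1
    obtain ⟨m, rfl⟩ : ∃ m : ℕ, j = m := ⟨j.toNat, by omega⟩
    exact exists_isReducedSeries hord.ge m hj
  choose! p hpU hp using hex
  -- The parameters are read off the reduced basis. The default `0` matters: the linear constraints
  -- also involve rows `2m+1 < 2n+1`, which index no basis element.
  set H : ℤ → ℤ → ℂ := fun j k =>
    if j ∈ nonnegOrders n ∧ -k ∉ nonnegOrders n ∧ -k < j then (p j).coeff k else 0 with hH
  have hcan : ∀ j ∈ nonnegOrders n, canonicalSeries n H j = p j := by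
    intro j hj
    apply canonicalSeries_eq (hp j hj)
    intro k hk hlt
    rw [hH]; exact if_pos ⟨hj, hk, hlt⟩
  have hspan : U = spanSeries n H := by
    apply eq_of_le_of_zOrders_subset (N := 0)
    · rw [spanSeries, Submodule.span_le]
      rintro _ ⟨⟨j, hj⟩, rfl⟩
      change canonicalSeries n H j ∈ U
      rw [hcan j hj]
      exact hpU j hj
    · rw [hord, zOrders_spanSeries]
    · rw [hord]; exact fun k hk => (mem_nonnegOrders.1 hk).1
  have hevenmem : ∀ m : ℕ, zPow (2 * m) ∈ U := fun m => ⟨X ^ m, 0, by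
    rw [map_pow, aeval_X, zPow_pow, map_zero]; ring⟩
  have heven : ∀ m : ℕ, p (2 * m) = zPow (2 * m) := by
    intro m
    have hT := two_mul_mem_nonnegOrders n m
    refine eq_of_isReducedSeries hord.le (hpU _ hT) (hevenmem m) (hp _ hT) ?_
    exact ⟨by rw [coeff_zPow, if_pos rfl], fun k hk => by rw [coeff_zPow, if_neg (by omega)],
      fun i _ hi => by rw [coeff_zPow, if_neg (by omega)]⟩
  have hoddmul : ∀ b : ℂ[X], zNeg (aeval (zPow 2) b * q) = -(aeval (zPow 2) b * q) := by
    intro b; rw [map_mul, zNeg_aeval_zPow_two, hq]; ring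
  have hodd : ∀ m : ℕ, n ≤ m → zNeg (p (2 * m + 1)) = -p (2 * m + 1) := by
    intro m hm
    have hT := odd_mem_nonnegOrders hm
    obtain ⟨a, b, hab⟩ := hpU _ hT
    -- The coefficients of `a` sit at even nonnegative exponents, where a reduced series of odd
    -- order vanishes.
    have ha : a = 0 := by
      ext i
      have h1 := (hp _ hT).2.2 _ (two_mul_mem_nonnegOrders n i) (by omega)
      rw [hab, mul_one, HahnSeries.coeff_add, coeff_aeval_zPow_two_neg,
        coeff_eq_zero_of_zNeg_eq_neg (hoddmul b) ⟨-i, by ring⟩, add_zero] at h1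
      rw [h1, coeff_zero]
    rw [ha, map_zero, zero_mul, zero_add] at hab
    rw [hab, hoddmul]
  have hlin : LinearConstraints n H := by
    constructor
    · intro m k hm _
      obtain ⟨m, rfl⟩ : ∃ m' : ℕ, m = m' := ⟨m.toNat, by omega⟩
      simp only [hH]
      split_ifs with h
      · rw [heven, coeff_zPow, if_neg]
        rintro rfl
        exact h.2.1 (by rw [neg_neg]; exact h.1)
      · rfl
    · intro m k hm _
      simp only [hH]
      split_ifs with h
      · obtain ⟨m, rfl⟩ : ∃ m' : ℕ, m = m' := ⟨m.toNat, by omega⟩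
        have hnm : n ≤ m := by
          rcases (mem_nonnegOrders.1 h.1).2 with h2 | h2
          · omega
          · rw [Int.even_iff] at h2; omega
        exact coeff_eq_zero_of_zNeg_eq_neg (hodd m hnm) ⟨k, by ring⟩
      · rfl
  have hqcan : canonicalSeries n H (2 * n + 1) = q := by
    have hT := odd_mem_nonnegOrders (le_refl n)
    rw [hcan _ hT]
    refine eq_of_isReducedSeries hord.le (hpU _ hT) ⟨0, 1, ?_⟩ (hp _ hT) hr
    rw [map_zero, map_one]; ring
  have hmemU : ∀ j : ℤ, (n : ℤ) ≤ j → canonicalSeries n H (2 * j + 1) ∈ spanSeries n H := by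
    intro j hj
    exact canonicalSeries_mem n H (mem_nonnegOrders.2 ⟨by omega, Or.inl (by omega)⟩)
  have hneg : ∀ j : ℤ, (n : ℤ) ≤ j →
      zNeg (canonicalSeries n H (2 * j + 1)) = -canonicalSeries n H (2 * j + 1) :=
    fun j hj => zNeg_canonicalSeries_odd hlin (by omega)
  refine ⟨H, ⟨hlin, ?_, ?_⟩, hspan, hqcan⟩
  · intro j k l hj hk hl
    -- Both sides lie in the space, so it suffices to compare exponents in `T`. The term of
    -- `p_{2j+1}` at `-(2s+1)` moves to `2(k-s-1)+1`, which is at least `2n+1` exactly when `s ≤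
    -- k-n-1`. Comparing the remaining coefficients then gives the first quadratic family.
    have key : zPow (2 * k) * canonicalSeries n H (2 * j + 1) =
        canonicalSeries n H (2 * (j + k) + 1) + ∑ s ∈ Finset.Icc (-(n : ℤ)) (k - n - 1),
          H (2 * j + 1) (2 * s + 1) • canonicalSeries n H (2 * (k - s - 1) + 1) := by
      apply eq_of_mem_spanSeries (n := n) (H := H)
      · obtain ⟨k, rfl⟩ : ∃ k' : ℕ, k = k' := ⟨k.toNat, by omega⟩
        have := aeval_zPow_two_mul_mem (zSqStable_quadSpan 1 q)
          (hUdef ▸ hspan ▸ hmemU j hj) (X ^ k)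
        rwa [map_pow, aeval_X, zPow_pow, ← hUdef, hspan] at this
      · refine Submodule.add_mem _ (hmemU _ (by omega)) (Submodule.sum_mem _ fun s hs => ?_)
        rw [Finset.mem_Icc] at hs
        exact Submodule.smul_mem _ _ (hmemU _ (by omega))
      · intro i hi
        rw [coeff_zPow_mul, HahnSeries.coeff_add, HahnSeries.coeff_sum]
        rcases nonnegOrders_cases hi with ⟨m, rfl⟩ | ⟨m, hm, rfl⟩
        · rw [coeff_eq_zero_of_zNeg_eq_neg (hneg j hj) ⟨k - m, by ring⟩,
            coeff_eq_zero_of_zNeg_eq_neg (hneg (j + k) (by omega)) ⟨-m, by ring⟩,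
            Finset.sum_eq_zero, add_zero]
          intro s hs
          rw [Finset.mem_Icc] at hs
          rw [HahnSeries.coeff_smul, coeff_eq_zero_of_zNeg_eq_neg (hneg _ (by omega)) ⟨-m, by ring⟩,
            smul_zero]
        · rw [show -(2 * (m : ℤ) + 1) + 2 * k = 2 * (k - m - 1) + 1 by ring,
            show -(2 * (m : ℤ) + 1) = 2 * (-m - 1) + 1 by ring,
            coeff_canonicalSeries_odd_of_lt (show -(m : ℤ) - 1 < -n by omega)]
          have hsum : ∀ s ∈ Finset.Icc (-(n : ℤ)) (k - n - 1),
              (H (2 * j + 1) (2 * s + 1) • canonicalSeries n H (2 * (k - s - 1) + 1)).coeff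
                (2 * (-m - 1) + 1) =
                if s = k - m - 1 then H (2 * j + 1) (2 * s + 1) else 0 := by
            intro s hs
            rw [HahnSeries.coeff_smul, coeff_canonicalSeries_odd_of_lt (by omega), smul_eq_mul,
              mul_ite, mul_one, mul_zero]
            exact if_congr (by omega) rfl rfl
          rw [Finset.sum_congr rfl hsum, Finset.sum_ite_eq']
          by_cases hkm : -(n : ℤ) ≤ k - m - 1
          · rw [coeff_canonicalSeries_odd hj hkm, if_neg (by omega),
              if_pos (Finset.mem_Icc.2 ⟨hkm, by omega⟩), zero_add]
          · rw [coeff_canonicalSeries_odd_of_lt (by omega),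
              if_neg (show ¬ (k - m - 1 ∈ Finset.Icc (-(n : ℤ)) (k - n - 1)) by
                rw [Finset.mem_Icc]; omega), add_zero]
            exact if_congr (by omega) rfl rfl
    have h2 := congrArg (fun f => HahnSeries.coeff f (2 * l + 1)) key
    simp only [coeff_zPow_mul, HahnSeries.coeff_add, HahnSeries.coeff_sum,
      HahnSeries.coeff_smul] at h2
    rw [show 2 * l + 1 + 2 * k = 2 * (l + k) + 1 by ring,
      coeff_canonicalSeries_odd hj (by omega), coeff_canonicalSeries_odd (by omega) hl] at h2
    rw [h2, add_sub_cancel_left, sub_eq_zero]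
    refine Finset.sum_congr rfl fun s hs => ?_
    rw [Finset.mem_Icc] at hs
    rw [coeff_canonicalSeries_odd (by omega) hl, smul_eq_mul,
      show 2 * (k - s - 1) + 1 = 2 * (k - s) - 1 by ring]
  · intro j k l hj hk hl
    have h1 := coeff_canonicalSeries_mul hlin hj hk (l := l) (by omega) (by omega)
    rw [sum_Icc_split n hl] at h1
    have h2 : canonicalSeries n H (2 * j + 1) * canonicalSeries n H (2 * k + 1) ∈ U := by
      apply mul_self_le_iff.1 hmul
      · rw [hspan]; exact hmemU j hj
      · rw [hspan]; exact hmemU k hk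
    -- The even part of an element of `quadSpan 1 q` is a polynomial in `z ^ 2`, so the coefficient
    -- of `z ^ (-2l)` vanishes for `l ≥ 1`.
    obtain ⟨a, b, hab⟩ := h2
    rw [hab, HahnSeries.coeff_add, mul_one, coeff_aeval_zPow_two, if_neg (by omega),
      coeff_eq_zero_of_zNeg_eq_neg (hoddmul b) ⟨l, by ring⟩] at h1
    linear_combination -h1

end Converse

/-! ### Extremality of `W_{2n}` and maximality of its members. -/

section Greatest

open Polynomial

variable {n : ℕ}

lemma spanSeries_mem_nonnegParts {H : ℤ → ℤ → ℂ} (hH : Admissible n H) :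
    spanSeries n H ∈ nonnegParts n := by
  refine ⟨zOrders_spanSeries n H, _, quadSpan_mem_birkhoffStratum
    (zNeg_canonicalSeries_odd hH.1 (by omega)) (isReducedSeries_canonicalSeries n H _), ?_⟩
  rw [spanSeries_eq_quadSpan hH]
  exact quadSpan_one_le _ n

lemma spanSeries_mul_le {H : ℤ → ℤ → ℂ} (hH : Admissible n H) :
    spanSeries n H * spanSeries n H ≤ spanSeries n H := by
  rw [spanSeries_eq_quadSpan hH]
  exact quadSpan_one_mul_le (canonicalSeries_sq hH)

lemma isGreatest_hyperellipticSubset (n : ℕ) :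
    IsGreatest
      {X : Set (Submodule ℂ (LaurentSeries ℂ)) |
        X ⊆ nonnegParts n ∧ ∀ U ∈ X, U * U ≤ U ∧ ZSqStable U}
      (hyperellipticSubset n) := by
  constructor
  · constructor
    · rintro _ ⟨H, hH, rfl⟩
      exact spanSeries_mem_nonnegParts hH
    · rintro _ ⟨H, hH, rfl⟩
      refine ⟨spanSeries_mul_le hH, ?_⟩
      rw [spanSeries_eq_quadSpan hH]
      exact zSqStable_quadSpan _ _
  · rintro X ⟨hX, hX'⟩ U hU
    obtain ⟨q, hr, hq, rfl⟩ := exists_eq_quadSpan (hX hU).1 (hX' U hU).1 (hX' U hU).2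
    obtain ⟨H, hH, h, -⟩ := exists_admissible_eq_spanSeries hr hq (hX' _ hU).1
    exact ⟨H, hH, h⟩

/-- If `f ∈ A` had negative order, `f ^ (2n+1)` would have order below `-2n`, the least order in
`V`. So the orders of `A` lie in `T`, and `A` cannot exceed `U`. -/
lemma eq_of_mul_closed_of_le {U V A : Submodule ℂ (LaurentSeries ℂ)}
    (hU : U ∈ hyperellipticSubset n) (hV : V ∈ birkhoffStratum (2 * n)) (hAV : A ≤ V)
    (hA : A * A ≤ A) (hUA : U ≤ A) : A = U := by
  obtain ⟨H, hH, rfl⟩ := hU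
  have hsub : zOrders A ⊆ nonnegOrders n := by
    rintro _ ⟨f, hf, hf0, rfl⟩
    have hVo : ∀ g ∈ A, g ≠ 0 → -g.order ∈ orderSet (2 * n) :=
      fun g hg hg0 => hV.1 ▸ ⟨g, hAV hg, hg0, rfl⟩
    refine ⟨hVo f hf hf0, ?_⟩
    by_contra hneg
    have hpow : ∀ k : ℕ, f ^ (k + 1) ∈ A := by
      intro k
      induction k with
      | zero => simpa using hf
      | succ k ih => rw [pow_succ]; exact mul_self_le_iff.1 hA _ ih _ hf
    have h1 := hVo _ (hpow (2 * n)) (pow_ne_zero _ hf0)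
    rw [HahnSeries.order_pow, nsmul_eq_mul] at h1
    have h2 : -((2 * n : ℕ) : ℤ) ≤ -(((2 * n + 1 : ℕ) : ℤ) * f.order) := by
      rcases h1 with h1 | h1
      · omega
      · exact h1.1
    push_cast at h2
    nlinarith
  apply eq_of_le_of_zOrders_subset hUA (N := 0)
  · rw [zOrders_spanSeries]; exact hsub
  · exact fun k hk => (mem_nonnegOrders.1 (hsub hk)).1

end Greatest

/-! ### Square roots of polynomials and the `2n+1` free parameters. -/

section Parametrization

open Polynomial

variable {n : ℕ}

/-- The coefficients of the square root of a polynomial in terms of the leading ones. -/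
noncomputable def sqrtCoeff (n : ℕ) (v : Fin (2 * n + 1) → ℂ) (m : ℕ) : ℂ :=
  if h : m < 2 * n + 1 then v ⟨m, h⟩
  -- With `q = z^{2n+1} + ∑ h_i z^{2(n-i)-1}`, the coefficient of `z ^ (-2(m-2n))` in `q²` is `2 h_m
  -- + ∑_{i<m} h_i h_{m-1-i}`; it must vanish for `m > 2n`.
  else -(1 / 2) * ∑ i : Fin m, sqrtCoeff n v i * sqrtCoeff n v (m - 1 - i)
termination_by m
decreasing_by
  all_goals omega

lemma sum_Icc_eq_sum_fin (n : ℕ) {l : ℤ} {m : ℕ} (hm : (m : ℤ) = l + 2 * n)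
    (F : ℤ → ℂ) :
    ∑ s ∈ Finset.Icc (-(n : ℤ)) (l - 1 + n), F (2 * s + 1) * F (2 * (l - s) - 1) =
      ∑ i : Fin m, F (2 * (((i : ℕ) : ℤ) - n) + 1) *
        F (2 * (((m - 1 - (i : ℕ) : ℕ) : ℤ) - n) + 1) := by
  symm
  refine Finset.sum_bij (fun i _ => ((i : ℕ) : ℤ) - n) ?_ ?_ ?_ ?_
  · intro i _
    have := i.2
    rw [Finset.mem_Icc]; omega
  · intro i _ j _ h
    ext; omega
  · intro s hs
    rw [Finset.mem_Icc] at hs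
    exact ⟨⟨(s + n).toNat, by omega⟩, Finset.mem_univ _, by simp only; omega⟩
  · intro i _
    have := i.2
    congr 2
    omega

/-- The uniqueness half: each vanishing coefficient of `p_{2n+1}²` is linear in the one unknown not
yet determined. -/
lemma sqrtCoeff_eq {H : ℤ → ℤ → ℂ} (hH : Admissible n H) {v : Fin (2 * n + 1) → ℂ}
    (hv : ∀ s : Fin (2 * n + 1), H (2 * n + 1) (2 * ((s : ℕ) - (n : ℤ)) + 1) = v s) (m : ℕ) :
    H (2 * n + 1) (2 * ((m : ℤ) - n) + 1) = sqrtCoeff n v m := by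
  induction m using Nat.strong_induction_on with
  | _ m ih =>
    rw [sqrtCoeff]
    split_ifs with h
    · exact hv ⟨m, h⟩
    · have hl : (1 : ℤ) ≤ m - 2 * n := by omega
      have h1 := coeff_canonicalSeries_sq_pos hH le_rfl le_rfl hl
      rw [coeff_canonicalSeries_mul hH.1 le_rfl le_rfl (by omega) (by omega),
        sum_Icc_eq_sum_fin n (m := m) (by ring),
        show (m : ℤ) - 2 * n + n = m - n by ring] at h1
      have h2 : ∑ i : Fin m, sqrtCoeff n v i * sqrtCoeff n v (m - 1 - i) =
          ∑ i : Fin m, H (2 * n + 1) (2 * (((i : ℕ) : ℤ) - n) + 1) *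
            H (2 * n + 1) (2 * (((m - 1 - (i : ℕ) : ℕ) : ℤ) - n) + 1) := by
        refine Finset.sum_congr rfl fun i _ => ?_
        rw [ih i i.2, ih (m - 1 - i) (by have := i.2; omega)]
      rw [h2]
      linear_combination (1 / 2) * h1

lemma exists_admissible (v : Fin (2 * n + 1) → ℂ) : ∃ H : ℤ → ℤ → ℂ, Admissible n H ∧
    ∀ s : Fin (2 * n + 1), H (2 * n + 1) (2 * ((s : ℕ) - (n : ℤ)) + 1) = v s := by
  classical
  -- `G` only records the square root `q` in its row `2n+1`; it need not be admissible. The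
  -- admissible `H` is obtained from the reduced basis of `quadSpan 1 q`.
  set G : ℤ → ℤ → ℂ := fun j k =>
    if j = 2 * n + 1 ∧ Odd k then sqrtCoeff n v ((k - 1) / 2 + n).toNat else 0 with hG
  have hGc : ∀ m : ℕ, G (2 * n + 1) (2 * ((m : ℤ) - n) + 1) = sqrtCoeff n v m := by
    intro m
    simp only [hG]
    rw [if_pos ⟨trivial, ⟨_, rfl⟩⟩]
    congr 1; omega
  have hlin : LinearConstraints n G := by
    constructor
    · intro m k _ _
      simp only [hG]
      rw [if_neg (by omega)]
    · intro m k _ _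
      simp only [hG]
      rw [if_neg]
      rintro ⟨-, h⟩
      rw [Int.odd_iff] at h; omega
  set q := canonicalSeries n G (2 * n + 1) with hq
  have hr : IsReducedSeries n (2 * n + 1) q := isReducedSeries_canonicalSeries n G _
  have hneg : zNeg q = -q := zNeg_canonicalSeries_odd hlin (by omega)
  have hsq : ∃ P : ℂ[X], q ^ 2 = aeval (zPow 2) P := by
    refine ⟨_, exists_aeval_zPow_two (f := q ^ 2) (N := 2 * n + 1) ?_ ?_ ?_⟩
    · intro k hk
      rcases Int.even_or_odd' k with ⟨l, rfl | rfl⟩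
      · rw [sq, hq, coeff_canonicalSeries_mul hlin le_rfl le_rfl (by omega) (by omega)]
        obtain ⟨m, hm⟩ : ∃ m : ℕ, (m : ℤ) = l + 2 * n := ⟨(l + 2 * n).toNat, by omega⟩
        rw [sum_Icc_eq_sum_fin n hm, show l + (n : ℤ) = m - n by omega, hGc]
        have h2 : ∑ i : Fin m, G (2 * n + 1) (2 * (((i : ℕ) : ℤ) - n) + 1) *
            G (2 * n + 1) (2 * (((m - 1 - (i : ℕ) : ℕ) : ℤ) - n) + 1) =
            ∑ i : Fin m, sqrtCoeff n v i * sqrtCoeff n v (m - 1 - i) :=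
          Finset.sum_congr rfl fun i _ => by rw [hGc, hGc]
        rw [h2]
        have h3 := sqrtCoeff.eq_1 n v m
        rw [dif_neg (by omega)] at h3
        linear_combination 2 * h3
      · exact coeff_eq_zero_of_zNeg_eq_self (by rw [map_pow, hneg]; ring) ⟨l, rfl⟩
    · intro k hk
      exact coeff_eq_zero_of_zNeg_eq_self (by rw [map_pow, hneg]; ring) hk
    · intro k hk
      rw [sq, coeff_mul_eq_sum_Icc hr.2.1 hr.2.1, Finset.Icc_eq_empty (by omega), Finset.sum_empty]
  obtain ⟨P, hP⟩ := hsq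
  obtain ⟨H, hH, -, hHq⟩ := exists_admissible_eq_spanSeries hr hneg (quadSpan_one_mul_le hP)
  refine ⟨H, hH, fun s => ?_⟩
  rw [← coeff_canonicalSeries_odd (H := H) le_rfl (by omega), hHq, hq,
    coeff_canonicalSeries_odd le_rfl (by omega), hGc, sqrtCoeff, dif_pos s.2]

lemma spanSeries_eq_of_leading {H H' : ℤ → ℤ → ℂ} (hH : Admissible n H) (hH' : Admissible n H')
    {v : Fin (2 * n + 1) → ℂ}
    (hv : ∀ s : Fin (2 * n + 1), H (2 * n + 1) (2 * ((s : ℕ) - (n : ℤ)) + 1) = v s)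
    (hv' : ∀ s : Fin (2 * n + 1), H' (2 * n + 1) (2 * ((s : ℕ) - (n : ℤ)) + 1) = v s) :
    spanSeries n H = spanSeries n H' := by
  rw [spanSeries_eq_quadSpan hH, spanSeries_eq_quadSpan hH']
  congr 1
  ext k
  rcases Int.even_or_odd' k with ⟨l, rfl | rfl⟩
  · rw [coeff_eq_zero_of_zNeg_eq_neg (zNeg_canonicalSeries_odd hH.1 (m := n) (by omega))
      ⟨l, by ring⟩, coeff_eq_zero_of_zNeg_eq_neg
      (zNeg_canonicalSeries_odd hH'.1 (m := n) (by omega)) ⟨l, by ring⟩]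
  · by_cases hl : -(n : ℤ) ≤ l
    · rw [coeff_canonicalSeries_odd le_rfl hl, coeff_canonicalSeries_odd le_rfl hl]
      obtain ⟨m, rfl⟩ : ∃ m : ℕ, l = m - n := ⟨(l + n).toNat, by omega⟩
      rw [sqrtCoeff_eq hH hv, sqrtCoeff_eq hH' hv']
    · rw [coeff_canonicalSeries_odd_of_lt (by omega), coeff_canonicalSeries_odd_of_lt (by omega)]

lemma existsUnique_spanSeries (v : Fin (2 * n + 1) → ℂ) :
    ∃! U : Submodule ℂ (LaurentSeries ℂ), ∃ H : ℤ → ℤ → ℂ,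
      Admissible n H ∧ U = spanSeries n H ∧
        ∀ s : Fin (2 * n + 1), H (2 * n + 1) (2 * ((s : ℕ) - (n : ℤ)) + 1) = v s := by
  obtain ⟨H, hH, hv⟩ := exists_admissible v
  refine ⟨_, ⟨H, hH, rfl, hv⟩, ?_⟩
  rintro _ ⟨H', hH', rfl, hv'⟩
  exact spanSeries_eq_of_leading hH' hH hv' hv

end Parametrization

/-! ### Algebras generated by `x` and a square root of `P(x)`. -/

section QuadSubalgebra

open Polynomial

variable {B : Type*} [CommRing B] [Algebra ℂ B]

/-- If `y ^ 2 = P(x)`, then `ℂ[x] + ℂ[x] y` is a subalgebra. -/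
noncomputable def quadSubalgebra (x y : B) (P : ℂ[X]) (h : y ^ 2 = aeval x P) :
    Subalgebra ℂ B where
  carrier := {f | ∃ a b : ℂ[X], f = aeval x a + aeval x b * y}
  mul_mem' := by
    rintro _ _ ⟨a, b, rfl⟩ ⟨a', b', rfl⟩
    refine ⟨a * a' + b * b' * P, a * b' + a' * b, ?_⟩
    simp only [map_add, map_mul, ← h]
    ring
  add_mem' := by
    rintro _ _ ⟨a, b, rfl⟩ ⟨a', b', rfl⟩
    exact ⟨a + a', b + b', by simp only [map_add]; ring⟩
  algebraMap_mem' c := ⟨C c, 0, by simp⟩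

lemma left_mem_quadSubalgebra {x y : B} {P : ℂ[X]} {h : y ^ 2 = aeval x P} :
    x ∈ quadSubalgebra x y P h := ⟨X, 0, by simp⟩

lemma adjoin_pair_eq_quadSubalgebra {x y : B} {P : ℂ[X]} (h : y ^ 2 = aeval x P) :
    Algebra.adjoin ℂ {x, y} = quadSubalgebra x y P h := by
  apply le_antisymm
  · rw [Algebra.adjoin_le_iff]
    rintro _ (rfl | rfl)
    · exact left_mem_quadSubalgebra
    · exact ⟨0, 1, by simp⟩
  · rintro _ ⟨a, b, rfl⟩
    have hx : x ∈ Algebra.adjoin ℂ {x, y} := Algebra.subset_adjoin (by simp)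
    have hy : y ∈ Algebra.adjoin ℂ {x, y} := Algebra.subset_adjoin (by simp)
    have hp : ∀ a : ℂ[X], aeval x a ∈ Algebra.adjoin ℂ {x, y} := fun a =>
      Algebra.adjoin_mono (by simp) (aeval_mem_adjoin_singleton ℂ x)
    exact add_mem (hp a) (mul_mem (hp b) hy)

lemma algHom_mem_of_X_mem {σ : Type*} (ψ : MvPolynomial σ ℂ →ₐ[ℂ] B) (S : Subalgebra ℂ B)
    (h : ∀ i, ψ (MvPolynomial.X i) ∈ S) (F : MvPolynomial σ ℂ) : ψ F ∈ S := by
  induction F using MvPolynomial.induction_on with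
  | C c =>
    rw [← MvPolynomial.algebraMap_eq, AlgHom.commutes]
    exact S.algebraMap_mem c
  | add F G hF hG => rw [map_add]; exact S.add_mem hF hG
  | mul_X F i hF => rw [map_mul]; exact S.mul_mem hF (h i)

lemma algHom_aeval_X {σ : Type*} {B : Type*} [CommRing B] [Algebra ℂ B]
    (ψ : MvPolynomial σ ℂ →ₐ[ℂ] B) (i : σ) (a : ℂ[X]) :
    ψ (aeval (MvPolynomial.X i) a) = aeval (ψ (MvPolynomial.X i)) a := by
  rw [aeval_algHom_apply]

end QuadSubalgebra

/-! ### The coordinate ring of the curve and its embedding in Laurent series. -/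

section Algebra

open Polynomial

variable {n : ℕ} {H : ℤ → ℤ → ℂ}

lemma CurveRing.p_sq (n : ℕ) (H : ℤ → ℤ → ℂ) :
    CurveRing.p n H ^ 2 = aeval (CurveRing.lam n H) (branchPoly n H) := by
  have h : Ideal.Quotient.mkₐ ℂ (Ideal.span {curvePoly n H}) (curvePoly n H) = 0 :=
    Ideal.Quotient.eq_zero_iff_mem.2 (Ideal.subset_span rfl)
  rw [curvePoly, map_sub, map_pow, algHom_aeval_X, sub_eq_zero] at h
  exact h

lemma CurveRing.exists_eq (f : CurveRing n H) : ∃ a b : ℂ[X],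
    f = aeval (CurveRing.lam n H) a + aeval (CurveRing.lam n H) b * CurveRing.p n H := by
  obtain ⟨F, rfl⟩ := Ideal.Quotient.mk_surjective f
  refine algHom_mem_of_X_mem (Ideal.Quotient.mkₐ ℂ (Ideal.span {curvePoly n H}))
    (quadSubalgebra _ _ _ (CurveRing.p_sq n H)) (fun i => ?_) F
  fin_cases i
  · exact left_mem_quadSubalgebra
  · exact ⟨0, 1, by rw [map_zero, map_one, zero_add, one_mul]; rfl⟩

/-- The evaluation `λ ↦ z ^ 2`, `p_{2n+1} ↦ p_{2n+1}(z)`. -/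
noncomputable def CurveRing.toLaurent (hH : Admissible n H) :
    CurveRing n H →ₐ[ℂ] LaurentSeries ℂ :=
  Ideal.Quotient.liftₐ _ (MvPolynomial.aeval ![zPow 2, canonicalSeries n H (2 * n + 1)]) (by
    intro F hF
    rw [← RingHom.mem_ker]
    refine (Ideal.span_le.2 ?_) hF
    rintro _ rfl
    rw [SetLike.mem_coe, RingHom.mem_ker, curvePoly, map_sub, map_pow, algHom_aeval_X,
      MvPolynomial.aeval_X, MvPolynomial.aeval_X]
    exact sub_eq_zero.2 (canonicalSeries_sq hH))

lemma CurveRing.toLaurent_lam (hH : Admissible n H) :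
    CurveRing.toLaurent hH (CurveRing.lam n H) = zPow 2 := by
  change MvPolynomial.aeval ![zPow 2, canonicalSeries n H (2 * n + 1)] (MvPolynomial.X 0) = _
  rw [MvPolynomial.aeval_X]; rfl

lemma CurveRing.toLaurent_p (hH : Admissible n H) :
    CurveRing.toLaurent hH (CurveRing.p n H) = canonicalSeries n H (2 * n + 1) := by
  change MvPolynomial.aeval ![zPow 2, canonicalSeries n H (2 * n + 1)] (MvPolynomial.X 1) = _
  rw [MvPolynomial.aeval_X]; rfl

lemma CurveRing.toLaurent_apply (hH : Admissible n H) (a b : ℂ[X]) :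
    CurveRing.toLaurent hH
      (aeval (CurveRing.lam n H) a + aeval (CurveRing.lam n H) b * CurveRing.p n H) =
      aeval (zPow 2) a + aeval (zPow 2) b * canonicalSeries n H (2 * n + 1) := by
  rw [map_add, map_mul, ← aeval_algHom_apply, ← aeval_algHom_apply, CurveRing.toLaurent_lam,
    CurveRing.toLaurent_p]

lemma eq_zero_of_aeval_add_aeval_mul_canonicalSeries (hH : Admissible n H) {a b : ℂ[X]}
    (h : aeval (zPow 2) a + aeval (zPow 2) b * canonicalSeries n H (2 * n + 1) = 0) :
    a = 0 ∧ b = 0 :=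
  eq_zero_of_aeval_add_aeval_mul (zNeg_canonicalSeries_odd hH.1 (by omega))
    (isReducedSeries_canonicalSeries n H _).ne_zero h

/-- In the normal form `a(λ) + b(λ) p` the two images have opposite parity, so neither can cancel
the other. -/
lemma CurveRing.toLaurent_injective (hH : Admissible n H) :
    Function.Injective (CurveRing.toLaurent hH) := by
  rw [injective_iff_map_eq_zero]
  intro f hf
  obtain ⟨a, b, rfl⟩ := CurveRing.exists_eq f
  rw [CurveRing.toLaurent_apply] at hf
  obtain ⟨rfl, rfl⟩ := eq_zero_of_aeval_add_aeval_mul_canonicalSeries hH hf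
  simp

lemma CurveRing.eq_zero_of_add_mul (hH : Admissible n H) {a b : ℂ[X]}
    (h : aeval (CurveRing.lam n H) a + aeval (CurveRing.lam n H) b * CurveRing.p n H = 0) :
    a = 0 ∧ b = 0 := by
  have := CurveRing.toLaurent_apply hH a b
  rw [h, map_zero] at this
  exact eq_zero_of_aeval_add_aeval_mul_canonicalSeries hH this.symm

lemma toSubmodule_range_toLaurent (hH : Admissible n H) :
    Subalgebra.toSubmodule (CurveRing.toLaurent hH).range = spanSeries n H := by
  rw [spanSeries_eq_quadSpan hH]
  ext f
  constructor
  · rintro ⟨g, rfl⟩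
    obtain ⟨a, b, rfl⟩ := CurveRing.exists_eq g
    refine ⟨a, b, ?_⟩
    rw [mul_one]
    exact CurveRing.toLaurent_apply hH a b
  · rintro ⟨a, b, rfl⟩
    refine ⟨_, (CurveRing.toLaurent_apply hH a b).trans ?_⟩
    rw [mul_one]

/-- The ring embeds in the field of Laurent series. -/
lemma CurveRing.isDomain (hH : Admissible n H) : IsDomain (CurveRing n H) :=
  (CurveRing.toLaurent_injective hH).isDomain (CurveRing.toLaurent hH).toRingHom

lemma not_finiteDimensional_spanSeries (n : ℕ) (H : ℤ → ℤ → ℂ) :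
    ¬ FiniteDimensional ℂ (spanSeries n H) := by
  intro hfin
  have hli : LinearIndependent ℂ (fun j : nonnegOrders n =>
      (⟨canonicalSeries n H j, canonicalSeries_mem n H j.2⟩ : spanSeries n H)) :=
    LinearIndependent.of_comp (spanSeries n H).subtype (linearIndependent_canonicalSeries n H)
  have hfin' : Finite (nonnegOrders n) := hli.finite
  refine not_injective_infinite_finite
    (fun m : ℕ => (⟨2 * (m : ℤ), two_mul_mem_nonnegOrders n m⟩ : nonnegOrders n)) ?_
  intro a b h
  have := congrArg Subtype.val h
  simp only at this
  omega

lemma exists_subalgebra (hH : Admissible n H) :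
    ∃ A : Subalgebra ℂ (LaurentSeries ℂ),
      Subalgebra.toSubmodule A = spanSeries n H ∧ ¬ FiniteDimensional ℂ A ∧
      ∃ φ : CurveRing n H ≃ₐ[ℂ] A,
        (φ (CurveRing.lam n H) : LaurentSeries ℂ) = zPow 2 ∧
        (φ (CurveRing.p n H) : LaurentSeries ℂ) = canonicalSeries n H (2 * n + 1) := by
  refine ⟨(CurveRing.toLaurent hH).range, toSubmodule_range_toLaurent hH, ?_,
    AlgEquiv.ofInjective _ (CurveRing.toLaurent_injective hH), CurveRing.toLaurent_lam hH,
    CurveRing.toLaurent_p hH⟩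
  intro h
  apply not_finiteDimensional_spanSeries n H
  rw [← toSubmodule_range_toLaurent hH]
  exact h

end Algebra

/-! ### The three ideals attached to `Γ_{2n}`. -/

section Variety

open Polynomial

variable {n : ℕ} {H : ℤ → ℤ → ℂ}

lemma coordFun_even (n m : ℕ) :
    coordFun n ⟨2 * (m : ℤ), two_mul_mem_nonnegOrders n m⟩ = MvPolynomial.X Coord.lam ^ m := by
  rw [coordFun, dif_pos (even_two_mul _)]
  congr 1
  simp only
  omega

lemma coordFun_odd {n m : ℕ} (h : n ≤ m) :
    coordFun n ⟨2 * (m : ℤ) + 1, odd_mem_nonnegOrders h⟩ = MvPolynomial.X (Coord.odd ⟨m, h⟩) := by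
  rw [coordFun, dif_neg (by simp only; rw [Int.even_iff]; omega)]
  congr 3
  simp only
  omega

lemma aeval_coordFun (hH : Admissible n H) (j : nonnegOrders n) :
    MvPolynomial.aeval (coordSeries n H) (coordFun n j) = canonicalSeries n H j := by
  obtain ⟨j, hj⟩ := j
  rcases nonnegOrders_cases hj with ⟨m, rfl⟩ | ⟨m, hm, rfl⟩
  · rw [coordFun_even, map_pow, MvPolynomial.aeval_X, canonicalSeries_even hH.1, coordSeries,
      zPow_pow]
  · rw [coordFun_odd hm, MvPolynomial.aeval_X, coordSeries]

lemma aeval_linearCombination_coordFun (hH : Admissible n H) (c : nonnegOrders n →₀ ℂ) :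
    MvPolynomial.aeval (coordSeries n H) (Finsupp.linearCombination ℂ (coordFun n) c) =
      Finsupp.linearCombination ℂ (fun j : nonnegOrders n => canonicalSeries n H j) c := by
  rw [Finsupp.linearCombination_apply, Finsupp.linearCombination_apply, Finsupp.sum, Finsupp.sum,
    map_sum]
  refine Finset.sum_congr rfl fun l _ => ?_
  rw [map_smul, aeval_coordFun hH]

/-- Modulo the quadrics every polynomial is a linear combination of the coordinate functions of
the `p_j`. -/
lemma exists_linearCombination_coordFun (hH : Admissible n H) (F : MvPolynomial (Coord n) ℂ) :
    ∃ c : nonnegOrders n →₀ ℂ,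
      F - Finsupp.linearCombination ℂ (coordFun n) c ∈ Ideal.span (relationSet n H) := by
  set J := Ideal.span (relationSet n H)
  set π := Ideal.Quotient.mkₐ ℂ J
  set S : Submodule ℂ (MvPolynomial (Coord n) ℂ ⧸ J) :=
    Submodule.span ℂ (Set.range fun j => π (coordFun n j)) with hS
  have hmem : ∀ j, π (coordFun n j) ∈ S := fun j => Submodule.subset_span ⟨j, rfl⟩
  have hone : (1 : MvPolynomial (Coord n) ℂ ⧸ J) ∈ S := by
    have := hmem ⟨_, two_mul_mem_nonnegOrders n 0⟩
    rwa [coordFun_even, pow_zero, map_one] at this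
  -- Since `U_H` is closed under products, structure constants exist and the quadrics rewrite `p_j
  -- p_k` linearly. So `S` is a subalgebra, and it contains the generators.
  have hmul : S * S ≤ S := by
    rw [hS, Submodule.span_mul_span, Submodule.span_le]
    rintro _ ⟨_, ⟨j, rfl⟩, _, ⟨k, rfl⟩, rfl⟩
    obtain ⟨c, hc⟩ := (mem_spanSeries_iff n H).1 (mul_self_le_iff.1 (spanSeries_mul_le hH)
      _ (canonicalSeries_mem n H j.2) _ (canonicalSeries_mem n H k.2))
    have hrel : π (coordFun n j * coordFun n k - c.sum (fun l a => a • coordFun n l)) = 0 :=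
      Ideal.Quotient.eq_zero_iff_mem.2 (Ideal.subset_span ⟨j, k, c, hc.symm, rfl⟩)
    rw [map_sub, map_mul, sub_eq_zero] at hrel
    simp only [SetLike.mem_coe]
    rw [hrel, Finsupp.sum, map_sum]
    refine Submodule.sum_mem _ fun l _ => ?_
    rw [map_smul]
    exact Submodule.smul_mem _ _ (hmem l)
  have hF : π F ∈ S := by
    refine algHom_mem_of_X_mem π (S.toSubalgebra hone fun a b ha hb =>
      hmul (Submodule.mul_mem_mul ha hb)) (fun i => ?_) F
    rcases i with _ | ⟨m, hm⟩
    · have := hmem ⟨_, two_mul_mem_nonnegOrders n 1⟩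
      rwa [coordFun_even, pow_one] at this
    · have := hmem ⟨_, odd_mem_nonnegOrders hm⟩
      rwa [coordFun_odd] at this
  rw [hS, ← Finsupp.range_linearCombination] at hF
  obtain ⟨c, hc⟩ := hF
  refine ⟨c, Ideal.Quotient.eq_zero_iff_mem.1 ?_⟩
  change π (F - _) = 0
  rw [map_sub, ← hc, sub_eq_zero, Finsupp.linearCombination_apply, Finsupp.linearCombination_apply,
    Finsupp.sum, Finsupp.sum, map_sum]
  refine Finset.sum_congr rfl fun l _ => ?_
  rw [map_smul]

/-- A relation between the series reduces, modulo the quadrics, to a linear one, which is trivial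
because the `p_j` are independent. -/
lemma span_relationSet_eq_ker (hH : Admissible n H) :
    Ideal.span (relationSet n H) =
      RingHom.ker (MvPolynomial.aeval (R := ℂ) (coordSeries n H)) := by
  have hle : Ideal.span (relationSet n H) ≤
      RingHom.ker (MvPolynomial.aeval (R := ℂ) (coordSeries n H)) := by
    rw [Ideal.span_le]
    rintro _ ⟨j, k, c, hc, rfl⟩
    rw [SetLike.mem_coe, RingHom.mem_ker, map_sub, map_mul, aeval_coordFun hH, aeval_coordFun hH,
      hc, sub_eq_zero]
    exact (aeval_linearCombination_coordFun hH c).symm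
  apply le_antisymm hle
  intro F hF
  obtain ⟨c, hc⟩ := exists_linearCombination_coordFun hH F
  have h0 := hle hc
  rw [RingHom.mem_ker] at hF h0
  rw [map_sub, hF, aeval_linearCombination_coordFun hH, zero_sub, neg_eq_zero] at h0
  have := linearIndependent_iff.1 (linearIndependent_canonicalSeries n H) c h0
  rwa [this, map_zero, sub_zero] at hc

variable (n H) in
/-- The polynomials `α_m` with `p_{2m+1} = α_m(z ^ 2) p_{2n+1}`. -/
noncomputable def alphaFamily (m : ℕ) : ℂ[X] := alphaPoly n H (m - n)

lemma canonicalSeries_odd_eq_alphaFamily (hH : Admissible n H) {m : ℕ} (hm : n ≤ m) :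
    canonicalSeries n H (2 * m + 1) =
      aeval (zPow 2) (alphaFamily n H m) * canonicalSeries n H (2 * n + 1) := by
  rw [alphaFamily, ← canonicalSeries_odd_eq hH]
  congr 1
  push_cast [hm]
  ring

/-- Modulo the ideal of the curve every polynomial is of the form `a(λ) + b(λ) p_{2n+1}`. -/
lemma exists_sub_mem_curveIdeal (n : ℕ) (H : ℤ → ℤ → ℂ) (F : MvPolynomial (Coord n) ℂ) :
    ∃ a b : ℂ[X], F - (aeval (MvPolynomial.X Coord.lam) a + aeval (MvPolynomial.X Coord.lam) b *
      MvPolynomial.X (Coord.odd ⟨n, le_rfl⟩)) ∈ curveIdeal n H (alphaFamily n H) := by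
  set J := curveIdeal n H (alphaFamily n H) with hJ
  set π := Ideal.Quotient.mkₐ ℂ J
  have hsq : π (MvPolynomial.X (Coord.odd ⟨n, le_rfl⟩)) ^ 2 =
      aeval (π (MvPolynomial.X Coord.lam)) (branchPoly n H) := by
    have h : π (MvPolynomial.X (Coord.odd ⟨n, le_rfl⟩) ^ 2 -
        aeval (MvPolynomial.X Coord.lam) (branchPoly n H)) = 0 :=
      Ideal.Quotient.eq_zero_iff_mem.2 (Ideal.subset_span (Or.inl rfl))
    rwa [map_sub, map_pow, algHom_aeval_X, sub_eq_zero] at h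
  obtain ⟨a, b, hab⟩ := algHom_mem_of_X_mem π (quadSubalgebra _ _ _ hsq) (fun i => by
    rcases i with _ | m
    · exact left_mem_quadSubalgebra
    · refine ⟨0, alphaFamily n H m, ?_⟩
      rw [map_zero, zero_add]
      by_cases hm : n < m
      · have h : π (MvPolynomial.X (Coord.odd m) -
            aeval (MvPolynomial.X Coord.lam) (alphaFamily n H m) *
              MvPolynomial.X (Coord.odd ⟨n, le_rfl⟩)) = 0 :=
          Ideal.Quotient.eq_zero_iff_mem.2 (Ideal.subset_span (Or.inr ⟨m, hm, rfl⟩))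
        rwa [map_sub, map_mul, algHom_aeval_X, sub_eq_zero] at h
      · obtain ⟨m, hnm⟩ := m
        obtain rfl : m = n := by simp only at hm; omega
        simp [alphaFamily, alphaPoly]) F
  refine ⟨a, b, Ideal.Quotient.eq_zero_iff_mem.1 ?_⟩
  change π _ = 0
  rw [map_sub, map_add, map_mul, algHom_aeval_X, algHom_aeval_X, hab, sub_self]

/-- The same argument with the normal form `a(λ) + b(λ) p_{2n+1}` and the independence of `1` and
`p_{2n+1}` over `ℂ[z ^ 2]`. -/
lemma ker_eq_curveIdeal (hH : Admissible n H) :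
    RingHom.ker (MvPolynomial.aeval (R := ℂ) (coordSeries n H)) =
      curveIdeal n H (alphaFamily n H) := by
  have hle : curveIdeal n H (alphaFamily n H) ≤
      RingHom.ker (MvPolynomial.aeval (R := ℂ) (coordSeries n H)) := by
    rw [curveIdeal, Ideal.span_le]
    rintro _ (rfl | ⟨⟨m, hm⟩, -, rfl⟩)
    · rw [SetLike.mem_coe, RingHom.mem_ker, map_sub, map_pow, algHom_aeval_X,
        MvPolynomial.aeval_X, MvPolynomial.aeval_X, sub_eq_zero]
      exact canonicalSeries_sq hH
    · rw [SetLike.mem_coe, RingHom.mem_ker, map_sub, map_mul, algHom_aeval_X,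
        MvPolynomial.aeval_X, MvPolynomial.aeval_X, MvPolynomial.aeval_X, sub_eq_zero]
      exact canonicalSeries_odd_eq_alphaFamily hH hm
  refine le_antisymm (fun F hF => ?_) hle
  obtain ⟨a, b, hab⟩ := exists_sub_mem_curveIdeal n H F
  have h0 := hle hab
  rw [RingHom.mem_ker] at hF h0
  rw [map_sub, hF, zero_sub, neg_eq_zero, map_add, map_mul, algHom_aeval_X, algHom_aeval_X,
    MvPolynomial.aeval_X, MvPolynomial.aeval_X] at h0
  obtain ⟨rfl, rfl⟩ := eq_zero_of_aeval_add_aeval_mul_canonicalSeries hH h0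
  simpa using hab

/-- A direct computation replaces the Nullstellensatz. A normal form `a + b y` vanishing on `Γ_{2n}`
vanishes at both points `(l, ±y)` over `l`; if `P(l) ≠ 0`, then `a(l) = b(l) = 0`. Hence `aP` and
`bP` vanish everywhere. -/
lemma vanishingIdeal_gammaVariety (hH : Admissible n H) :
    MvPolynomial.vanishingIdeal ℂ (gammaVariety n H) = curveIdeal n H (alphaFamily n H) := by
  have hspan := (span_relationSet_eq_ker hH).trans (ker_eq_curveIdeal hH)
  have hle : curveIdeal n H (alphaFamily n H) ≤
      MvPolynomial.vanishingIdeal ℂ (gammaVariety n H) := by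
    rw [← hspan, Ideal.span_le]
    intro F hF
    rw [SetLike.mem_coe, MvPolynomial.mem_vanishingIdeal_iff]
    intro x hx
    exact hx F hF
  refine le_antisymm (fun F hF => ?_) hle
  obtain ⟨a, b, hab⟩ := exists_sub_mem_curveIdeal n H F
  have h0 := (MvPolynomial.vanishingIdeal ℂ (gammaVariety n H)).sub_mem hF (hle hab)
  rw [sub_sub_cancel, MvPolynomial.mem_vanishingIdeal_iff] at h0
  have hpt : ∀ l y : ℂ, y ^ 2 = (branchPoly n H).eval l → a.eval l + b.eval l * y = 0 := by
    intro l y hy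
    -- Each point `(l, y)` of the plane curve lifts to `Γ_{2n}` through `p_{2m+1} = α_m(l) y`; here
    -- `α_n = 1`.
    set x : Coord n → ℂ := fun i => match i with
      | Coord.lam => l
      | Coord.odd m => (alphaFamily n H m).eval l * y with hx
    have hxn : x (Coord.odd ⟨n, le_rfl⟩) = y := by simp [hx, alphaFamily, alphaPoly]
    have hxl : x Coord.lam = l := rfl
    have hxG : x ∈ gammaVariety n H := by
      have hker : curveIdeal n H (alphaFamily n H) ≤ RingHom.ker (MvPolynomial.aeval (R := ℂ) x) := by
        rw [curveIdeal, Ideal.span_le]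
        rintro _ (rfl | ⟨⟨m, hm⟩, -, rfl⟩)
        · rw [SetLike.mem_coe, RingHom.mem_ker, map_sub, map_pow, algHom_aeval_X,
            MvPolynomial.aeval_X, MvPolynomial.aeval_X, hxn, hxl, hy, coe_aeval_eq_eval, sub_self]
        · rw [SetLike.mem_coe, RingHom.mem_ker, map_sub, map_mul, algHom_aeval_X,
            MvPolynomial.aeval_X, MvPolynomial.aeval_X, MvPolynomial.aeval_X, hxn, hxl,
            coe_aeval_eq_eval, sub_self]
      intro G hG
      rw [← MvPolynomial.coe_aeval_eq_eval]
      exact hker (hspan ▸ Ideal.subset_span hG)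
    have := h0 x hxG
    rwa [map_add, map_mul, algHom_aeval_X, algHom_aeval_X, MvPolynomial.aeval_X,
      MvPolynomial.aeval_X, hxn, hxl, coe_aeval_eq_eval] at this
  have hab0 : ∀ l : ℂ, (branchPoly n H).eval l ≠ 0 → a.eval l = 0 ∧ b.eval l = 0 := by
    intro l hl
    obtain ⟨y, hy⟩ := IsAlgClosed.exists_pow_nat_eq ((branchPoly n H).eval l) (n := 2) two_pos
    have h1 := hpt l y hy
    have h2 := hpt l (-y) (by rw [neg_sq, hy])
    have hy0 : y ≠ 0 := by rintro rfl; apply hl; rw [← hy]; ring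
    have ha : a.eval l = 0 := by linear_combination (h1 + h2) / 2
    rw [ha, zero_add] at h1
    exact ⟨ha, (mul_eq_zero.1 h1).resolve_right hy0⟩
  have hzero : ∀ c : ℂ[X], (∀ l : ℂ, (branchPoly n H).eval l ≠ 0 → c.eval l = 0) → c = 0 := by
    intro c hc
    have : c * branchPoly n H = 0 := by
      apply Polynomial.funext
      intro l
      rw [eval_mul, eval_zero, mul_eq_zero]
      by_cases h : (branchPoly n H).eval l = 0
      · exact Or.inr h
      · exact Or.inl (hc l h)
    exact (mul_eq_zero.1 this).resolve_right (branchPoly_ne_zero n H)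
  obtain rfl := hzero a fun l hl => (hab0 l hl).1
  obtain rfl := hzero b fun l hl => (hab0 l hl).2
  simpa using hab

lemma exists_alpha (hH : Admissible n H) :
    ∃ α : ℕ → Polynomial ℂ,
      (∀ m : ℕ, n < m → (α m).Monic ∧ (α m).natDegree = m - n ∧
        canonicalSeries n H (2 * m + 1) =
          Polynomial.aeval (zPow 2) (α m) * canonicalSeries n H (2 * n + 1)) ∧
      Ideal.span (relationSet n H) = curveIdeal n H α ∧
      MvPolynomial.vanishingIdeal ℂ (gammaVariety n H) = curveIdeal n H α ∧
      RingHom.ker (MvPolynomial.aeval (R := ℂ) (coordSeries n H)) = curveIdeal n H α :=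
  ⟨alphaFamily n H, fun _ hm => ⟨(alphaPoly_monic_natDegree n H _).1,
    (alphaPoly_monic_natDegree n H _).2, canonicalSeries_odd_eq_alphaFamily hH hm.le⟩,
    (span_relationSet_eq_ker hH).trans (ker_eq_curveIdeal hH), vanishingIdeal_gammaVariety hH,
    ker_eq_curveIdeal hH⟩

end Variety

/-! ### The Jacobian criterion for the affine curve. -/

section Nonsingular

open Polynomial

/-- A complex polynomial is squarefree if and only if it has no multiple root. -/
lemma squarefree_iff_eval_derivative (P : ℂ[X]) :
    Squarefree P ↔ ∀ l, P.eval l = 0 → (derivative P).eval l ≠ 0 := by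
  rw [← PerfectField.separable_iff_squarefree, Polynomial.Separable]
  constructor
  · rintro ⟨a, b, hab⟩ l hl hl'
    have := congrArg (eval l) hab
    simp [hl, hl'] at this
  · intro h
    by_contra hc
    have hg : ¬ IsUnit (EuclideanDomain.gcd P (derivative P)) := by
      rwa [EuclideanDomain.gcd_isUnit_iff]
    have hdeg : (EuclideanDomain.gcd P (derivative P)).degree ≠ 0 := by
      intro h0
      exact hg (isUnit_iff_degree_eq_zero.2 h0)
    obtain ⟨l, hl⟩ := IsAlgClosed.exists_root _ hdeg
    exact h l (hl.dvd (EuclideanDomain.gcd_dvd_left _ _)) (hl.dvd (EuclideanDomain.gcd_dvd_right _ _))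

/-- The partial derivatives are `-P'(λ)` and `2 p`, so the singular points are the `(l, 0)` with `l`
a multiple root of `P`. -/
lemma isNonsingularCurve_iff (n : ℕ) (H : ℤ → ℤ → ℂ) :
    IsNonsingularCurve (curvePoly n H) ↔ Squarefree (branchPoly n H) := by
  have hpd : ∀ P : ℂ[X], MvPolynomial.pderiv (0 : Fin 2)
      (aeval (MvPolynomial.X 0) P : MvPolynomial (Fin 2) ℂ) =
      aeval (MvPolynomial.X 0) (derivative P) := by
    intro P
    rw [Derivation.map_aeval, MvPolynomial.pderiv_X_self, smul_eq_mul, mul_one]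
  have hpd1 : ∀ P : ℂ[X], MvPolynomial.pderiv (1 : Fin 2)
      (aeval (MvPolynomial.X 0) P : MvPolynomial (Fin 2) ℂ) = 0 := by
    intro P
    rw [Derivation.map_aeval, MvPolynomial.pderiv_X_of_ne (by decide), smul_zero]
  have hev : ∀ (x : Fin 2 → ℂ) (P : ℂ[X]),
      MvPolynomial.eval x (aeval (MvPolynomial.X 0) P) = P.eval (x 0) := by
    intro x P
    rw [← MvPolynomial.coe_aeval_eq_eval, RingHom.coe_coe, algHom_aeval_X, MvPolynomial.aeval_X,
      coe_aeval_eq_eval]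
  have h0 : ∀ x : Fin 2 → ℂ, MvPolynomial.eval x (MvPolynomial.pderiv 0 (curvePoly n H)) =
      -(derivative (branchPoly n H)).eval (x 0) := by
    intro x
    rw [curvePoly, map_sub, hpd, map_sub, hev, Derivation.leibniz_pow,
      MvPolynomial.pderiv_X_of_ne (by decide)]
    simp
  have h1 : ∀ x : Fin 2 → ℂ, MvPolynomial.eval x (MvPolynomial.pderiv 1 (curvePoly n H)) =
      2 * x 1 := by
    intro x
    rw [curvePoly, map_sub, hpd1, Derivation.leibniz_pow, MvPolynomial.pderiv_X_self]
    simp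
  have hc : ∀ x : Fin 2 → ℂ, MvPolynomial.eval x (curvePoly n H) =
      x 1 ^ 2 - (branchPoly n H).eval (x 0) := by
    intro x
    rw [curvePoly, map_sub, hev, map_pow, MvPolynomial.eval_X]
  rw [squarefree_iff_eval_derivative]
  constructor
  · intro h l hl hl'
    obtain ⟨i, hi⟩ := h ![l, 0] (by rw [hc]; simp [hl])
    fin_cases i
    · exact hi (by simpa using (h0 ![l, 0]).trans (by simp [hl']))
    · exact hi (by simpa using (h1 ![l, 0]).trans (by simp))
  · intro h x hx
    by_cases hx1 : x 1 = 0
    · refine ⟨0, ?_⟩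
      rw [h0, neg_ne_zero]
      apply h
      rw [hc, hx1] at hx
      linear_combination -hx
    · exact ⟨1, by rw [h1]; exact mul_ne_zero two_ne_zero hx1⟩

end Nonsingular

/-! ### Quadratic extensions of `ℂ(x)` and their change of coordinates. -/

section QuadraticPair

open Polynomial

variable {K : Type*} [Field K] [Algebra ℂ K]

/-- `K = ℂ(x) ⊕ ℂ(x) w` with `x` transcendental over `ℂ` and `w ^ 2 = Q(x)`. -/
structure IsQuadraticPair (x w : K) (Q : ℂ[X]) : Prop where
  sq : w ^ 2 = aeval x Q
  indep : ∀ a b : ℂ[X], aeval x a + aeval x b * w = 0 → a = 0 ∧ b = 0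
  span : ∀ f : K, ∃ a b c : ℂ[X], c ≠ 0 ∧ f * aeval x c = aeval x a + aeval x b * w

lemma aeval_mul_mem {x : K} {S : Submodule ℂ K} {c : K} (h : ∀ i : ℕ, x ^ i * c ∈ S) (a : ℂ[X]) :
    aeval x a * c ∈ S := by
  induction a using Polynomial.induction_on' with
  | add a b ha hb => rw [map_add, add_mul]; exact S.add_mem ha hb
  | monomial m r =>
    rw [aeval_monomial, mul_assoc, ← Algebra.smul_def]
    exact S.smul_mem _ (h m)

lemma aeval_inv {x : K} (hx : x ≠ 0) {a : ℂ[X]} {N : ℕ} (ha : a.natDegree ≤ N) :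
    aeval x⁻¹ a = aeval x (reflect N a) * x⁻¹ ^ N := by
  let _ : Invertible x⁻¹ := invertibleOfNonzero (inv_ne_zero hx)
  have := eval₂_reflect_mul_pow (algebraMap ℂ K) x⁻¹ N a ha
  rw [invOf_eq_inv, inv_inv] at this
  exact this.symm

namespace IsQuadraticPair

variable {x w : K} {Q : ℂ[X]} (h : IsQuadraticPair x w Q)

include h

lemma aeval_eq_zero {a : ℂ[X]} (ha : aeval x a = 0) : a = 0 :=
  (h.indep a 0 (by simpa using ha)).1

lemma aeval_ne_zero {a : ℂ[X]} (ha : a ≠ 0) : aeval x a ≠ 0 := fun h0 => ha (h.aeval_eq_zero h0)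

lemma transcendental : Transcendental ℂ x := by
  rw [transcendental_iff]
  exact fun a ha => h.aeval_eq_zero ha

lemma x_ne_zero : x ≠ 0 := by
  intro h0
  exact X_ne_zero (h.aeval_eq_zero (a := X) (by rw [aeval_X, h0]))

lemma w_ne_zero : w ≠ 0 := by
  intro h0
  exact one_ne_zero (h.indep 0 1 (by simp [h0])).2

lemma Q_ne_zero : Q ≠ 0 := by
  intro h0
  have := h.sq
  rw [h0, map_zero] at this
  exact h.w_ne_zero (pow_eq_zero_iff two_ne_zero |>.1 this)

lemma exists_of_mem_adjoin {f : K} (hf : f ∈ IntermediateField.adjoin ℂ {x}) :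
    ∃ a c : ℂ[X], c ≠ 0 ∧ f * aeval x c = aeval x a := by
  obtain ⟨r, s, rfl⟩ := (IntermediateField.mem_adjoin_simple_iff ℂ f).1 hf
  by_cases hs : s = 0
  · exact ⟨0, 1, one_ne_zero, by simp [hs]⟩
  · exact ⟨r, s, hs, div_mul_cancel₀ _ (h.aeval_ne_zero hs)⟩

omit h in
lemma aeval_mem_adjoin (x : K) (a : ℂ[X]) : aeval x a ∈ IntermediateField.adjoin ℂ {x} :=
  IntermediateField.algebra_adjoin_le_adjoin ℂ {x} (aeval_mem_adjoin_singleton ℂ x)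

lemma linearIndependent_pair :
    LinearIndependent (IntermediateField.adjoin ℂ {x}) ![(1 : K), w] := by
  rw [LinearIndependent.pair_iff]
  rintro ⟨s, hs⟩ ⟨t, ht⟩ hst
  obtain ⟨a, c, hc, hs'⟩ := h.exists_of_mem_adjoin hs
  obtain ⟨b, d, hd, ht'⟩ := h.exists_of_mem_adjoin ht
  have hst : s + t * w = 0 := by
    have : s * 1 + t * w = 0 := hst
    rwa [mul_one] at this
  have h0 := h.indep (a * d) (b * c) (by
    rw [map_mul, map_mul, ← hs', ← ht']
    linear_combination aeval x c * aeval x d * hst)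
  have ha : a = 0 := (mul_eq_zero.1 h0.1).resolve_right hd
  have hb : b = 0 := (mul_eq_zero.1 h0.2).resolve_right hc
  rw [ha, map_zero] at hs'
  rw [hb, map_zero] at ht'
  exact ⟨Subtype.ext ((mul_eq_zero.1 hs').resolve_right (h.aeval_ne_zero hc)),
    Subtype.ext ((mul_eq_zero.1 ht').resolve_right (h.aeval_ne_zero hd))⟩

lemma finrank_eq_two : Module.finrank (IntermediateField.adjoin ℂ {x}) K = 2 := by
  have hsp : ⊤ ≤ Submodule.span (IntermediateField.adjoin ℂ {x}) (Set.range ![(1 : K), w]) := by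
    intro f _
    obtain ⟨a, b, c, hc, hf⟩ := h.span f
    have hc' := h.aeval_ne_zero hc
    have e : f = (⟨aeval x a / aeval x c, div_mem (aeval_mem_adjoin x a) (aeval_mem_adjoin x c)⟩ :
          IntermediateField.adjoin ℂ {x}) • (1 : K) +
        (⟨aeval x b / aeval x c, div_mem (aeval_mem_adjoin x b) (aeval_mem_adjoin x c)⟩ :
          IntermediateField.adjoin ℂ {x}) • w := by
      change f = aeval x a / aeval x c * 1 + aeval x b / aeval x c * w
      field_simp
      exact hf
    rw [e]
    exact Submodule.add_mem _ (Submodule.smul_mem _ _ (Submodule.subset_span ⟨0, rfl⟩))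
      (Submodule.smul_mem _ _ (Submodule.subset_span ⟨1, rfl⟩))
  rw [Module.finrank_eq_card_basis (Module.Basis.mk h.linearIndependent_pair hsp), Fintype.card_fin]

/-- Removing a square factor from the branch polynomial. -/
lemma div_of_eq_sq_mul {R Q' : ℂ[X]} (hQ : Q = R ^ 2 * Q') :
    IsQuadraticPair x (w / aeval x R) Q' := by
  have hR : R ≠ 0 := by
    rintro rfl
    exact h.Q_ne_zero (by rw [hQ]; ring)
  have hR' := h.aeval_ne_zero hR
  refine ⟨?_, ?_, ?_⟩
  · rw [div_pow, h.sq, hQ, map_mul, map_pow]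
    field_simp
  · intro a b hab
    have h0 := h.indep (a * R) b (by
      rw [map_mul]
      field_simp at hab
      linear_combination hab)
    exact ⟨(mul_eq_zero.1 h0.1).resolve_right hR, h0.2⟩
  · intro f
    obtain ⟨a, b, c, hc, hf⟩ := h.span f
    refine ⟨a, b * R, c, hc, ?_⟩
    rw [hf, map_mul]
    field_simp

/-- The coordinates at infinity. -/
lemma inv {m : ℕ} (hQ : Q.natDegree = 2 * m + 1) :
    IsQuadraticPair x⁻¹ (w * x⁻¹ ^ (m + 1)) (X * Q.reverse) := by
  have hx := h.x_ne_zero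
  refine ⟨?_, ?_, ?_⟩
  -- `w² x^{-(2m+2)} = x⁻¹ · x^{-(2m+1)} Q(x)`, and the second factor is `Q.reverse` evaluated at
  -- `x⁻¹`; the extra factor `X` reflects the odd degree.
  · rw [map_mul, aeval_X, aeval_inv hx (N := 2 * m + 1) (hQ ▸ reverse_natDegree_le Q), ← hQ,
      reverse, reflect_reflect, mul_pow, h.sq, hQ]
    ring
  · intro a b hab
    set N := max a.natDegree b.natDegree
    rw [aeval_inv hx (N := N) (le_max_left _ _), aeval_inv hx (N := N) (le_max_right _ _)] at hab
    have h0 := h.indep (reflect N a * X ^ (m + 1)) (reflect N b) (by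
      rw [map_mul, map_pow, aeval_X]
      have hx' : x ^ N * x⁻¹ ^ N = 1 := by rw [← mul_pow, mul_inv_cancel₀ hx, one_pow]
      have hx'' : x ^ (m + 1) * x⁻¹ ^ (m + 1) = 1 := by
        rw [← mul_pow, mul_inv_cancel₀ hx, one_pow]
      linear_combination x ^ N * x ^ (m + 1) * hab -
        (aeval x (reflect N a) * x ^ (m + 1) + aeval x (reflect N b) * w *
          (x ^ (m + 1) * x⁻¹ ^ (m + 1))) * hx' - aeval x (reflect N b) * w * hx'')
    refine ⟨?_, reflect_eq_zero_iff.1 h0.2⟩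
    exact reflect_eq_zero_iff.1 ((mul_eq_zero.1 h0.1).resolve_right (pow_ne_zero _ X_ne_zero))
  · intro f
    obtain ⟨a, b, c, hc, hf⟩ := h.span f
    set N := max (max a.natDegree b.natDegree) c.natDegree
    have hpa : ∀ a : ℂ[X], a.natDegree ≤ N → aeval x a = aeval x⁻¹ (reflect N a) * x ^ N := by
      intro a ha
      have := aeval_inv (inv_ne_zero hx) ha
      rwa [inv_inv] at this
    rw [hpa a (by simp [N]), hpa b (by simp [N]), hpa c (by simp [N])] at hf
    refine ⟨reflect N a * X ^ (m + 1), reflect N b, reflect N c * X ^ (m + 1),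
      mul_ne_zero (mt reflect_eq_zero_iff.1 hc) (pow_ne_zero _ X_ne_zero), ?_⟩
    simp only [map_mul, map_pow, aeval_X]
    have hx' := pow_ne_zero N hx
    apply mul_right_cancel₀ hx'
    linear_combination x⁻¹ ^ (m + 1) * hf

end IsQuadraticPair

end QuadraticPair

/-! ### The arithmetic genus. -/

section CechGenus

open Polynomial

variable {K : Type*} [Field K] [Algebra ℂ K]

lemma linearIndependent_zpow {F : Type*} [Field F] [Algebra ℂ F] {x : F}
    (hx : Transcendental ℂ x) : LinearIndependent ℂ (fun k : ℤ => x ^ k) := by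
  have hx0 : x ≠ 0 := by
    rintro rfl
    exact hx (isAlgebraic_zero)
  rw [linearIndependent_iff']
  intro s g hg i hi
  obtain ⟨N, hN⟩ : ∃ N : ℕ, ∀ k ∈ s, -(N : ℤ) ≤ k := by
    refine ⟨s.sup fun k => k.natAbs, fun k hk => ?_⟩
    have := Finset.le_sup (f := fun k : ℤ => k.natAbs) hk
    omega
  have hp : aeval x (∑ k ∈ s, C (g k) * X ^ (k + N).toNat : ℂ[X]) = 0 := by
    have h2 : (∑ k ∈ s, g k • x ^ k) * x ^ N = 0 := by rw [hg, zero_mul]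
    rw [map_sum, ← h2, Finset.sum_mul]
    refine Finset.sum_congr rfl fun k hk => ?_
    rw [map_mul, aeval_C, map_pow, aeval_X, ← Algebra.smul_def, smul_mul_assoc]
    congr 1
    rw [← zpow_natCast x N, ← zpow_add₀ hx0, ← zpow_natCast]
    congr 1
    have := hN k hk
    omega
  have hp0 := (transcendental_iff.1 hx) _ hp
  have hc := congrArg (fun p => coeff p (i + N).toNat) hp0
  simp only [finsetSum_coeff, coeff_C_mul, coeff_X_pow, coeff_zero] at hc
  rw [Finset.sum_eq_single i] at hc
  · simpa using hc
  · intro k hk hki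
    have := hN k hk
    have := hN i hi
    rw [if_neg (by omega), mul_zero]
  · intro h; exact absurd hi h

/-- The dimension of a quotient of spans of subfamilies of a linearly independent family. -/
lemma finrank_quotient_span_image {ι : Type*} {F : ι → K} (hF : LinearIndependent ℂ F)
    (I : Set ι) (J : Finset ι) (hIJ : ∀ i, i ∈ I ↔ i ∉ J) {M N : Submodule ℂ K}
    (hM : M = Submodule.span ℂ (Set.range F)) (hN : N = Submodule.span ℂ (F '' I)) :
    Module.finrank ℂ (M ⧸ N.submoduleOf M) = J.card := by
  classical
  set P := Submodule.span ℂ (F '' (J : Set ι)) with hP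
  have hPM : P ≤ M := by rw [hM]; exact Submodule.span_mono (Set.image_subset_range _ _)
  have hNM : N ≤ M := by rw [hM, hN]; exact Submodule.span_mono (Set.image_subset_range _ _)
  have hdisj : Disjoint N P := by
    rw [hN, hP]
    exact hF.disjoint_span_image (Set.disjoint_left.2 fun i hi hj => (hIJ i).1 hi hj)
  have hsup : N ⊔ P = M := by
    rw [hN, hP, ← Submodule.span_union, ← Set.image_union, hM, ← Set.image_univ]
    congr 2
    ext i
    simp only [Set.mem_union, Set.mem_univ, iff_true, SetLike.mem_coe, hIJ]
    tauto
  have hc : IsCompl (N.submoduleOf M) (P.submoduleOf M) := by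
    constructor
    · rw [Submodule.disjoint_def]
      rintro ⟨f, hfM⟩ h1 h2
      exact Subtype.ext (Submodule.disjoint_def.1 hdisj f h1 h2)
    · rw [codisjoint_iff, eq_top_iff]
      rintro ⟨f, hfM⟩ -
      rw [← hsup] at hfM
      obtain ⟨a, ha, b, hb, rfl⟩ := Submodule.mem_sup.1 hfM
      exact Submodule.mem_sup.2 ⟨⟨a, hNM ha⟩, ha, ⟨b, hPM hb⟩, hb, rfl⟩
  rw [(Submodule.quotientEquivOfIsCompl _ _ hc).finrank_eq,
    (Submodule.submoduleOfEquivOfLe hPM).finrank_eq, hP, Set.image_eq_range]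
  have := finrank_span_eq_card (b := fun i : (J : Set ι) => F i)
    (hF.comp _ Subtype.val_injective)
  rw [this]
  simp

/-- The monomials `x^k` and `x^k y` form a basis of the functions on the overlap. The first chart
contains those with `k ≥ 0`, the second the `x^k` with `k ≤ 0` and the `x^k y` with `k ≤ -n-1`. The
gap is `x^k y`, `-n ≤ k ≤ -1`, whether or not the curve is singular. -/
lemma IsQuadraticPair.doubleCoverArithmeticGenus_eq {x y : K} {P : ℂ[X]} {n : ℕ}
    (h : IsQuadraticPair x y P) (hP : P.natDegree = 2 * n + 1) :
    doubleCoverArithmeticGenus n x y = n := by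
  classical
  have hx := h.x_ne_zero
  set F : ℤ × Fin 2 → K := fun i => x ^ i.1 * (![1, y] : Fin 2 → K) i.2 with hFdef
  have hF0 : ∀ k, F (k, 0) = x ^ k := fun k => by simp [hFdef]
  have hF1 : ∀ k, F (k, 1) = x ^ k * y := fun k => by simp [hFdef]
  have hF : LinearIndependent ℂ F := by
    have hx' : x ∈ IntermediateField.adjoin ℂ {x} :=
      IntermediateField.mem_adjoin_simple_self ℂ x
    have ht : Transcendental ℂ (⟨x, hx'⟩ : IntermediateField.adjoin ℂ {x}) := by
      intro ha
      exact h.transcendental (ha.algebraMap (A := K))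
    have := linearIndependent_smul (linearIndependent_zpow ht) h.linearIndependent_pair
    convert this using 1
    funext p
    rw [hFdef, Algebra.smul_def, map_zpow₀]
    rfl
  have h' := h.inv hP
  set A := Algebra.adjoin ℂ {x, y} with hA
  set B := Algebra.adjoin ℂ {x⁻¹, y * x⁻¹ ^ (n + 1)} with hB
  set J : Finset (ℤ × Fin 2) := (Finset.Icc (-(n : ℤ)) (-1)) ×ˢ {1} with hJ
  have hspanA : Subalgebra.toSubmodule A = Submodule.span ℂ (F '' {i | 0 ≤ i.1}) := by
    apply le_antisymm
    · intro f hf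
      rw [hA, adjoin_pair_eq_quadSubalgebra h.sq] at hf
      obtain ⟨a, b, rfl⟩ := hf
      refine Submodule.add_mem _ ?_ ?_
      · rw [← mul_one (aeval x a)]
        refine aeval_mul_mem (fun i => ?_) a
        refine Submodule.subset_span ⟨(i, 0), ?_, ?_⟩
        · simp
        · rw [hF0, mul_one, zpow_natCast]
      · refine aeval_mul_mem (fun i => ?_) b
        refine Submodule.subset_span ⟨(i, 1), ?_, ?_⟩
        · simp
        · rw [hF1, zpow_natCast]
    · rw [Submodule.span_le]
      rintro _ ⟨⟨k, e⟩, hk, rfl⟩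
      have hxA : x ∈ A := Algebra.subset_adjoin (by simp)
      have hyA : y ∈ A := Algebra.subset_adjoin (by simp)
      obtain ⟨k, rfl⟩ : ∃ k' : ℕ, k = k' := ⟨k.toNat, by
        have : 0 ≤ k := hk
        omega⟩
      rw [SetLike.mem_coe, Subalgebra.mem_toSubmodule]
      fin_cases e
      · exact (hF0 k).symm ▸ (zpow_natCast x k).symm ▸ pow_mem hxA k
      · exact (hF1 k).symm ▸ (zpow_natCast x k).symm ▸ mul_mem (pow_mem hxA k) hyA
  have hspanB : Subalgebra.toSubmodule B =
      Submodule.span ℂ (F '' {i | (i.2 = 0 ∧ i.1 ≤ 0) ∨ (i.2 = 1 ∧ i.1 ≤ -(n : ℤ) - 1)}) := by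
    have hneg : ∀ i : ℕ, x⁻¹ ^ i = x ^ (-(i : ℤ)) := fun i => by
      rw [inv_pow, zpow_neg, zpow_natCast]
    apply le_antisymm
    · intro f hf
      rw [hB, adjoin_pair_eq_quadSubalgebra h'.sq] at hf
      obtain ⟨a, b, rfl⟩ := hf
      refine Submodule.add_mem _ ?_ ?_
      · rw [← mul_one (aeval x⁻¹ a)]
        refine aeval_mul_mem (fun i => ?_) a
        refine Submodule.subset_span ⟨(-(i : ℤ), 0), ?_, ?_⟩
        · simp
        · rw [hF0, mul_one, hneg]
      · refine aeval_mul_mem (fun i => ?_) b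
        refine Submodule.subset_span ⟨(-(i : ℤ) - n - 1, 1), ?_, ?_⟩
        · simp
        · rw [hF1, mul_left_comm, ← pow_add, hneg, mul_comm]
          congr 2
          push_cast
          ring
    · rw [Submodule.span_le]
      rintro _ ⟨⟨k, e⟩, hk, rfl⟩
      have hxB : x⁻¹ ∈ B := Algebra.subset_adjoin (by simp)
      have hyB : y * x⁻¹ ^ (n + 1) ∈ B := Algebra.subset_adjoin (by simp)
      rw [SetLike.mem_coe, Subalgebra.mem_toSubmodule]
      rcases hk with ⟨he, hk⟩ | ⟨he, hk⟩
      · simp only at he hk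
        subst he
        obtain ⟨k, rfl⟩ : ∃ k' : ℕ, k = -k' := ⟨(-k).toNat, by omega⟩
        rw [hF0, ← hneg]
        exact pow_mem hxB k
      · simp only at he hk
        subst he
        obtain ⟨i, rfl⟩ : ∃ i : ℕ, k = -((i + (n + 1) : ℕ) : ℤ) := ⟨(-k - n - 1).toNat, by omega⟩
        rw [hF1, ← hneg, pow_add, mul_assoc, mul_comm _ y]
        exact mul_mem (pow_mem hxB i) hyB
  have hspan : Subalgebra.toSubmodule (A ⊔ B) = Submodule.span ℂ (Set.range F) := by
    set S := Submodule.span ℂ (Set.range F) with hS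
    have hFS : ∀ i, F i ∈ S := fun i => Submodule.subset_span ⟨i, rfl⟩
    apply le_antisymm
    · have hone : (1 : K) ∈ S := by
        have := hFS (0, 0)
        rwa [hF0, zpow_zero] at this
      have hmul : S * S ≤ S := by
        rw [hS, Submodule.span_mul_span, Submodule.span_le]
        rintro _ ⟨_, ⟨⟨k, e⟩, rfl⟩, _, ⟨⟨l, d⟩, rfl⟩, rfl⟩
        rw [SetLike.mem_coe]
        change F (k, e) * F (l, d) ∈ S
        have h00 : x ^ k * x ^ l ∈ S := by rw [← zpow_add₀ hx, ← hF0]; exact hFS _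
        have h01 : x ^ k * x ^ l * y ∈ S := by rw [← zpow_add₀ hx, ← hF1]; exact hFS _
        have h11 : aeval x P * (x ^ k * x ^ l) ∈ S := by
          refine aeval_mul_mem (fun i => ?_) P
          rw [← zpow_natCast, ← zpow_add₀ hx, ← zpow_add₀ hx, ← hF0]
          exact hFS _
        have he : e = 0 ∨ e = 1 := by omega
        have hd : d = 0 ∨ d = 1 := by omega
        rcases he with rfl | rfl <;> rcases hd with rfl | rfl
        · rwa [hF0, hF0]
        · rwa [hF0, hF1, ← mul_assoc]
        · rwa [hF0, hF1, mul_right_comm]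
        · rw [hF1, hF1, show x ^ k * y * (x ^ l * y) = y ^ 2 * (x ^ k * x ^ l) by ring, h.sq]
          exact h11
      have : A ⊔ B ≤ S.toSubalgebra hone fun a b ha hb => hmul (Submodule.mul_mem_mul ha hb) := by
        apply sup_le
        · intro f hf
          have : f ∈ Subalgebra.toSubmodule A := hf
          rw [hspanA] at this
          exact Submodule.span_mono (Set.image_subset_range _ _) this
        · intro f hf
          have : f ∈ Subalgebra.toSubmodule B := hf
          rw [hspanB] at this
          exact Submodule.span_mono (Set.image_subset_range _ _) this
      exact fun f hf => this hf
    · rw [hS, Submodule.span_le]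
      rintro _ ⟨⟨k, e⟩, rfl⟩
      have hxA : x ∈ A ⊔ B := (le_sup_left : A ≤ A ⊔ B) (Algebra.subset_adjoin (by simp))
      have hyA : y ∈ A ⊔ B := (le_sup_left : A ≤ A ⊔ B) (Algebra.subset_adjoin (by simp))
      have hxB : x⁻¹ ∈ A ⊔ B := (le_sup_right : B ≤ A ⊔ B) (Algebra.subset_adjoin (by simp))
      have hz : x ^ k ∈ A ⊔ B := by
        obtain ⟨k, rfl | rfl⟩ := k.eq_nat_or_neg
        · rw [zpow_natCast]; exact pow_mem hxA k
        · rw [zpow_neg, zpow_natCast, ← inv_pow]; exact pow_mem hxB k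
      rw [SetLike.mem_coe, Subalgebra.mem_toSubmodule]
      have he : e = 0 ∨ e = 1 := by omega
      rcases he with rfl | rfl
      · rwa [hF0]
      · rw [hF1]; exact mul_mem hz hyA
  have hN : Subalgebra.toSubmodule A ⊔ Subalgebra.toSubmodule B =
      Submodule.span ℂ (F '' ({i | 0 ≤ i.1} ∪
        {i | (i.2 = 0 ∧ i.1 ≤ 0) ∨ (i.2 = 1 ∧ i.1 ≤ -(n : ℤ) - 1)})) := by
    rw [hspanA, hspanB, Set.image_union, Submodule.span_union]
  have := finrank_quotient_span_image hF _ J (fun i => ?_) hspan hN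
  · rw [doubleCoverArithmeticGenus, cechGenus, this, hJ, Finset.card_product, Int.card_Icc]
    simp
  · obtain ⟨k, e⟩ := i
    have he : e = 0 ∨ e = 1 := by omega
    simp only [hJ, Set.mem_union, Set.mem_ofPred_eq, Finset.mem_product, Finset.mem_Icc,
      Finset.mem_singleton]
    rcases he with rfl | rfl <;> simp <;> omega

end CechGenus

/-! ### The integral closure of `ℂ[x]` in a quadratic extension. -/

section IntegralClosure

open Polynomial

variable {K : Type*} [Field K] [Algebra ℂ K] {x w : K} {Q : ℂ[X]}

/-- In `ℂ[X]`, if `c ^ 2` divides `b ^ 2 Q` with `Q` squarefree, then `c` divides `b`. -/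
lemma dvd_of_sq_dvd_sq_mul {b c Q : ℂ[X]} (hc : c ≠ 0) (hQ : Squarefree Q)
    (h : c ^ 2 ∣ b ^ 2 * Q) : c ∣ b := by
  -- After division by the gcd, `c'²` is coprime to `b'²` and hence divides `Q`, so `c'` is a unit.
  obtain ⟨g, c', b', hcop, rfl, rfl⟩ : ∃ g c' b', IsCoprime c' b' ∧ c = g * c' ∧ b = g * b' := by
    obtain ⟨c', hc'⟩ := EuclideanDomain.gcd_dvd_left c b
    obtain ⟨b', hb'⟩ := EuclideanDomain.gcd_dvd_right c b
    have hg : EuclideanDomain.gcd c b ≠ 0 := fun h0 => hc (EuclideanDomain.gcd_eq_zero_iff.1 h0).1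
    have hab := EuclideanDomain.gcd_eq_gcd_ab c b
    generalize EuclideanDomain.gcd c b = g at *
    refine ⟨g, c', b', ⟨EuclideanDomain.gcdA c b, EuclideanDomain.gcdB c b, ?_⟩, hc', hb'⟩
    apply mul_left_cancel₀ hg
    linear_combination -hab - EuclideanDomain.gcdA c b * hc' - EuclideanDomain.gcdB c b * hb'
  have hg : g ≠ 0 := left_ne_zero_of_mul hc
  have h1 : c' ^ 2 ∣ b' ^ 2 * Q := by
    rw [mul_pow, mul_pow, mul_assoc] at h
    exact (mul_dvd_mul_iff_left (pow_ne_zero 2 hg)).1 h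
  have h2 : c' * c' ∣ Q := by
    rw [← sq]
    exact (hcop.pow (m := 2) (n := 2)).dvd_of_dvd_mul_left h1
  exact mul_dvd_mul_left g (hQ c' h2).dvd

/-- The monic divisors of positive degree of a quadratic polynomial. -/
lemma natDegree_eq_one_or_dvd_of_dvd_quadratic {R : Type*} [CommRing R] [IsDomain R] {m : R[X]}
    (hm : m.Monic) (hm0 : m.natDegree ≠ 0) {α β γ : R} (hα : α ≠ 0)
    (h : m ∣ C α * X ^ 2 + C β * X + C γ) : m.natDegree = 1 ∨ (α ∣ β ∧ α ∣ γ) := by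
  obtain ⟨r, hr⟩ := h
  have hr0 : r ≠ 0 := by
    rintro rfl
    have := congrArg (fun p => coeff p 2) hr
    simp at this
    exact hα this
  have hd := congrArg natDegree hr
  rw [natDegree_quadratic hα, natDegree_mul hm.ne_zero hr0] at hd
  by_cases h1 : m.natDegree = 1
  · exact Or.inl h1
  · right
    have hr1 : r.natDegree = 0 := by omega
    have hm2 : m.natDegree = 2 := by omega
    rw [eq_C_of_natDegree_eq_zero hr1] at hr
    have h2 : m.coeff 2 = 1 := hm2 ▸ hm.coeff_natDegree
    have e2 := congrArg (fun p => coeff p 2) hr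
    have e1 := congrArg (fun p => coeff p 1) hr
    have e0 := congrArg (fun p => coeff p 0) hr
    simp only [coeff_mul_C, h2, one_mul, coeff_add, coeff_C_mul, coeff_X_pow, coeff_X,
      coeff_C] at e2 e1 e0
    simp at e2 e1 e0
    exact ⟨⟨m.coeff 1, by rw [e1, e2, mul_comm]⟩, ⟨m.coeff 0, by rw [e0, e2, mul_comm]⟩⟩

/-- The integral closure of `ℂ[x]` is `ℂ[x] + ℂ[x] w`. -/
lemma IsQuadraticPair.exists_of_isIntegral [Algebra ℂ[X] K] (h : IsQuadraticPair x w Q)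
    (hx : ∀ a : ℂ[X], algebraMap ℂ[X] K a = aeval x a) (hQ : Squarefree Q) {f : K}
    (hf : IsIntegral ℂ[X] f) : ∃ a b : ℂ[X], f = aeval x a + aeval x b * w := by
  have : FaithfulSMul ℂ[X] K := (faithfulSMul_iff_algebraMap_injective _ _).2 (by
    rw [injective_iff_map_eq_zero]
    intro a ha
    rw [hx] at ha
    exact h.aeval_eq_zero ha)
  obtain ⟨a, b, c, hc, hfc⟩ := h.span f
  have hc' := h.aeval_ne_zero hc
  -- For `f = (a + b w) / c` this is its norm polynomial multiplied by `c²`. As `ℂ[x]` is integrally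
  -- closed, the minimal polynomial of `f` divides it: either `f ∈ ℂ[x]`, or `c²` divides `2ac` and
  -- `a² - b² Q`, whence `c` divides `a` and `b`.
  have hG0 : aeval f (C (c ^ 2) * X ^ 2 + C (-(2 * a * c)) * X + C (a ^ 2 - b ^ 2 * Q) : ℂ[X][X])
      = 0 := by
    simp only [map_add, map_sub, map_mul, aeval_C, map_pow, aeval_X, hx, map_neg, ← h.sq, map_ofNat]
    linear_combination (f * aeval x c - aeval x a + aeval x b * w) * hfc
  have hm := minpoly.monic hf
  have hm0 : (minpoly ℂ[X] f).natDegree ≠ 0 := (minpoly.natDegree_pos hf).ne'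
  rcases natDegree_eq_one_or_dvd_of_dvd_quadratic hm hm0 (pow_ne_zero 2 hc) (minpoly.isIntegrallyClosed_dvd hf hG0) with
    h1 | ⟨h1, h2⟩
  · have h2 := minpoly.aeval ℂ[X] f
    rw [hm.eq_X_add_C h1, map_add, aeval_X, aeval_C, hx] at h2
    refine ⟨-(minpoly ℂ[X] f).coeff 0, 0, ?_⟩
    rw [map_neg, map_zero]
    linear_combination h2
  · rw [dvd_neg, pow_two, mul_comm (2 * a) c] at h1
    have hca : c ∣ a := by
      have h3 : c ∣ 2 * a := (mul_dvd_mul_iff_left hc).1 h1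
      have h4 : (2 : ℂ[X]) = C 2 := rfl
      rw [h4] at h3
      exact (IsUnit.dvd_mul_left (isUnit_C.2 (by norm_num))).1 h3
    have hcb : c ∣ b := by
      apply dvd_of_sq_dvd_sq_mul hc hQ
      exact (dvd_sub_right (pow_dvd_pow_of_dvd hca 2)).1 h2
    obtain ⟨a', rfl⟩ := hca
    obtain ⟨b', rfl⟩ := hcb
    refine ⟨a', b', mul_left_cancel₀ hc' ?_⟩
    simp only [map_mul] at hfc
    linear_combination hfc

end IntegralClosure

/-! ### Kähler differentials of the function field. -/

section Kaehler

open Polynomial KaehlerDifferential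

variable {K : Type*} [Field K] [Algebra ℂ K] {x w : K} {Q : ℂ[X]}

lemma IsQuadraticPair.finite_fractionRing [Algebra ℂ[X] K] [Algebra (FractionRing ℂ[X]) K]
    [IsScalarTower ℂ[X] (FractionRing ℂ[X]) K] (h : IsQuadraticPair x w Q)
    (hx : ∀ a : ℂ[X], algebraMap ℂ[X] K a = aeval x a) :
    FiniteDimensional (FractionRing ℂ[X]) K := by
  classical
  refine ⟨⟨({1, w} : Finset K), ?_⟩⟩
  rw [eq_top_iff]
  intro f _
  obtain ⟨a, b, c, hc, hf⟩ := h.span f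
  have hc' := h.aeval_ne_zero hc
  have e : f = (algebraMap ℂ[X] (FractionRing ℂ[X]) a / algebraMap ℂ[X] (FractionRing ℂ[X]) c) •
      (1 : K) + (algebraMap ℂ[X] (FractionRing ℂ[X]) b / algebraMap ℂ[X] (FractionRing ℂ[X]) c) •
      w := by
    simp only [Algebra.smul_def, map_div₀, ← IsScalarTower.algebraMap_apply, hx]
    field_simp
    exact hf
  rw [e]
  exact Submodule.add_mem _ (Submodule.smul_mem _ _ (Submodule.subset_span (by simp)))
      (Submodule.smul_mem _ _ (Submodule.subset_span (by simp)))

/-- The differentials of `K` form a one-dimensional space with basis `dx`. -/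
lemma IsQuadraticPair.exists_equiv (h : IsQuadraticPair x w Q) :
    ∃ e : Ω[K⁄ℂ] ≃ₗ[K] K, e (D ℂ K x) = 1 := by
  let _ : Algebra ℂ[X] K := (aeval x).toRingHom.toAlgebra
  have hx : ∀ a : ℂ[X], algebraMap ℂ[X] K a = aeval x a := fun _ => rfl
  have : IsScalarTower ℂ ℂ[X] K := IsScalarTower.of_algebraMap_eq fun c => by
    rw [hx, Polynomial.algebraMap_eq, aeval_C]
  have : FaithfulSMul ℂ[X] K := (faithfulSMul_iff_algebraMap_injective _ _).2 (by
    rw [injective_iff_map_eq_zero]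
    intro a ha
    exact h.aeval_eq_zero ha)
  let _ : Algebra (FractionRing ℂ[X]) K := FractionRing.liftAlgebra ℂ[X] K
  have : IsScalarTower ℂ[X] (FractionRing ℂ[X]) K := inferInstance
  have := h.finite_fractionRing hx
  have : Algebra.IsSeparable (FractionRing ℂ[X]) K := inferInstance
  -- Localization and the finite separable extension are both formally étale, so `Ω_K` is the base
  -- change of `Ω_{ℂ[X]} = ℂ[X] dX`.
  have : Algebra.FormallyEtale ℂ[X] (FractionRing ℂ[X]) :=
    Algebra.FormallyEtale.of_isLocalization (nonZeroDivisors ℂ[X])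
  have : Algebra.FormallyEtale (FractionRing ℂ[X]) K := Algebra.FormallyEtale.of_isSeparable _ _
  have : Algebra.FormallyEtale ℂ[X] K := Algebra.FormallyEtale.comp ℂ[X] (FractionRing ℂ[X]) K
  refine ⟨(tensorKaehlerEquivOfFormallyEtale ℂ ℂ[X] K).symm.trans
    ((TensorProduct.AlgebraTensorModule.congr (LinearEquiv.refl K K) (polynomialEquiv ℂ)).trans
      (TensorProduct.AlgebraTensorModule.rid ℂ[X] K K)), ?_⟩
  have hxX : x = algebraMap ℂ[X] K X := by rw [hx, aeval_X]
  rw [hxX, LinearEquiv.trans_apply, tensorKaehlerEquivOfFormallyEtale_symm_D_algebraMap,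
    LinearEquiv.trans_apply, TensorProduct.AlgebraTensorModule.congr_tmul, polynomialEquiv_D,
    derivative_X, TensorProduct.AlgebraTensorModule.rid_tmul]
  simp

end Kaehler

/-! ### Differentials regular at the finite places. -/

section RegularDifferentials

open Polynomial KaehlerDifferential

variable {K : Type*} [Field K] [Algebra ℂ K] {x w : K} {Q : ℂ[X]}

/-- Regularity of a differential at a place. -/
def IsRegularAt (O : ValuationSubring K) (ω : Ω[K⁄ℂ]) : Prop :=
  ω ∈ Submodule.span O.toSubring (D ℂ K '' (O : Set K))

lemma IsRegularAt.smul_D {O : ValuationSubring K} {f g : K} (hf : f ∈ O) (hg : g ∈ O) :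
    IsRegularAt O (f • D ℂ K g) :=
  Submodule.smul_mem _ (⟨f, hf⟩ : O.toSubring) (Submodule.subset_span ⟨g, hg, rfl⟩)

lemma IsRegularAt.add {O : ValuationSubring K} {ω η : Ω[K⁄ℂ]} (h : IsRegularAt O ω)
    (h' : IsRegularAt O η) : IsRegularAt O (ω + η) := Submodule.add_mem _ h h'

/-- A derivation that preserves a valuation ring takes integral values on the differentials that
are regular there. -/
lemma IsRegularAt.apply_mem {O : ValuationSubring K} {ω : Ω[K⁄ℂ]} (h : IsRegularAt O ω)
    (L : Ω[K⁄ℂ] →ₗ[K] K) (hL : ∀ g ∈ O, L (D ℂ K g) ∈ O) : L ω ∈ O := by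
  refine Submodule.span_induction (p := fun ω _ => L ω ∈ O) ?_ ?_ ?_ ?_ h
  · rintro _ ⟨g, hg, rfl⟩
    exact hL g hg
  · rw [map_zero]; exact O.zero_mem
  · intro a b _ _ ha hb
    rw [map_add]; exact O.add_mem _ _ ha hb
  · intro c a _ ha
    have : L (c • a) = (c : K) * L a := L.map_smul (c : K) a
    rw [this]
    exact O.mul_mem _ _ c.2 ha

lemma aeval_mem_valuationSubring {O : ValuationSubring K} (hO : ∀ c : ℂ, algebraMap ℂ K c ∈ O)
    (hx : x ∈ O) (a : ℂ[X]) : aeval x a ∈ O := by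
  induction a using Polynomial.induction_on' with
  | add a b ha hb => rw [map_add]; exact O.add_mem _ _ ha hb
  | monomial m c => rw [aeval_monomial]; exact O.mul_mem _ _ (hO c) (pow_mem hx m)

namespace IsQuadraticPair

/-- If `w⁻¹` is in the valuation ring, so is `w = Q(x) w⁻¹`. -/
lemma w_mem (h : IsQuadraticPair x w Q) {O : ValuationSubring K}
    (hO : ∀ c : ℂ, algebraMap ℂ K c ∈ O) (hx : x ∈ O) : w ∈ O := by
  rcases O.mem_or_inv_mem w with hw | hw
  · exact hw
  · have := O.mul_mem _ _ (aeval_mem_valuationSubring hO hx Q) hw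
    rwa [← h.sq, pow_two, mul_assoc, mul_inv_cancel₀ h.w_ne_zero, mul_one] at this

lemma D_w (h : IsQuadraticPair x w Q) :
    (2 * w) • D ℂ K w = aeval x (derivative Q) • D ℂ K x := by
  have := congrArg (D ℂ K) h.sq
  rw [Derivation.map_aeval, Derivation.leibniz_pow] at this
  rw [← this]
  simp only [Nat.add_one_sub_one, pow_one, mul_smul, ofNat_smul_eq_nsmul]

/-- The differentials `(a(x) + b(x) w) dx / w` are regular at all finite places. -/
lemma isRegularAt (h : IsQuadraticPair x w Q) (hQ : Squarefree Q) {O : ValuationSubring K}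
    (hO : ∀ c : ℂ, algebraMap ℂ K c ∈ O) (hx : x ∈ O) (a b : ℂ[X]) :
    IsRegularAt O (((aeval x a + aeval x b * w) / w) • D ℂ K x) := by
  -- The Bézout identity `A Q + B Q' = 1` and `2w dw = Q' dx` give `dx / w = A w dx + 2 B dw`, so no
  -- local parameter at the branch points is needed.
  obtain ⟨A, B, hAB⟩ := PerfectField.separable_iff_squarefree.2 hQ
  have hw := h.w_ne_zero
  have hwO := h.w_mem hO hx
  have hp := aeval_mem_valuationSubring (O := O) hO hx
  have h2 : (2 : K) ∈ O := by
    have := hO 2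
    rwa [map_ofNat] at this
  set f := aeval x a + aeval x b * w with hf
  have hfO : f ∈ O := O.add_mem _ _ (hp a) (O.mul_mem _ _ (hp b) hwO)
  have e : (f / w) • D ℂ K x = (f * aeval x A * w) • D ℂ K x + (f * aeval x B * 2) • D ℂ K w := by
    have h1 : aeval x A * w ^ 2 + aeval x B * aeval x (derivative Q) = 1 := by
      rw [h.sq, ← map_mul, ← map_mul, ← map_add, hAB, map_one]
    have h3 : (f * aeval x B * 2) • D ℂ K w =
        (f * aeval x B / w * aeval x (derivative Q)) • D ℂ K x := by
      rw [mul_smul (f * aeval x B / w), ← h.D_w, smul_smul]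
      congr 1
      field_simp
    rw [h3, ← add_smul]
    congr 1
    field_simp
    linear_combination -f * h1
  rw [e]
  exact (IsRegularAt.smul_D (O.mul_mem _ _ (O.mul_mem _ _ hfO (hp A)) hwO) hx).add
    (IsRegularAt.smul_D (O.mul_mem _ _ (O.mul_mem _ _ hfO (hp B)) h2) hwO)

/-- The differentials that are regular at all finite places. -/
lemma exists_of_isRegularAt (h : IsQuadraticPair x w Q) (hQ : Squarefree Q) {ω : Ω[K⁄ℂ]}
    (hω : ∀ O : ValuationSubring K, (∀ c : ℂ, algebraMap ℂ K c ∈ O) → x ∈ O → IsRegularAt O ω) :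
    ∃ a b : ℂ[X], ω = ((aeval x a + aeval x b * w) / w) • D ℂ K x := by
  obtain ⟨e, he⟩ := h.exists_equiv
  have hw := h.w_ne_zero
  let _ : Algebra ℂ[X] K := (aeval x).toRingHom.toAlgebra
  have hx : ∀ a : ℂ[X], algebraMap ℂ[X] K a = aeval x a := fun _ => rfl
  have : FaithfulSMul ℂ[X] K := (faithfulSMul_iff_algebraMap_injective _ _).2 (by
    rw [injective_iff_map_eq_zero]
    intro a ha
    exact h.aeval_eq_zero ha)
  let _ : Algebra (FractionRing ℂ[X]) K := FractionRing.liftAlgebra ℂ[X] K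
  have : IsScalarTower ℂ[X] (FractionRing ℂ[X]) K := inferInstance
  have := h.finite_fractionRing hx
  have : IsFractionRing (integralClosure ℂ[X] K) K :=
    integralClosure.isFractionRing_of_finite_extension (FractionRing ℂ[X]) K
  have : IsDedekindDomain (integralClosure ℂ[X] K) :=
    integralClosure.isDedekindDomain_fractionRing ℂ[X] K
  have hpS : ∀ a : ℂ[X], aeval x a ∈ integralClosure ℂ[X] K := fun a => by
    rw [← hx]; exact (integralClosure ℂ[X] K).algebraMap_mem a
  have hwS : w ∈ integralClosure ℂ[X] K := by
    refine ⟨X ^ 2 - C Q, monic_X_pow_sub_C Q two_ne_zero, ?_⟩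
    rw [eval₂_sub, eval₂_X_pow, eval₂_C, hx, h.sq, sub_self]
  -- `L` corresponds to the derivation `2w d/dx`. It sends `x` to `2w` and `w` to `Q'(x)`, so it
  -- preserves the integral closure `ℂ[x] + ℂ[x] w`.
  set L : Ω[K⁄ℂ] →ₗ[K] K := (2 * w) • e.toLinearMap with hLdef
  have hL : ∀ η, L η = 2 * w * e η := fun η => rfl
  have hLx : L (D ℂ K x) = 2 * w := by rw [hL, he, mul_one]
  have hLw : L (D ℂ K w) = aeval x (derivative Q) := by
    have := congrArg e h.D_w
    rw [map_smul, map_smul, he, smul_eq_mul, smul_eq_mul, mul_one] at this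
    rw [hL, this]
  have hLS : ∀ s ∈ integralClosure ℂ[X] K, L (D ℂ K s) ∈ integralClosure ℂ[X] K := by
    intro s hs
    obtain ⟨a, b, rfl⟩ := h.exists_of_isIntegral hx hQ hs
    rw [map_add, Derivation.leibniz, Derivation.map_aeval, Derivation.map_aeval]
    simp only [map_add, map_smul, hLx, hLw, smul_eq_mul]
    have h2S : (2 : K) ∈ integralClosure ℂ[X] K := by
      have := hpS (C 2)
      rwa [aeval_C, map_ofNat] at this
    exact add_mem (mul_mem (hpS _) (mul_mem h2S hwS)) (add_mem (mul_mem (hpS _) (hpS _))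
      (mul_mem hwS (mul_mem (hpS _) (mul_mem h2S hwS))))
  -- At a prime `v`, elements of the valuation ring are quotients `s / u` with `u` outside `v`; by
  -- the quotient rule `L` preserves this ring. So `L ω` is integral at every prime, hence lies in
  -- the Dedekind domain.
  have hmem : 2 * w * e ω ∈ (algebraMap (integralClosure ℂ[X] K) K).range := by
    apply IsDedekindDomain.HeightOneSpectrum.mem_integers_of_valuation_le_one
    intro v
    have hSv : ∀ s ∈ integralClosure ℂ[X] K, s ∈ (v.valuation K).valuationSubring :=
      fun s hs => v.valuation_le_one ⟨s, hs⟩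
    have hreg := hω (v.valuation K).valuationSubring
      (fun c => by
        have := hSv _ (hpS (C c))
        rwa [aeval_C] at this)
      (by
        have := hSv _ (hpS X)
        rwa [aeval_X] at this)
    refine hreg.apply_mem L fun g hg => ?_
    obtain ⟨s, u, hsu⟩ := v.exists_primeCompl_mul_eq_of_integer g hg
    have hu1 : v.valuation K (algebraMap (integralClosure ℂ[X] K) K u) = 1 := by
      rw [v.valuation_of_algebraMap]
      exact (v.intValuation_eq_one_iff_mem_primeCompl _).2 u.2
    have h3 := congrArg (fun t => L (D ℂ K t)) hsu
    simp only [Derivation.leibniz, map_add, map_smul, smul_eq_mul] at h3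
    have h4 : algebraMap (integralClosure ℂ[X] K) K u * L (D ℂ K g) ∈
        (v.valuation K).valuationSubring := by
      have e4 : algebraMap (integralClosure ℂ[X] K) K u * L (D ℂ K g) =
          L (D ℂ K (algebraMap (integralClosure ℂ[X] K) K s)) -
            g * L (D ℂ K (algebraMap (integralClosure ℂ[X] K) K u)) := by
        rw [← h3]; ring
      rw [e4]
      exact sub_mem (hSv _ (hLS _ s.2)) (mul_mem hg (hSv _ (hLS _ u.1.2)))
    rw [Valuation.mem_valuationSubring_iff, map_mul, hu1, one_mul] at h4
    exact h4
  obtain ⟨⟨s, hs⟩, hs'⟩ := hmem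
  obtain ⟨a, b, hab⟩ := h.exists_of_isIntegral hx hQ hs
  have hs'' : s = 2 * w * e ω := hs'
  refine ⟨C (1 / 2) * a, C (1 / 2) * b, ?_⟩
  apply e.injective
  rw [map_smul, he, smul_eq_mul, mul_one]
  have hhalf : algebraMap ℂ K (1 / 2) * 2 = 1 := by
    rw [← map_ofNat (algebraMap ℂ K) 2, ← map_mul]
    norm_num
  rw [eq_div_iff hw]
  simp only [map_mul, aeval_C]
  linear_combination (-algebraMap ℂ K (1 / 2)) * (hs'' - hab) - e ω * w * hhalf

end IsQuadraticPair

end RegularDifferentials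

/-! ### The regular differentials and the geometric genus. -/

section Genus

open Polynomial KaehlerDifferential

variable {K : Type*} [Field K] [Algebra ℂ K] {x w : K} {Q : ℂ[X]}

/-- The constant term of `Q.reverse` is the leading coefficient of `Q`, so `X` occurs only once. A
square factor `g²` is thus prime to `X`, and reversing it gives a square factor of `Q`; reversing
`Q` twice loses only a power of `X`. -/
lemma squarefree_X_mul_reverse {Q : ℂ[X]} (hQ : Squarefree Q) : Squarefree (X * Q.reverse) := by
  have hQ0 : Q ≠ 0 := hQ.ne_zero
  have hX : ¬ (X : ℂ[X]) ∣ Q.reverse := by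
    rw [X_dvd_iff, coeff_zero_reverse]
    exact leadingCoeff_ne_zero.2 hQ0
  intro g hg
  have hXg : ¬ (X : ℂ[X]) ∣ g := by
    intro h
    have h1 : (X : ℂ[X]) * X ∣ X * Q.reverse := (mul_dvd_mul h h).trans hg
    exact hX ((mul_dvd_mul_iff_left X_ne_zero).1 h1)
  have hcop : IsCoprime g (X : ℂ[X]) := ((irreducible_X.coprime_iff_not_dvd).2 hXg).symm
  have hg1 : g * g ∣ Q.reverse := (hcop.mul_left hcop).dvd_of_dvd_mul_left hg
  obtain ⟨r, hr⟩ := hg1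
  have hdvd : g.reverse * g.reverse ∣ Q := by
    have h1 : Q.reverse.reverse ∣ Q := by
      obtain ⟨R, hR, hXR⟩ := exists_eq_pow_rootMultiplicity_mul_and_not_dvd Q hQ0 0
      rw [C_0, sub_zero] at hR hXR
      rw [X_dvd_iff] at hXR
      generalize rootMultiplicity 0 Q = k at hR
      have hRR : R.reverse.reverse = R := by
        have : R.reverse.natDegree = R.natDegree := by
          rw [reverse_natDegree, natTrailingDegree_eq_zero.2 (Or.inr hXR), Nat.sub_zero]
        rw [reverse, this, reverse, reflect_reflect]
      rw [hR, mul_comm, reverse_mul_X_pow, hRR]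
      exact dvd_mul_right _ _
    refine dvd_trans ?_ h1
    rw [hr, reverse_mul_of_domain, reverse_mul_of_domain]
    exact dvd_mul_right _ _
  have hu := hQ _ hdvd
  have hg0 : g.coeff 0 ≠ 0 := by rwa [X_dvd_iff] at hXg
  have hd := natDegree_eq_zero_of_isUnit hu
  rw [reverse_natDegree, natTrailingDegree_eq_zero.2 (Or.inr hg0), Nat.sub_zero] at hd
  rw [eq_C_of_natDegree_eq_zero hd]
  exact isUnit_C.2 hg0.isUnit

namespace IsQuadraticPair

/-- The regular differentials are the `a(x) dx / w` with `deg a < m`. -/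
lemma mem_regularDifferentials_iff (h : IsQuadraticPair x w Q) (hQ : Squarefree Q) {m : ℕ}
    (hm : Q.natDegree = 2 * m + 1) (ω : Ω[K⁄ℂ]) :
    ω ∈ regularDifferentials K ↔ ∃ a ∈ degreeLT ℂ m, ω = (aeval x a / w) • D ℂ K x := by
  have h' := h.inv hm
  have hQ' := squarefree_X_mul_reverse hQ
  have hx := h.x_ne_zero
  have hw := h.w_ne_zero
  have hDinv : D ℂ K x⁻¹ = (-x⁻¹ ^ 2) • D ℂ K x := Derivation.leibniz_inv _ _
  constructor
  · intro hω
    obtain ⟨a, b, hab⟩ := h.exists_of_isRegularAt hQ fun O hO _ => hω O hO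
    obtain ⟨a', b', hab'⟩ := h'.exists_of_isRegularAt hQ' fun O hO _ => hω O hO
    obtain ⟨e, he⟩ := h.exists_equiv
    have heq : (aeval x a + aeval x b * w) / w =
        (aeval x⁻¹ a' + aeval x⁻¹ b' * (w * x⁻¹ ^ (m + 1))) / (w * x⁻¹ ^ (m + 1)) *
          (-x⁻¹ ^ 2) := by
      have := congrArg e (hab.symm.trans hab')
      rwa [hDinv, map_smul, map_smul, map_smul, he, smul_eq_mul, smul_eq_mul, smul_eq_mul, mul_one,
        mul_one] at this
    set N := max a'.natDegree b'.natDegree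
    rw [aeval_inv hx (N := N) (le_max_left _ _), aeval_inv hx (N := N) (le_max_right _ _)] at heq
    -- The finite and infinite charts give two expressions for `ω`, related by `d(x⁻¹) = -x⁻² dx`.
    -- After clearing powers of `x`, degrees force `deg b + N + 2 ≤ N` unless `b = 0`, and `deg a +
    -- N + 2 ≤ N + m + 1` unless `a = 0`.
    have h0 := h.indep (a * X ^ (N + 2) + reflect N a' * X ^ (m + 1))
      (b * X ^ (N + 2) + reflect N b') (by
        simp only [map_add, map_mul, map_pow, aeval_X]
        have hN : x⁻¹ ^ N * x⁻¹ ^ 2 * x ^ (N + 2) = 1 := by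
          rw [← pow_add, ← mul_pow, inv_mul_cancel₀ hx, one_pow]
        have heq' : aeval x a + aeval x b * w = -(aeval x (reflect N a') * x⁻¹ ^ N * x ^ (m + 1) *
            x⁻¹ ^ 2 + aeval x (reflect N b') * x⁻¹ ^ N * w * x⁻¹ ^ 2) := by
          rw [div_eq_iff hw] at heq
          rw [heq]
          generalize aeval x (reflect N a') * x⁻¹ ^ N = A
          generalize aeval x (reflect N b') * x⁻¹ ^ N = B
          simp only [inv_pow]
          field_simp
        linear_combination x ^ (N + 2) * heq' -
          (aeval x (reflect N a') * x ^ (m + 1) + aeval x (reflect N b') * w) * hN)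
    have hb : b = 0 := by
      by_contra hb
      have h1 := congrArg natDegree (eq_neg_of_add_eq_zero_left h0.2)
      rw [natDegree_mul_X_pow _ hb, natDegree_neg] at h1
      have h2 : (reflect N b').natDegree ≤ max N b'.natDegree := natDegree_reflect_le
      have h3 : b'.natDegree ≤ N := le_max_right _ _
      omega
    refine ⟨a, ?_, by rw [hab, hb, map_zero, zero_mul, add_zero]⟩
    by_cases ha : a = 0
    · rw [ha]; exact Submodule.zero_mem _
    · have h1 := congrArg natDegree (eq_neg_of_add_eq_zero_left h0.1)
      rw [natDegree_mul_X_pow _ ha, natDegree_neg] at h1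
      have h2 : (reflect N a').natDegree ≤ max N a'.natDegree := natDegree_reflect_le
      have h3 : a'.natDegree ≤ N := le_max_left _ _
      have h4 := natDegree_mul_le (p := reflect N a') (q := X ^ (m + 1))
      rw [natDegree_X_pow] at h4
      rw [mem_degreeLT, degree_eq_natDegree ha]
      have h5 : a.natDegree < m := by omega
      exact_mod_cast h5
  · rintro ⟨a, ha, rfl⟩ O hO
    rcases O.mem_or_inv_mem x with hxO | hxO
    · have := h.isRegularAt hQ hO hxO a 0
      rwa [map_zero, zero_mul, add_zero] at this
    · by_cases ha0 : a = 0
      · rw [ha0, map_zero, zero_div, zero_smul]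
        exact Submodule.zero_mem _
      have had : a.natDegree < m := by
        rw [mem_degreeLT, degree_eq_natDegree ha0] at ha
        exact_mod_cast ha
      -- In the coordinates at infinity, `a(x) = x^{m-1} (reflect (m-1) a)(x⁻¹)`, and the sign comes
      -- from `d(x⁻¹) = -x⁻² dx`.
      have := h'.isRegularAt hQ' hO hxO (-reflect (m - 1) a) 0
      change IsRegularAt O _
      convert this using 1
      rw [hDinv, smul_smul, map_zero, zero_mul, add_zero, map_neg]
      congr 1
      have hr := aeval_inv (inv_ne_zero hx) (a := a) (N := m - 1) (by omega)
      rw [inv_inv] at hr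
      rw [hr]
      obtain ⟨k, rfl⟩ : ∃ k, m = k + 1 := ⟨m - 1, by omega⟩
      rw [Nat.add_sub_cancel]
      generalize aeval x⁻¹ (reflect k a) = A
      simp only [inv_pow]
      field_simp
      ring

lemma geometricGenus_eq (h : IsQuadraticPair x w Q) (hQ : Squarefree Q) {m : ℕ}
    (hm : Q.natDegree = 2 * m + 1) : geometricGenus K = m := by
  obtain ⟨e, he⟩ := h.exists_equiv
  have hw := h.w_ne_zero
  let F : degreeLT ℂ m →ₗ[ℂ] regularDifferentials K :=
    { toFun := fun a => ⟨(aeval x a.1 / w) • D ℂ K x,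
        (h.mem_regularDifferentials_iff hQ hm _).2 ⟨a.1, a.2, rfl⟩⟩
      map_add' := fun a b => by
        ext
        simp only [Submodule.coe_add, map_add, add_div, add_smul]
      map_smul' := fun c a => by
        ext
        simp only [SetLike.val_smul, map_smul, RingHom.id_apply, smul_div_assoc, smul_assoc] }
  have hF : Function.Bijective F := by
    constructor
    · rw [injective_iff_map_eq_zero]
      rintro ⟨a, ha⟩ h0
      have h1 := congrArg (fun ω => e (Subtype.val ω)) h0
      simp only [F, LinearMap.coe_mk, AddHom.coe_mk, map_smul, he, ZeroMemClass.coe_zero, map_zero,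
        smul_eq_mul, mul_one, div_eq_zero_iff, hw, or_false] at h1
      exact Subtype.ext (h.aeval_eq_zero h1)
    · rintro ⟨ω, hω⟩
      obtain ⟨a, ha, rfl⟩ := (h.mem_regularDifferentials_iff hQ hm ω).1 hω
      exact ⟨⟨a, ha⟩, rfl⟩
  rw [geometricGenus, ← (LinearEquiv.ofBijective F hF).finrank_eq,
    (degreeLTEquiv ℂ m).finrank_eq, Module.finrank_fin_fun]

end IsQuadraticPair

end Genus

/-! ### The function field of the curve and the hyperelliptic criterion. -/

section FunctionField

open Polynomial

lemma exists_sq_mul_squarefree {F : Type*} [Field F] (P : F[X]) (hP : P ≠ 0) :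
    ∃ R Q : F[X], P = R ^ 2 * Q ∧ Squarefree Q := by
  induction hd : P.natDegree using Nat.strong_induction_on generalizing P with
  | _ d ih =>
    by_cases hsq : Squarefree P
    · exact ⟨1, P, by ring, hsq⟩
    · obtain ⟨g, ⟨c, rfl⟩, hg⟩ : ∃ g : F[X], g * g ∣ P ∧ ¬ IsUnit g := by
        simpa [Squarefree] using hsq
      have hc : c ≠ 0 := right_ne_zero_of_mul hP
      have hg0 : g ≠ 0 := left_ne_zero_of_mul (left_ne_zero_of_mul hP)
      have hgd := natDegree_pos_iff_degree_pos.2 (degree_pos_of_ne_zero_of_nonunit hg0 hg)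
      rw [natDegree_mul (mul_ne_zero hg0 hg0) hc, natDegree_mul hg0 hg0] at hd
      obtain ⟨R, Q, rfl, hQ⟩ := ih c.natDegree (by omega) c hc rfl
      exact ⟨g * R, Q, by ring, hQ⟩

variable {n : ℕ} {H : ℤ → ℤ → ℂ}

lemma CurveRing.isQuadraticPair (hH : Admissible n H) (K : Type*) [Field K] [Algebra ℂ K]
    [Algebra (CurveRing n H) K] [IsScalarTower ℂ (CurveRing n H) K]
    [IsFractionRing (CurveRing n H) K] :
    IsQuadraticPair (algebraMap (CurveRing n H) K (CurveRing.lam n H))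
      (algebraMap (CurveRing n H) K (CurveRing.p n H)) (branchPoly n H) := by
  have : IsDomain (CurveRing n H) := CurveRing.isDomain hH
  have hinj := IsFractionRing.injective (CurveRing n H) K
  have hsq := CurveRing.p_sq n H
  have indep : ∀ a b : ℂ[X], aeval (algebraMap (CurveRing n H) K (CurveRing.lam n H)) a +
      aeval (algebraMap (CurveRing n H) K (CurveRing.lam n H)) b *
        algebraMap (CurveRing n H) K (CurveRing.p n H) = 0 → a = 0 ∧ b = 0 := by
    intro a b h0
    rw [aeval_algebraMap_apply, aeval_algebraMap_apply, ← map_mul, ← map_add] at h0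
    exact CurveRing.eq_zero_of_add_mul hH ((map_eq_zero_iff _ hinj).1 h0)
  have sq' : algebraMap (CurveRing n H) K (CurveRing.p n H) ^ 2 =
      aeval (algebraMap (CurveRing n H) K (CurveRing.lam n H)) (branchPoly n H) := by
    rw [← map_pow, hsq, aeval_algebraMap_apply]
  refine ⟨sq', indep, fun f => ?_⟩
  obtain ⟨u, v, hv, rfl⟩ := IsFractionRing.div_surjective (A := CurveRing n H) f
  obtain ⟨a, b, rfl⟩ := CurveRing.exists_eq u
  obtain ⟨c, d, rfl⟩ := CurveRing.exists_eq v
  have hv0 := (map_ne_zero_iff _ hinj).2 (nonZeroDivisors.ne_zero hv)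
  simp only [map_add, map_mul, ← aeval_algebraMap_apply] at hv0 ⊢
  generalize algebraMap (CurveRing n H) K (CurveRing.lam n H) = x at *
  generalize algebraMap (CurveRing n H) K (CurveRing.p n H) = y at *
  -- Denominators are cleared by the conjugate `c - d y`. The norm is nonzero, since otherwise `c -
  -- d y = 0` and independence would give `c = d = 0`.
  have hnorm : aeval x (c ^ 2 - d ^ 2 * branchPoly n H) =
      (aeval x c + aeval x d * y) * (aeval x c - aeval x d * y) := by
    simp only [map_sub, map_mul, map_pow, ← sq']
    ring
  refine ⟨a * c - b * d * branchPoly n H, b * c - a * d, c ^ 2 - d ^ 2 * branchPoly n H, ?_, ?_⟩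
  · intro h0
    rw [h0, map_zero, zero_eq_mul, or_iff_right hv0] at hnorm
    obtain ⟨rfl, hd⟩ := indep c (-d) (by rw [← hnorm, map_neg]; ring)
    rw [neg_eq_zero] at hd
    simp [hd] at hv0
  · rw [hnorm, ← mul_assoc, div_mul_cancel₀ _ hv0]
    simp only [map_sub, map_mul, ← sq']
    ring

/-- Write `P = R² Q` with `Q` squarefree. Replacing `w` by `w / R(x)` keeps the field, and its genus
is `n - deg R`; here `deg R ≤ n` because `2 deg R + deg Q = 2n+1`. So genus `n` means that `R` is
constant. -/
lemma IsQuadraticPair.isHyperellipticOfGenus_iff {K : Type*} [Field K] [Algebra ℂ K] {x w : K}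
    {P : ℂ[X]} (h : IsQuadraticPair x w P) (hn : 2 ≤ n) (hP : P.natDegree = 2 * n + 1) :
    IsHyperellipticOfGenus K n ↔ Squarefree P := by
  constructor
  · rintro ⟨-, hg, -⟩
    obtain ⟨R, Q, hRQ, hQ⟩ := exists_sq_mul_squarefree P h.Q_ne_zero
    have h0 : R ^ 2 * Q ≠ 0 := hRQ ▸ h.Q_ne_zero
    have hd : P.natDegree = 2 * R.natDegree + Q.natDegree := by
      rw [hRQ, natDegree_mul (left_ne_zero_of_mul h0) (right_ne_zero_of_mul h0), natDegree_pow]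
    have hg' := (h.div_of_eq_sq_mul hRQ).geometricGenus_eq hQ (m := n - R.natDegree) (by omega)
    have hR : IsUnit R := by
      rw [isUnit_iff_degree_eq_zero,
        degree_eq_natDegree (pow_ne_zero_iff two_ne_zero |>.1 (left_ne_zero_of_mul h0))]
      exact_mod_cast (by omega : R.natDegree = 0)
    exact hRQ ▸ (Associated.squarefree_iff (associated_unit_mul_left Q _ (hR.pow 2))).2 hQ
  · exact fun hsq => ⟨hn, h.geometricGenus_eq hsq hP, x, h.transcendental, h.finrank_eq_two⟩

end FunctionField

theorem mainTheorem6 (n : ℕ) (hn : 2 ≤ n) :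
    -- `W_{2n}` is the greatest family of multiplicatively closed, `z ^ 2`-stable spaces in `Σ_{2n}`
    IsGreatest
      {X : Set (Submodule ℂ (LaurentSeries ℂ)) |
        X ⊆ nonnegParts n ∧ ∀ U ∈ X, U * U ≤ U ∧ ZSqStable U}
      (hyperellipticSubset n) ∧
    -- each member is a maximal multiplicatively closed subspace of the points containing it
    (∀ U ∈ hyperellipticSubset n, ∀ V ∈ birkhoffStratum (2 * n), U ≤ V →
      ∀ A : Submodule ℂ (LaurentSeries ℂ), A ≤ V → A * A ≤ A → U ≤ A → A = U) ∧
    -- the members are parametrized by `H^{2n+1}_{-2n+1}, H^{2n+1}_{-2n+3}, …, H^{2n+1}_{2n+1}`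
    (∀ v : Fin (2 * n + 1) → ℂ, ∃! U : Submodule ℂ (LaurentSeries ℂ), ∃ H : ℤ → ℤ → ℂ,
      Admissible n H ∧ U = spanSeries n H ∧
        ∀ s : Fin (2 * n + 1), H (2 * n + 1) (2 * ((s : ℕ) - (n : ℤ)) + 1) = v s) ∧
    ∀ H : ℤ → ℤ → ℂ, Admissible n H →
      -- the algebra structure
      LinearIndependent ℂ (fun j : nonnegOrders n => canonicalSeries n H j) ∧
      (∀ m : ℕ, canonicalSeries n H (2 * m) = zPow 2 ^ m) ∧
      (∃ A : Subalgebra ℂ (LaurentSeries ℂ),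
        Subalgebra.toSubmodule A = spanSeries n H ∧ ¬ FiniteDimensional ℂ A ∧
        ∃ φ : CurveRing n H ≃ₐ[ℂ] A,
          (φ (CurveRing.lam n H) : LaurentSeries ℂ) = zPow 2 ∧
          (φ (CurveRing.p n H) : LaurentSeries ℂ) = canonicalSeries n H (2 * n + 1)) ∧
      -- the ideal of the variety `Γ_{2n}`
      (∃ α : ℕ → Polynomial ℂ,
        (∀ m : ℕ, n < m → (α m).Monic ∧ (α m).natDegree = m - n ∧
          canonicalSeries n H (2 * m + 1) =
            Polynomial.aeval (zPow 2) (α m) * canonicalSeries n H (2 * n + 1)) ∧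
        Ideal.span (relationSet n H) = curveIdeal n H α ∧
        MvPolynomial.vanishingIdeal ℂ (gammaVariety n H) = curveIdeal n H α ∧
        RingHom.ker (MvPolynomial.aeval (R := ℂ) (coordSeries n H)) = curveIdeal n H α) ∧
      -- the curve
      IsDomain (CurveRing n H) ∧
      (IsNonsingularCurve (curvePoly n H) ↔ Squarefree (branchPoly n H)) ∧
      ∀ (K : Type) [Field K] [Algebra ℂ K] [Algebra (CurveRing n H) K]
        [IsScalarTower ℂ (CurveRing n H) K] [IsFractionRing (CurveRing n H) K],
        Module.finrank
          (IntermediateField.adjoin ℂ {algebraMap (CurveRing n H) K (CurveRing.lam n H)}) K = 2 ∧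
        doubleCoverArithmeticGenus n (algebraMap (CurveRing n H) K (CurveRing.lam n H))
          (algebraMap (CurveRing n H) K (CurveRing.p n H)) = n ∧
        (IsHyperellipticOfGenus K n ↔ IsNonsingularCurve (curvePoly n H)) := by
  refine ⟨isGreatest_hyperellipticSubset n, fun U hU V hV _ A hAV hA hUA =>
    eq_of_mul_closed_of_le hU hV hAV hA hUA, existsUnique_spanSeries, fun H hH =>
    ⟨linearIndependent_canonicalSeries n H, fun m => by rw [canonicalSeries_even hH.1, zPow_pow],
      exists_subalgebra hH, exists_alpha hH, CurveRing.isDomain hH, isNonsingularCurve_iff n H,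
      fun K _ _ _ _ _ => ?_⟩⟩
  have h := CurveRing.isQuadraticPair hH K
  have hd := branchPoly_natDegree n H
  exact ⟨h.finrank_eq_two, h.doubleCoverArithmeticGenus_eq hd,
    (h.isHyperellipticOfGenus_iff hn hd).trans (isNonsingularCurve_iff n H).symm⟩
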